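/- **Conventions.** A *stratification* of a space is a partition into connected, locally closed subsets (strata); the strata are partially ordered by $e\le e' \iff e\subset\overline{e'}$. It is *normal* if $e\cap\overline{e'}\neq\emptyset$ implies $e\subset\overline{e'}$. A map is strict if it maps strata onto strata. A *globular $n$-cell* is a set $D$ with $\operatorname{Int}D^n\subset D\subset D^n$; a cell structure on a stratum $e$ is a quotient map $\varphi:D\to\overline e$ restricting to a homeomorphism $\operatorname{Int}D^n\to e$. A cellular stratification is a stratification of a Hausdorff space with such cell structures in which $\overline e\setminus e$ is covered by cells of lower dimension. An *aster* is a subset $D\subset D^N$ containing $0$ and, with each $x$, the segment $[0,x]$; its center is $0$, $\partial D=D\cap\partial D^N$, $\operatorname{Int}D=D\setminus\partial D$. A *stellar cell* of stellar dimension $n$ on a stratum $e$ is an aster $D$ with a quotient map $\varphi:D\to\overline e$ restricting to a homeomorphism $\operatorname{Int}D\to e$, together with a stratification of $\partial D$ whose strata are strata of a normal stratification of $\partial D^N$, such that some cellular stratification of $\partial D^N$ contains $\partial D$ as a cellular stratified subspace of dimension $n-1$, with hereditarily quotient cell structures, of which the stratification of $\partial D$ is a coarsening. A *cylindrically normal stellar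 stratified space* is a space $X$ with a normal stratification $\{e_\lambda\}_{\lambda\in P(X)}$, a stellar cell $\varphi_\lambda:D_\lambda\to\overline{e_\lambda}$ on each stratum, such that $\overline{e_\lambda}\setminus e_\lambda$ is covered by strata of smaller stellar dimension, and a cylindrical structure: stratified parameter spaces $P_{\mu,\lambda}$ (empty unless $e_\mu\subset\overline{e_\lambda}$, with $P_{\lambda,\lambda}$ a point), continuous maps $b_{\mu,\lambda}:P_{\mu,\lambda}\times D_\mu\to D_\lambda$ and associative, unital, strict continuous maps $c:P_{\mu,\lambda}\times P_{\nu,\mu}\to P_{\nu,\lambda}$ with $\varphi_\lambda(b_{\mu,\lambda}(p,x))=\varphi_\mu(x)$, $b_{\nu,\lambda}(c(q,p),x)=b_{\mu,\lambda}(q,b_{\nu,\mu}(p,x))$, $b_{\lambda,\lambda}=\mathrm{id}$, such that for $\mu\neq\lambda$ the map $b_{\mu,\lambda}$ is strict as a map to $\partial D_\lambda$ and is an embedding on $P_{\mu,\lambda}\times\operatorname{Int}D_\mu$, and $\partial D_\lambda=\bigcup_{\mu\ne\lambda}b_{\mu,\lambda}(P_{\mu,\lambda}\times\operatorname{Int}D_\mu)$.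 We say *cylindrically normal stellar stratified space in the relaxed sense* if the domains $D_\lambda$ are not required to be embedded in disks: $D_\lambda$ is then a space with a center, a closed subset $\partial D_\lambda$ and a continuous multiplicative radial action of $[0,1]$ contracting it to the center, meeting $\partial D_\lambda$ only at the ends of the radii and injective on the non-central points of these radii; and $\partial D_\lambda$ has an $(n-1)$-dimensional cellular stratification of which its given stratification is a coarsening. *Morphisms* over a monotone map $g$ of face posets consist of continuous maps of spaces, of domains and of parameter spaces which preserve strata and commute with all $\varphi_\lambda$ and $b_{\mu,\lambda}$. A morphism is an *embedding* if all these continuous maps are topological embeddings and $g$ is an order embedding, and an *isomorphism* if they are homeomorphisms and $g$ is an order isomorphism. $X$ is *relatively compact* if every $\varphi_\lambda^{-1}(y)$ is compact, and *CW* if each $\overline{e_\lambda}\setminus e_\lambda$ is covered by finitely many strata and $A\subset X$ is closed as soon as all $A\cap\overline{e_\lambda}$ are closed. A cell is *closed* if $D_\lambda$ is closed in its disk and is the union of its center and the radii ending in $\partial D_\lambda$ (e.g. $D_\lambda=D^N$). The *cylindrical face category* $C(X)$ has objects $P(X)$, morphism spaces $C(X)(\mu,\lambda)=P_{\mu,\lambda}$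 and composition $c$. Let $\operatorname{Sd}(X)=BC(X)=\|\overline N(C(X))\|$ be the realization of its nondegenerate nerve. * The *Salvetti complex* $\operatorname{Sal}(X)$ is $\operatorname{Sd}(X)$ with stratum $\lambda$ formed by the open simplices of chains ending in $\lambda$, domains $D_\lambda^{\operatorname{Sal}}=\|\overline N(C(X)\downarrow\lambda)\|$, boundaries formed by the chains not involving the object $\lambda$, structure maps forgetting the morphisms to $\lambda$, parameter spaces $P_{\mu,\lambda}$ with the maps $c$, and $b^{\operatorname{Sal}}$ given by composition in $C(X)$. * The *stellar dual* $X^{\mathrm{op}}$ is $\operatorname{Sd}(X)$ with stratum $\lambda$ formed by the open simplices of chains starting in $\lambda$, domains $\|\overline N(\lambda\downarrow C(X))\|$, and correspondingly boundaries, structure maps, $P^{\mathrm{op}}_{\mu,\lambda}=P_{\lambda,\mu}$ and $b^{\mathrm{op}}$. So $C(X^{\mathrm{op}})=C(X)^{\mathrm{op}}$. * The *canonical morphism* $i_X:\operatorname{Sal}(X)\to X$ is the morphism over $\mathrm{id}_{P(X)}$ which is the identity on parameter spaces and whose maps $z_\lambda:D^{\operatorname{Sal}}_\lambda\to D_\lambda$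 preserve the centers and are radial on the simplices whose last vertex $v$ is the object $\lambda$: $z_\lambda(st+(1-s)v)=s\,z_\lambda(t)$ for $0\le s\le1$. **Theorem.** Let $X$ be a cylindrically normal stellar stratified space. 1. If all parameter spaces $P_{\mu,\lambda}$ are locally compact, then $\operatorname{Sal}(X)$ is a cylindrically normal stellar stratified space in the relaxed sense. 2. If $X$ is CW and relatively compact, then $\operatorname{Sal}(X)$ is a cylindrically normal stellar stratified space (its domains being realized as asters in disks), and there is a canonical morphism $i_X:\operatorname{Sal}(X)\hookrightarrow X$ which is an embedding of cylindrically normal stellar stratified spaces. 3. If $X$ is CW and all cells of $X$ are closed, then $\operatorname{Sal}(X)$ is a cylindrically normal stellar stratified space (as in 2) and there is a canonical morphism $i_X:\operatorname{Sal}(X)\to X$ which is an isomorphism of cylindrically normal stellar stratified spaces. 4. If $X$ has finitely many strata and is relatively compact, then $X^{\mathrm{op}}$ and $(X^{\mathrm{op}})^{\mathrm{op}}$ are cylindrically normal stellar stratified spaces, and $\operatorname{Sal}(X)=(X^{\mathrm{op}})^{\mathrm{op}}$: there is an isomorphism $\operatorname{Sal}(X)\cong(X^{\mathrm{op}})^{\mathrm{op}}$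 over the identity of $P(X)$ which is the identity on parameter spaces, preserves the centers of the domains, and on underlying spaces is the reversal of chains $BC(X)\cong B(C(X)^{\mathrm{op}})$. In each part, the stellar dimensions and the stratifications of the parameter spaces and of the boundaries of the domains are asserted to exist. -/

import Mathlib

open Set Topology Metric

universe u

/-! ### Stratifications and cells -/

/-- The Euclidean space containing the disk `D^n` and the sphere `S^{n-1}`. -/
abbrev Eucl (n : ℕ) : Type := EuclideanSpace ℝ (Fin n)

/-- A stratification of `Y`, recorded as the collection of its strata: connected, locally closed
subsets which partition `Y`.  The order of the face poset is always
`e ≤ e' ↔ e ⊆ closure e'`, so it need not be recorded. -/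
def IsStratification {Y : Type u} [TopologicalSpace Y] (S : Set (Set Y)) : Prop :=
  (∀ e ∈ S, IsConnected e ∧ IsLocallyClosed e) ∧ S.PairwiseDisjoint id ∧ ⋃₀ S = univ

/-- Normality: a stratum that meets the closure of another one is contained in it. -/
def IsNormalStratification {Y : Type u} [TopologicalSpace Y] (S : Set (Set Y)) : Prop :=
  IsStratification S ∧ ∀ e ∈ S, ∀ e' ∈ S, (e ∩ closure e').Nonempty → e ⊆ closure e'

/-- `S` is a coarsening of `C`: every stratum of `C` lies in a stratum of `S`, and the resulting
map of face posets is monotone. -/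
def IsCoarsening {Y : Type u} [TopologicalSpace Y] (C S : Set (Set Y)) : Prop :=
  (∀ c ∈ C, ∃ e ∈ S, c ⊆ e) ∧
  ∀ c ∈ C, ∀ c' ∈ C, ∀ e ∈ S, ∀ e' ∈ S, c ⊆ e → c' ⊆ e' → c ⊆ closure c' → e ⊆ closure e'

/-- Hereditarily quotient maps. -/
def IsHereditarilyQuotient {A B : Type*} [TopologicalSpace A] [TopologicalSpace B]
    (f : A → B) : Prop :=
  Continuous f ∧ Function.Surjective f ∧ ∀ y, ∀ U : Set A, U ∈ 𝓝ˢ (f ⁻¹' {y}) → f '' U ∈ 𝓝 y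

/-- `(D, φ)` is an `n`-cell structure on `e ⊆ Y`: the domain `D` is a globular `n`-cell (it lies
between the open and the closed unit ball), `φ : D → closure e` is a quotient map, and `φ`
restricts to a homeomorphism from the open ball onto `e`. -/
def IsCellStructure {Y : Type u} [TopologicalSpace Y] (n : ℕ) (e : Set Y)
    (D : Set (Eucl n)) (φ : D → closure e) : Prop :=
  ball 0 1 ⊆ D ∧ D ⊆ closedBall 0 1 ∧ IsQuotientMap φ ∧
  IsEmbedding (fun x : {x : D // (x : Eucl n) ∈ ball (0 : Eucl n) 1} => φ x.1) ∧
  (fun x : D => (φ x : Y)) '' {x | (x : Eucl n) ∈ ball (0 : Eucl n) 1} = e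

/-- A cellular stratification on a (Hausdorff) space, with cell dimensions given by `d`. -/
def IsCellular {Y : Type u} [TopologicalSpace Y] (C : Set (Set Y)) (d : Set Y → ℕ) : Prop :=
  T2Space Y ∧ IsStratification C ∧
  ∀ e ∈ C, (∃ D φ, IsCellStructure (d e) e D φ) ∧ closure e \ e ⊆ ⋃₀ {c ∈ C | d c < d e}

/-- A family of cells, with dimensions given by `d`, has dimension `n - 1`
(with `n = 0` for the empty family). -/
def HasDimPred {Y : Type u} (C : Set (Set Y)) (d : Set Y → ℕ) (n : ℕ) : Prop :=
  (∀ e ∈ C, d e + 1 ≤ n) ∧ (n = 0 ∨ ∃ e ∈ C, d e + 1 = n)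

/-! ### Topological categories with a discrete set of objects, nerves and realizations -/

/-- A category enriched in topological spaces, with object set `L`. -/
structure TopEnrichedCat (L : Type u) where
  Hom : L → L → Type u
  [top : ∀ a b, TopologicalSpace (Hom a b)]
  one : ∀ a, Hom a a
  comp : ∀ {a b c}, Hom b c → Hom a b → Hom a c
  continuous_comp : ∀ a b c, Continuous fun p : Hom b c × Hom a b => comp p.1 p.2
  one_comp : ∀ {a b} (f : Hom a b), comp (one b) f = f
  comp_one : ∀ {a b} (f : Hom a b), comp f (one a) = f
  assoc : ∀ {a b c d} (h : Hom c d) (g : Hom b c) (f : Hom a b),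
    comp (comp h g) f = comp h (comp g f)

attribute [instance] TopEnrichedCat.top

/-- The opposite category. -/
def TopEnrichedCat.op {L : Type u} (K : TopEnrichedCat L) : TopEnrichedCat L where
  Hom a b := K.Hom b a
  one := K.one
  comp f g := K.comp g f
  continuous_comp a b c := (K.continuous_comp c b a).comp continuous_swap
  one_comp f := K.comp_one f
  comp_one f := K.one_comp f
  assoc h g f := (K.assoc f g h).symm

/-- Realization `‖F‖ = (∐ F_n × Δ^n) / ∼` of a `Δ`-space `F` with face maps `r θ`, where `θ` runs
through the injective monotone maps `[m] → [n]`; the relation is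
`(r θ x, t) ∼ (x, θ_* t)`. -/
inductive RealizationRel (F : ℕ → Type u)
    (r : ∀ {m n : ℕ}, (Fin (m + 1) ↪o Fin (n + 1)) → F n → F m) :
    (Σ n, F n × stdSimplex ℝ (Fin (n + 1))) → (Σ n, F n × stdSimplex ℝ (Fin (n + 1))) → Prop
  | face {m n : ℕ} (θ : Fin (m + 1) ↪o Fin (n + 1)) (x : F n) (t : stdSimplex ℝ (Fin (m + 1))) :
      RealizationRel F r ⟨m, (r θ x, t)⟩ ⟨n, (x, stdSimplex.map θ t)⟩

/-- The geometric realization of a `Δ`-space. -/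
def Realization (F : ℕ → Type u)
    (r : ∀ {m n : ℕ}, (Fin (m + 1) ↪o Fin (n + 1)) → F n → F m) : Type u :=
  Quot (RealizationRel F r)

instance (F : ℕ → Type u) [∀ n, TopologicalSpace (F n)]
    (r : ∀ {m n : ℕ}, (Fin (m + 1) ↪o Fin (n + 1)) → F n → F m) :
    TopologicalSpace (Realization F r) :=
  inferInstanceAs (TopologicalSpace (Quot (RealizationRel F r)))

/-- The class `[x, t]` in the realization. -/
def Realization.mk {F : ℕ → Type u}
    (r : ∀ {m n : ℕ}, (Fin (m + 1) ↪o Fin (n + 1)) → F n → F m) {n : ℕ}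
    (x : F n) (t : stdSimplex ℝ (Fin (n + 1))) : Realization F r :=
  Quot.mk _ ⟨n, (x, t)⟩

/-- The map of realizations induced by a map of `Δ`-spaces. -/
def Realization.map {F G : ℕ → Type u}
    {r : ∀ {m n : ℕ}, (Fin (m + 1) ↪o Fin (n + 1)) → F n → F m}
    {s : ∀ {m n : ℕ}, (Fin (m + 1) ↪o Fin (n + 1)) → G n → G m}
    (g : ∀ n, F n → G n)
    (hg : ∀ {m n : ℕ} (θ : Fin (m + 1) ↪o Fin (n + 1)) (x : F n), g m (r θ x) = s θ (g n x)) :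
    Realization F r → Realization G s :=
  Quot.map (fun y => ⟨y.1, (g y.1 y.2.1, y.2.2)⟩) (by
    rintro _ _ ⟨θ, x, t⟩
    simp only [hg]
    exact RealizationRel.face θ (g _ x) t)

/-- Pairs `i < j` of vertices of `[k]`. -/
abbrev EdgeIdx (k : ℕ) : Type := {ij : Fin (k + 1) × Fin (k + 1) // ij.1 < ij.2}

/-- The image of an edge under an injective monotone map. -/
def EdgeIdx.push {m n : ℕ} (θ : Fin (m + 1) ↪o Fin (n + 1)) (ij : EdgeIdx m) : EdgeIdx n :=
  ⟨(θ ij.1.1, θ ij.1.2), θ.strictMono ij.2⟩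

namespace TopEnrichedCat

variable {L : Type u} (K : TopEnrichedCat L)

/-- Nondegenerate `k`-chains, i.e. functors `[k] → K` that send no nonidentity arrow to an
identity; for an acyclic category `K` this says that the objects of the chain are distinct.
The topology is that of `∐_o ∏_{i<j} Hom (o i) (o j)`. -/
def Nerve (k : ℕ) : Type u :=
  {x : Σ o : Fin (k + 1) → L, ∀ ij : EdgeIdx k, K.Hom (o ij.1.1) (o ij.1.2) //
    Function.Injective x.1 ∧
    ∀ (i j l : Fin (k + 1)) (h : i < j) (h' : j < l),
      x.2 ⟨(i, l), h.trans h'⟩ = K.comp (x.2 ⟨(j, l), h'⟩) (x.2 ⟨(i, j), h⟩)}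

instance (k : ℕ) : TopologicalSpace (K.Nerve k) := instTopologicalSpaceSubtype

/-- Face maps of the nondegenerate nerve. -/
def nerveFace {m n : ℕ} (θ : Fin (m + 1) ↪o Fin (n + 1)) (x : K.Nerve n) : K.Nerve m :=
  ⟨⟨x.1.1 ∘ θ, fun ij => x.1.2 (ij.push θ)⟩, x.2.1.comp θ.injective,
    fun _ _ _ h h' => x.2.2 _ _ _ (θ.strictMono h) (θ.strictMono h')⟩

/-- The classifying space `B K = ‖N̄(K)‖` of an acyclic category. -/
def Classifying : Type u := Realization K.Nerve K.nerveFace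

instance : TopologicalSpace K.Classifying :=
  inferInstanceAs (TopologicalSpace (Realization K.Nerve K.nerveFace))

/-- The point `[x, t]` of the classifying space. -/
def pt {k : ℕ} (x : K.Nerve k) (t : stdSimplex ℝ (Fin (k + 1))) : K.Classifying :=
  Realization.mk K.nerveFace x t

/-- The lower star `St_{≤ a}(K)`: the nondegenerate nerve of the comma category `K ↓ a`.  A
`k`-chain is a nondegenerate `k`-chain of `K` with compatible morphisms from its objects
to `a`. -/
def LowerStar (a : L) (k : ℕ) : Type u :=
  {x : Σ o : Fin (k + 1) → L,
      (∀ ij : EdgeIdx k, K.Hom (o ij.1.1) (o ij.1.2)) × (∀ i, K.Hom (o i) a) //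
    (Function.Injective x.1 ∧
    ∀ (i j l : Fin (k + 1)) (h : i < j) (h' : j < l),
      x.2.1 ⟨(i, l), h.trans h'⟩ = K.comp (x.2.1 ⟨(j, l), h'⟩) (x.2.1 ⟨(i, j), h⟩)) ∧
    ∀ ij : EdgeIdx k, x.2.2 ij.1.1 = K.comp (x.2.2 ij.1.2) (x.2.1 ij)}

instance (a : L) (k : ℕ) : TopologicalSpace (K.LowerStar a k) := instTopologicalSpaceSubtype

/-- Face maps of the lower star. -/
def lowerFace (a : L) {m n : ℕ} (θ : Fin (m + 1) ↪o Fin (n + 1)) (x : K.LowerStar a n) :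
    K.LowerStar a m :=
  ⟨⟨x.1.1 ∘ θ, fun ij => x.1.2.1 (ij.push θ), fun i => x.1.2.2 (θ i)⟩,
    ⟨x.2.1.1.comp θ.injective,
      fun _ _ _ h h' => x.2.1.2 _ _ _ (θ.strictMono h) (θ.strictMono h')⟩,
    fun ij => x.2.2 (ij.push θ)⟩

/-- The upper star `St_{≥ a}(K)`: the nondegenerate nerve of the comma category `a ↓ K`. -/
def UpperStar (a : L) (k : ℕ) : Type u :=
  {x : Σ o : Fin (k + 1) → L,
      (∀ ij : EdgeIdx k, K.Hom (o ij.1.1) (o ij.1.2)) × (∀ i, K.Hom a (o i)) //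
    (Function.Injective x.1 ∧
    ∀ (i j l : Fin (k + 1)) (h : i < j) (h' : j < l),
      x.2.1 ⟨(i, l), h.trans h'⟩ = K.comp (x.2.1 ⟨(j, l), h'⟩) (x.2.1 ⟨(i, j), h⟩)) ∧
    ∀ ij : EdgeIdx k, x.2.2 ij.1.2 = K.comp (x.2.1 ij) (x.2.2 ij.1.1)}

instance (a : L) (k : ℕ) : TopologicalSpace (K.UpperStar a k) := instTopologicalSpaceSubtype

/-- Face maps of the upper star. -/
def upperFace (a : L) {m n : ℕ} (θ : Fin (m + 1) ↪o Fin (n + 1)) (x : K.UpperStar a n) :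
    K.UpperStar a m :=
  ⟨⟨x.1.1 ∘ θ, fun ij => x.1.2.1 (ij.push θ), fun i => x.1.2.2 (θ i)⟩,
    ⟨x.2.1.1.comp θ.injective,
      fun _ _ _ h h' => x.2.1.2 _ _ _ (θ.strictMono h) (θ.strictMono h')⟩,
    fun ij => x.2.2 (ij.push θ)⟩

/-- The realization of the lower star. -/
abbrev RealLower (a : L) : Type u := Realization (K.LowerStar a) (K.lowerFace a)

/-- The realization of the upper star. -/
abbrev RealUpper (a : L) : Type u := Realization (K.UpperStar a) (K.upperFace a)

/-- The reversed chain in the opposite category. -/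
def nerveRev {k : ℕ} (x : K.Nerve k) : K.op.Nerve k :=
  ⟨⟨x.1.1 ∘ Fin.rev, fun ij => x.1.2 ⟨(ij.1.2.rev, ij.1.1.rev), Fin.rev_lt_rev.2 ij.2⟩⟩,
    x.2.1.comp Fin.rev_injective,
    fun _ _ _ h h' => x.2.2 _ _ _ (Fin.rev_lt_rev.2 h') (Fin.rev_lt_rev.2 h)⟩

end TopEnrichedCat

/-! ### Cylindrically normal stellar stratified spaces -/

/-- The data underlying a cylindrically normal stellar stratified space `X`: the strata
`e_l = str l`; the cylindrical face category `K`, whose morphism spaces `K.Hom m l` are the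
parameter spaces `P_{m,l}` with the maps `c` as composition; the domains `D l` of the
stellar cells with their centers and boundaries; the structure maps `φ l : D l → X`; and the
maps `b_{m,l} = act : P_{m,l} × D_m → D_l`. -/
structure CylData (X : Type u) [TopologicalSpace X] where
  L : Type u
  str : L → Set X
  K : TopEnrichedCat L
  D : L → Type u
  [topD : ∀ l, TopologicalSpace (D l)]
  center : ∀ l, D l
  bdry : ∀ l, Set (D l)
  φ : ∀ l, D l → X
  act : ∀ {m l}, K.Hom m l → D m → D l

attribute [instance] CylData.topD

namespace CylData

variable {X : Type u} [TopologicalSpace X]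

/-- Stratifications (given by their sets of strata) of the parameter spaces and of the boundaries
of the domains. -/
structure Strats (C : CylData X) where
  par : ∀ m l, Set (Set (C.K.Hom m l))
  bd : ∀ l, Set (Set (C.bdry l))

/-- The axioms of a normal stratification, of structure maps of cells, and of a cylindrical
structure with stratifications `T` of parameter spaces and boundaries. -/
structure IsCylNormal (C : CylData X) (T : C.Strats) : Prop where
  connected : ∀ l, IsConnected (C.str l)
  locallyClosed : ∀ l, IsLocallyClosed (C.str l)
  disjoint : ∀ m l, m ≠ l → Disjoint (C.str m) (C.str l)
  cover : ⋃ l, C.str l = univ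
  normal : ∀ m l, (C.str m ∩ closure (C.str l)).Nonempty → C.str m ⊆ closure (C.str l)
  quotient : ∀ l, ∃ h : ∀ x, C.φ l x ∈ closure (C.str l),
    IsQuotientMap (codRestrict (C.φ l) (closure (C.str l)) h)
  embedding_interior : ∀ l, IsEmbedding fun x : {x // x ∉ C.bdry l} => C.φ l x
  image_interior : ∀ l, C.φ l '' (C.bdry l)ᶜ = C.str l
  hom_self : ∀ l, Subsingleton (C.K.Hom l l)
  le_of_hom : ∀ m l, Nonempty (C.K.Hom m l) → C.str m ⊆ closure (C.str l)
  par_strat : ∀ m l, IsStratification (T.par m l)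
  bd_strat : ∀ l, IsNormalStratification (T.bd l)
  continuous_act : ∀ m l, Continuous fun q : C.K.Hom m l × C.D m => C.act q.1 q.2
  act_interior : ∀ m l, m ≠ l → ∀ p ∈ T.par m l,
    ∃ e ∈ T.bd l, Subtype.val '' e = image2 C.act p (C.bdry m)ᶜ
  act_boundary : ∀ m l, m ≠ l → ∀ p ∈ T.par m l, ∀ e' ∈ T.bd m,
    ∃ e ∈ T.bd l, Subtype.val '' e = image2 C.act p (Subtype.val '' e')
  comp_strict : ∀ a b c, ∀ q ∈ T.par b c, ∀ p ∈ T.par a b,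
    image2 (fun g f => C.K.comp g f) q p ∈ T.par a c
  embedding_act : ∀ m l, m ≠ l →
    IsEmbedding fun q : C.K.Hom m l × {x // x ∉ C.bdry m} => C.act q.1 q.2.1
  φ_act : ∀ m l (p : C.K.Hom m l) x, C.φ l (C.act p x) = C.φ m x
  act_comp : ∀ a b c (q : C.K.Hom b c) (p : C.K.Hom a b) x,
    C.act (C.K.comp q p) x = C.act q (C.act p x)
  act_one : ∀ l x, C.act (C.K.one l) x = x
  bdry_eq : ∀ l, C.bdry l = ⋃ m ∈ {m | m ≠ l}, image2 (C.act (m := m) (l := l)) univ (C.bdry m)ᶜ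

/-- The condition on stellar dimensions: the boundary of an `n`-cell is covered by cells of
dimension at most `n - 1`. -/
def DimCondition (C : CylData X) (dim : C.L → ℕ) : Prop :=
  ∀ l, closure (C.str l) \ C.str l ⊆ ⋃ m ∈ {m | dim m < dim l}, C.str m

/-- A realization of the domains `D l` as asters in disks `D^{N l}`: subsets `S` of the unit disk
with `{0} * {x} ⊆ S` for all `x ∈ S`, centered at `0` and with boundary
`S ∩ ∂ D^{N l}`. -/
structure Asters (C : CylData X) where
  N : C.L → ℕ
  ι : ∀ l, C.D l → Eucl (N l)
  isEmbedding : ∀ l, IsEmbedding (ι l)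
  center : ∀ l, ι l (C.center l) = 0
  norm_le : ∀ l x, ‖ι l x‖ ≤ 1
  star : ∀ l x, ∀ s : ℝ, 0 ≤ s → s ≤ 1 → s • ι l x ∈ range (ι l)
  mem_bdry : ∀ l x, x ∈ C.bdry l ↔ ‖ι l x‖ = 1

/-- The inclusion of `∂ D_l` into the unit sphere. -/
def Asters.toSphere {C : CylData X} (E : C.Asters) (l : C.L) (x : C.bdry l) :
    sphere (0 : Eucl (E.N l)) 1 :=
  ⟨E.ι l x, by simpa using (E.mem_bdry l x).1 x.2⟩

/-- The remaining conditions on a stellar cell whose domain is an aster in a disk `D^N` and has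
stellar dimension `n`: the stratification of `∂ D` is a strict stratified subspace of a normal
stratification of `∂ D^N`, and it is a coarsening of an `(n-1)`-dimensional cellular
stratification of `∂ D`, which is a cellular stratified subspace of a cellular stratification
of `∂ D^N`. -/
def IsStellarCell (C : CylData X) (E : C.Asters) (T : C.Strats) (l : C.L) (n : ℕ) : Prop :=
  (∃ S : Set (Set (sphere (0 : Eucl (E.N l)) 1)), IsNormalStratification S ∧
    ∀ e ∈ T.bd l, E.toSphere l '' e ∈ S) ∧
  ∃ (S : Set (Set (sphere (0 : Eucl (E.N l)) 1))) (d : Set (sphere (0 : Eucl (E.N l)) 1) → ℕ),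
    IsCellular S d ∧
    ⋃₀ {e ∈ S | e ⊆ range (E.toSphere l)} = range (E.toSphere l) ∧
    (∀ e ∈ S, e ⊆ range (E.toSphere l) →
      ∃ D φ, IsCellStructure (d e) e D φ ∧ IsHereditarilyQuotient φ) ∧
    HasDimPred {e ∈ S | e ⊆ range (E.toSphere l)} d n ∧
    IsCoarsening {e ∈ S | e ⊆ range (E.toSphere l)} ((fun e => E.toSphere l '' e) '' T.bd l)

/-- `C`, with domains realized as asters in disks by `E`, is a cylindrically normal stellar
stratified space. -/
def IsCylNormalStellar (C : CylData X) (E : C.Asters) : Prop :=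
  ∃ T : C.Strats, C.IsCylNormal T ∧
    ∃ dim : C.L → ℕ, C.DimCondition dim ∧ ∀ l, C.IsStellarCell E T l (dim l)

/-- An abstract star-shaped cell: a space with a closed boundary and a continuous radial
multiplication by `s ∈ [0,1]`, which contracts the space to the center, and for which only the
ends of the radii lie on the boundary.  No embedding in a disk is required. -/
def IsAbstractAster {S : Type u} [TopologicalSpace S] (center : S) (bdry : Set S) : Prop :=
  IsClosed bdry ∧ ∃ sm : unitInterval → S → S,
    Continuous (fun q : unitInterval × S => sm q.1 q.2) ∧
    (∀ x, sm 1 x = x) ∧ (∀ x, sm 0 x = center) ∧ (∀ s t x, sm (s * t) x = sm s (sm t x)) ∧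
    (∀ s x, sm s x ∈ bdry → s = 1) ∧
    ∀ s t, ∀ x ∈ bdry, ∀ y ∈ bdry, s ≠ 0 → sm s x = sm t y → s = t ∧ x = y

/-- `C` is a cylindrically normal stellar stratified space in the sense in which the domains of
the stellar cells are not required to be embedded in disks. -/
def IsCylNormalAbstractStellar (C : CylData X) : Prop :=
  ∃ T : C.Strats, C.IsCylNormal T ∧
    ∃ dim : C.L → ℕ, C.DimCondition dim ∧
      ∀ l, IsAbstractAster (C.center l) (C.bdry l) ∧
        ∃ (S : Set (Set (C.bdry l))) (d : Set (C.bdry l) → ℕ),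
          IsCellular S d ∧ HasDimPred S d (dim l) ∧ IsCoarsening S (T.bd l)

/-- The CW condition: closure finiteness and weak topology. -/
def IsCW (C : CylData X) : Prop :=
  (∀ l, ∃ s : Set C.L, s.Finite ∧ closure (C.str l) \ C.str l ⊆ ⋃ m ∈ s, C.str m) ∧
  ∀ A : Set X, (∀ l, IsClosed (A ∩ closure (C.str l))) → IsClosed A

/-- Relative compactness: all fibers of the structure maps of the cells are compact. -/
def IsRelativelyCompact (C : CylData X) : Prop :=
  ∀ l y, IsCompact (C.φ l ⁻¹' {y})

/-- All cells are closed: the domain of every cell is a closed subset of its disk and consists of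
the center and of the radii that end in its boundary.  (The whole disk is an example.) -/
def AllCellsClosed (C : CylData X) (E : C.Asters) : Prop :=
  ∀ l, IsClosed (range (E.ι l)) ∧
    ∀ x, x = C.center l ∨ ∃ y ∈ C.bdry l, ∃ s : ℝ, 0 ≤ s ∧ s ≤ 1 ∧ E.ι l x = s • E.ι l y

/-! ### Morphisms -/

/-- A morphism of cylindrically normal stellar stratified spaces with underlying map of face
posets `g`. -/
structure Morphism {Y : Type u} [TopologicalSpace Y] (C : CylData X) (C' : CylData Y)
    (g : C.L → C'.L) where
  map : X → Y
  dom : ∀ l, C.D l → C'.D (g l)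
  par : ∀ {m l}, C.K.Hom m l → C'.K.Hom (g m) (g l)
  continuous_map : Continuous map
  continuous_dom : ∀ l, Continuous (dom l)
  continuous_par : ∀ m l, Continuous (par : C.K.Hom m l → C'.K.Hom (g m) (g l))
  monotone : ∀ m l, C.str m ⊆ closure (C.str l) → C'.str (g m) ⊆ closure (C'.str (g l))
  map_str : ∀ l, MapsTo map (C.str l) (C'.str (g l))
  φ_dom : ∀ l x, C'.φ (g l) (dom l x) = map (C.φ l x)
  dom_act : ∀ m l (p : C.K.Hom m l) x, dom l (C.act p x) = C'.act (par p) (dom m x)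

variable {Y : Type u} [TopologicalSpace Y] {C : CylData X} {C' : CylData Y} {g : C.L → C'.L}

/-- Embeddings of cylindrically normal stellar stratified spaces. -/
structure Morphism.IsEmbedding (F : C.Morphism C' g) : Prop where
  map : Topology.IsEmbedding F.map
  injective : Function.Injective g
  le_of_le : ∀ m l, C'.str (g m) ⊆ closure (C'.str (g l)) → C.str m ⊆ closure (C.str l)
  dom : ∀ l, Topology.IsEmbedding (F.dom l)
  par : ∀ m l, Topology.IsEmbedding (F.par : C.K.Hom m l → C'.K.Hom (g m) (g l))

/-- Isomorphisms of cylindrically normal stellar stratified spaces. -/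
structure Morphism.IsIso (F : C.Morphism C' g) : Prop where
  map : IsHomeomorph F.map
  bijective : Function.Bijective g
  le_of_le : ∀ m l, C'.str (g m) ⊆ closure (C'.str (g l)) → C.str m ⊆ closure (C.str l)
  dom : ∀ l, IsHomeomorph (F.dom l)
  par : ∀ m l, IsHomeomorph (F.par : C.K.Hom m l → C'.K.Hom (g m) (g l))

/-! ### The barycentric subdivision, the Salvetti complex and the stellar dual -/

/-- The barycentric subdivision `Sd(X) = B C(X)`. -/
abbrev Sd (C : CylData X) : Type u := C.K.Classifying

/-- The Salvetti complex: `Sd(X)` stratified by the target map, with domains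
`‖St_{≤ l}(C(X))‖`, boundaries `‖Lk_{< l}(C(X))‖`, structure maps `s_l` (forgetting the morphisms
to `l`), the parameter spaces of `X`, and `b^{Sal}` given by composition in `C(X)`. -/
noncomputable def Sal (C : CylData X) : CylData C.Sd where
  L := C.L
  str l := {x | ∃ (k : ℕ) (u : C.K.Nerve k) (t : stdSimplex ℝ (Fin (k + 1))),
    (∀ i, 0 < t i) ∧ u.1.1 (Fin.last k) = l ∧ x = C.K.pt u t}
  K := C.K
  D l := C.K.RealLower l
  center l := Realization.mk (C.K.lowerFace l) (n := 0)
    ⟨⟨fun _ => l, fun _ => C.K.one l, fun _ => C.K.one l⟩,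
      ⟨fun _ _ _ => Subsingleton.elim (α := Fin 1) _ _, fun _ _ _ _ _ => (C.K.one_comp _).symm⟩,
      fun _ => (C.K.one_comp _).symm⟩
    (stdSimplex.vertex 0)
  bdry l := {x | ∃ (k : ℕ) (u : C.K.LowerStar l k) (t : stdSimplex ℝ (Fin (k + 1))),
    (∀ i, u.1.1 i ≠ l) ∧ x = Realization.mk (C.K.lowerFace l) u t}
  φ l := Realization.map (fun _ u => ⟨⟨u.1.1, u.1.2.1⟩, u.2.1⟩) (fun _ _ => rfl)
  act q := Realization.map
    (fun _ u => ⟨⟨u.1.1, u.1.2.1, fun i => C.K.comp q (u.1.2.2 i)⟩, u.2.1, fun ij => by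
      simp only [u.2.2 ij, C.K.assoc]⟩) (fun _ _ => rfl)

/-- The stellar dual `X^op`: `Sd(X)` stratified by the source map, with domains
`‖St_{≥ l}(C(X))‖`, boundaries `‖Lk_{> l}(C(X))‖`, structure maps `t_l` (forgetting the morphisms
from `l`), parameter spaces `P^op_{m,l} = P_{l,m}`, and `b^op` given by composition in `C(X)`. -/
noncomputable def dual (C : CylData X) : CylData C.Sd where
  L := C.L
  str l := {x | ∃ (k : ℕ) (u : C.K.Nerve k) (t : stdSimplex ℝ (Fin (k + 1))),
    (∀ i, 0 < t i) ∧ u.1.1 0 = l ∧ x = C.K.pt u t}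
  K := C.K.op
  D l := C.K.RealUpper l
  center l := Realization.mk (C.K.upperFace l) (n := 0)
    ⟨⟨fun _ => l, fun _ => C.K.one l, fun _ => C.K.one l⟩,
      ⟨fun _ _ _ => Subsingleton.elim (α := Fin 1) _ _, fun _ _ _ _ _ => (C.K.one_comp _).symm⟩,
      fun _ => (C.K.one_comp _).symm⟩
    (stdSimplex.vertex 0)
  bdry l := {x | ∃ (k : ℕ) (u : C.K.UpperStar l k) (t : stdSimplex ℝ (Fin (k + 1))),
    (∀ i, u.1.1 i ≠ l) ∧ x = Realization.mk (C.K.upperFace l) u t}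
  φ l := Realization.map (fun _ u => ⟨⟨u.1.1, u.1.2.1⟩, u.2.1⟩) (fun _ _ => rfl)
  act {m l} (q : C.K.Hom l m) := Realization.map
    (fun _ u => ⟨⟨u.1.1, u.1.2.1, fun i => C.K.comp (u.1.2.2 i) q⟩, u.2.1, fun ij => by
      simp only [u.2.2 ij, C.K.assoc]⟩) (fun _ _ => rfl)

/-- A morphism `Sal(X) → X` over the identity of the face poset is the canonical one, `i_X`, if it
is the identity on parameter spaces, preserves the centers of the domains, and maps the simplices
of `D_l^{Sal}` with last vertex `1_l` radially into the aster `D_l`: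
`z_l [u, s t + (1 - s) v_k] = s z_l [u, t]`. -/
structure IsCanonical (C : CylData X) (E : C.Asters)
    (F : C.Sal.Morphism C (fun l => l)) : Prop where
  par : ∀ m l (p : C.K.Hom m l), F.par (m := m) (l := l) p = p
  center : ∀ l, F.dom l (C.Sal.center l) = C.center l
  radial : ∀ (l : C.L) (k : ℕ) (u : C.K.LowerStar l k), u.1.1 (Fin.last k) = l →
    ∀ (s : ℝ) (t t' : stdSimplex ℝ (Fin (k + 1))), 0 ≤ s → s ≤ 1 →
      (∀ i, t' i = s * t i + (1 - s) * (if i = Fin.last k then 1 else 0)) →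
      E.ι l (F.dom l (Realization.mk (C.K.lowerFace l) u t')) =
        s • E.ι l (F.dom l (Realization.mk (C.K.lowerFace l) u t))

end CylData

/-!
The Salvetti complex `C.Sal` depends only on the cylindrical face category `K = C.K`
(`TopEnrichedCat.salvetti`), and the only facts about `K` that are needed are collected in
`TopEnrichedCat.IsTame`: the endomorphism spaces are points, the stellar dimension is a rank
function, and the morphism spaces embed in Euclidean spaces, because `P_{m,l}` embeds in the aster
`D_l` by acting on the center of `D_m`.

The classifying space of `K` and the domains `D_l` of the Salvetti complex are realizations of
chains with elements in a right module over `K`, the trivial one and `Hom(-, l)` respectively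
(`RightModule.Real`).  Such a realization is controlled by three devices.

* *Coordinates.*  Barycentric coordinates, and Euclidean coordinates of the morphisms of a chain
  weighted by barycentric coordinates, are continuous and separate points (`IsTame.ext_of_coord`).
  Hence the realizations of lower stars are Hausdorff and each of their points lies in exactly one
  open simplex.
* *Truncation.*  Cutting a chain at an object `m` is a continuous inverse of the action `M(m) × Int
  D_m → M.Real`, which is therefore an embedding (`RightModule.isEmbedding_smul`).  Local
  compactness of `M(m)` gives the continuity of the action.
* *Closed subcomplexes.*  The closure of the stratum `P × Int D_m` consists of the chains whose
  elements lie in the closure of the family generated by `P` (`RightModule.closure_stratum`).  This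
  turns the order relations and normality into statements about the morphism spaces.

The domain `D_l` is a cone over the link of `l`, and its radial multiplication is linear in all
coordinates not involving `l`, which makes it well defined (`IsTame.radial`).  The open simplices
of the link form a cellular stratification of the boundary, and lengths of chains provide the
stellar dimensions.  This proves the first assertion.  If the morphism spaces are compact and only
finitely many objects map to `l`, then `D_l` is compact, and normalizing the vector of its
homogeneous coordinates to length `1 - t_l`, where `t_l` is the barycentric coordinate of `l`,
realizes it as an aster in a disk (`IsTame.asters`); the cells of the boundary are completed to a
cellular stratification of the sphere by the points of the complement.  Compactness of `P_{m,l}`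
holds since it is homeomorphic to the fiber of `φ_l` over the image of the center of `D_m`;
compactness also shows that the stratifications of the parameter spaces of `X` are normal in the
required sense (`TopEnrichedCat.isParStratification_of_compact`).

The maps `z_l` of the canonical morphism are defined by recursion on the rank: a point of a
boundary is `g w` with unique `g : m → l` and `w` in the interior of the domain of `m`, its image
is `g z_m(w)`, and this is extended radially (`Asters.canonicalMap`).  Continuity, injectivity and,
for closed cells, surjectivity follow by induction.  Since the domains are compact, these maps are
embeddings, and the weak topology of a CW space makes the induced map of spaces a closed map.

Finally, reversal of chains identifies the stellar dual of `X` with the Salvetti complex of the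
opposite category (`CylData.dual_eq_transport`).  For finitely many strata, the opposite category
has the same properties as `K`, so the results above apply to it, and reversing twice gives the
isomorphism from the Salvetti complex to the double dual.
-/

/-! ### Simplices and realizations -/

theorem stdSimplex.map_apply_of_injective {X Y : Type*} [Fintype X] [Fintype Y] {f : X → Y}
    (hf : Function.Injective f) (t : stdSimplex ℝ X) (x : X) : stdSimplex.map f t (f x) = t x := by
  classical
  rw [stdSimplex.map_coe, FunOnFinite.linearMap_apply_apply,
    Finset.sum_eq_single x]
  · intro y hy hyx
    exact absurd (hf (by simpa using hy)) hyx
  · simp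

theorem stdSimplex.map_apply_of_notMem_range {X Y : Type*} [Fintype X] [Fintype Y] {f : X → Y}
    (t : stdSimplex ℝ X) {y : Y} (hy : y ∉ range f) : stdSimplex.map f t y = 0 := by
  classical
  rw [stdSimplex.map_coe, FunOnFinite.linearMap_apply_apply]
  apply Finset.sum_eq_zero
  intro x hx
  exact absurd ⟨x, by simpa using hx⟩ hy

/-- A point of a simplex that is supported on a face is the image of a point of that face. -/
theorem stdSimplex.exists_map_eq {X Y : Type*} [Fintype X] [Fintype Y] {f : X → Y}
    (hf : Function.Injective f) (t : stdSimplex ℝ Y) (ht : ∀ y ∉ range f, t y = 0) :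
    ∃ s : stdSimplex ℝ X, stdSimplex.map f s = t ∧ ∀ x, s x = t (f x) := by
  classical
  have hsum : ∑ x, t (f x) = 1 := by
    rw [← stdSimplex.sum_eq_one t]
    exact Fintype.sum_of_injective f hf _ _ ht (fun _ => rfl)
  refine ⟨⟨fun x => t (f x), fun x => t.2.1 _, hsum⟩, ?_, fun x => rfl⟩
  ext y
  by_cases hy : y ∈ range f
  · obtain ⟨x, rfl⟩ := hy
    exact stdSimplex.map_apply_of_injective hf _ x
  · rw [stdSimplex.map_apply_of_notMem_range _ hy, ht y hy]

/-- The point of the simplex with homogeneous coordinates `w`; if `w` is not a nonzero nonnegative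
vector, the value is a vertex and has no meaning. -/
noncomputable def stdSimplex.normalize {n : ℕ} (w : Fin (n + 1) → ℝ) :
    stdSimplex ℝ (Fin (n + 1)) :=
  open Classical in
  if h : (∀ i, 0 ≤ w i) ∧ 0 < ∑ i, w i then
    ⟨fun i => w i / ∑ i, w i, fun i => div_nonneg (h.1 i) h.2.le, by
      rw [← Finset.sum_div]; exact div_self h.2.ne'⟩
  else stdSimplex.vertex 0

theorem stdSimplex.normalize_apply {n : ℕ} {w : Fin (n + 1) → ℝ} (h0 : ∀ i, 0 ≤ w i)
    (h1 : 0 < ∑ i, w i) (i : Fin (n + 1)) :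
    stdSimplex.normalize w i = w i / ∑ i, w i := by
  rw [stdSimplex.normalize, dif_pos ⟨h0, h1⟩]
  rfl

@[simp]
theorem stdSimplex.normalize_coe {n : ℕ} (t : stdSimplex ℝ (Fin (n + 1))) :
    stdSimplex.normalize (fun i => t i) = t := by
  ext i
  have h : ∑ i, t.1 i = 1 := t.2.2
  refine (stdSimplex.normalize_apply t.2.1 (by rw [h]; exact one_pos) i).trans ?_
  rw [h, div_one]
  rfl

theorem stdSimplex.continuous_apply {X : Type*} [Fintype X] (i : X) :
    Continuous fun t : stdSimplex ℝ X => t i :=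
  (_root_.continuous_apply i).comp continuous_subtype_val

theorem stdSimplex.continuousOn_normalize {n : ℕ} :
    ContinuousOn (stdSimplex.normalize (n := n)) {w | (∀ i, 0 ≤ w i) ∧ 0 < ∑ i, w i} := by
  rw [continuousOn_iff_continuous_domRestrict]
  refine continuous_induced_rng.2 (continuous_pi fun i => ?_)
  have : Continuous fun w : {w : Fin (n + 1) → ℝ | (∀ i, 0 ≤ w i) ∧ 0 < ∑ i, w i} =>
      w.1 i / ∑ i, w.1 i :=
    Continuous.div ((_root_.continuous_apply i).comp continuous_subtype_val)
      (continuous_finsetSum _ fun i _ => (_root_.continuous_apply i).comp continuous_subtype_val)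
      fun w => w.2.2.ne'
  exact this.congr fun w => (stdSimplex.normalize_apply w.2.1 w.2.2 i).symm

/-- Pushing weights forward does not change sums against coefficients. -/
theorem stdSimplex.sum_map {X Y : Type*} [Fintype X] [Fintype Y] {f : X → Y}
    (hf : Function.Injective f) (t : stdSimplex ℝ X) (F : Y → ℝ → ℝ) (hF : ∀ y, F y 0 = 0) :
    ∑ x, F (f x) (t x) = ∑ y, F y (stdSimplex.map f t y) := by
  refine Fintype.sum_of_injective f hf _ _ (fun y hy => ?_) (fun x => ?_)
  · rw [stdSimplex.map_apply_of_notMem_range t hy, hF]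
  · rw [stdSimplex.map_apply_of_injective hf]

theorem stdSimplex.exists_pos {X : Type*} [Fintype X] (t : stdSimplex ℝ X) : ∃ i, 0 < t i := by
  by_contra! h
  have : ∑ i, t i ≤ 0 := Finset.sum_nonpos fun i _ => h i
  rw [stdSimplex.sum_eq_one] at this
  exact absurd this (by norm_num)

/-- Every point of a simplex lies in the interior of a face. -/
theorem stdSimplex.exists_pos_map {n : ℕ} (t : stdSimplex ℝ (Fin (n + 1))) :
    ∃ (m : ℕ) (θ : Fin (m + 1) ↪o Fin (n + 1)) (s : stdSimplex ℝ (Fin (m + 1))),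
      (∀ i, 0 < s i) ∧ stdSimplex.map θ s = t := by
  classical
  -- `θ` enumerates the support of `t`.
  let S : Finset (Fin (n + 1)) := Finset.univ.filter fun i => 0 < t i
  obtain ⟨i₀, hi₀⟩ := stdSimplex.exists_pos t
  have hS : S.card ≠ 0 := Finset.card_ne_zero_of_mem (a := i₀) (by simpa [S] using hi₀)
  obtain ⟨k, hk⟩ := Nat.exists_eq_succ_of_ne_zero hS
  let θ := S.orderEmbOfFin hk
  have hr : ∀ i, i ∈ range θ ↔ 0 < t i := fun i => by
    rw [Finset.range_orderEmbOfFin]; simp [S]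
  obtain ⟨s, hs, hs'⟩ := stdSimplex.exists_map_eq θ.injective t fun y hy =>
    le_antisymm (not_lt.1 fun h => hy ((hr y).2 h)) (stdSimplex.zero_le t y)
  refine ⟨k, θ, s, fun i => ?_, hs⟩
  rw [hs']; exact (hr _).1 ⟨i, rfl⟩

namespace Realization

variable {F : ℕ → Type u} {r : ∀ {m n : ℕ}, (Fin (m + 1) ↪o Fin (n + 1)) → F n → F m}

theorem mk_face {m n : ℕ} (θ : Fin (m + 1) ↪o Fin (n + 1)) (x : F n)
    (t : stdSimplex ℝ (Fin (m + 1))) : mk r (r θ x) t = mk r x (stdSimplex.map θ t) :=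
  Quot.sound (RealizationRel.face θ x t)

/-- Every point of a realization lies in an open simplex. -/
theorem exists_pos (x : Realization F r) :
    ∃ (n : ℕ) (u : F n) (t : stdSimplex ℝ (Fin (n + 1))), (∀ i, 0 < t i) ∧ x = mk r u t := by
  obtain ⟨⟨n, u, t⟩, rfl⟩ := Quot.exists_rep x
  obtain ⟨k, θ, s, hs, rfl⟩ := stdSimplex.exists_pos_map t
  exact ⟨k, r θ u, s, hs, (mk_face θ u s).symm⟩

variable [∀ n, TopologicalSpace (F n)]

theorem isQuotientMap_quot : IsQuotientMap (Quot.mk (RealizationRel F r)) :=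
  isQuotientMap_quot_mk

theorem continuous_mk (n : ℕ) :
    Continuous fun p : F n × stdSimplex ℝ (Fin (n + 1)) => mk r p.1 p.2 :=
  (continuous_quot_mk (r := RealizationRel F r)).comp
    (continuous_sigmaMk (σ := fun n => F n × stdSimplex ℝ (Fin (n + 1))) (i := n))

theorem isOpen_iff {s : Set (Realization F r)} :
    IsOpen s ↔ ∀ n, IsOpen {p : F n × stdSimplex ℝ (Fin (n + 1)) | mk r p.1 p.2 ∈ s} := by
  have : IsOpen s ↔ IsOpen (Quot.mk (RealizationRel F r) ⁻¹' s) :=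
    (isQuotientMap_quot.isOpen_preimage).symm
  rw [this, isOpen_sigma_iff]
  rfl

theorem isClosed_iff {s : Set (Realization F r)} :
    IsClosed s ↔ ∀ n, IsClosed {p : F n × stdSimplex ℝ (Fin (n + 1)) | mk r p.1 p.2 ∈ s} := by
  rw [← isOpen_compl_iff, isOpen_iff]
  simp only [← isOpen_compl_iff]
  rfl

theorem continuous_iff {Z : Type*} [TopologicalSpace Z] {f : Realization F r → Z} :
    Continuous f ↔
      ∀ n, Continuous fun p : F n × stdSimplex ℝ (Fin (n + 1)) => f (mk r p.1 p.2) := by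
  have : Continuous f ↔ Continuous (f ∘ Quot.mk (RealizationRel F r)) :=
    isQuotientMap_quot.continuous_iff
  rw [this, continuous_sigma_iff]
  rfl

/-- Maps on a product with a locally compact space are continuous as soon as they are continuous
on the simplices; local compactness makes the product of a quotient map with the identity a
quotient map. -/
theorem continuous_prod_iff {Z T : Type*} [TopologicalSpace Z] [TopologicalSpace T]
    [LocallyCompactSpace T] {f : T × Realization F r → Z}
    (h : ∀ n, Continuous fun p : T × (F n × stdSimplex ℝ (Fin (n + 1))) =>
      f (p.1, mk r p.2.1 p.2.2)) : Continuous f := by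
  refine (isQuotientMap_quot (F := F) (r := r)).continuous_lift_prod_right ?_
  have e : Continuous fun p : (Σ n, F n × stdSimplex ℝ (Fin (n + 1))) × T =>
      f (p.2, Quot.mk (RealizationRel F r) p.1) := by
    have h2 : ∀ n, Continuous fun p : (F n × stdSimplex ℝ (Fin (n + 1))) × T =>
        f (p.2, mk r p.1.1 p.1.2) := fun n => (h n).comp continuous_swap
    refine continuous_iff_continuousAt.2 fun ⟨⟨n, q⟩, τ⟩ => ?_
    have ho := (IsOpenEmbedding.sigmaMk (σ := fun n => F n × stdSimplex ℝ (Fin (n + 1)))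
      (i := n)).prodMap (IsOpenEmbedding.id (X := T))
    exact (ho.continuousAt_iff (x := (q, τ))).1 (h2 n).continuousAt
  exact e.comp continuous_swap

theorem continuous_map {G : ℕ → Type u} [∀ n, TopologicalSpace (G n)]
    {s : ∀ {m n : ℕ}, (Fin (m + 1) ↪o Fin (n + 1)) → G n → G m} (g : ∀ n, F n → G n)
    (hg : ∀ {m n : ℕ} (θ : Fin (m + 1) ↪o Fin (n + 1)) (x : F n), g m (r θ x) = s θ (g n x))
    (h : ∀ n, Continuous (g n)) : Continuous (map (r := r) (s := s) g hg) :=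
  continuous_iff.2 fun n => (continuous_mk (r := s) n).comp (((h n).comp continuous_fst).prodMk
    continuous_snd)

end Realization

theorem stdSimplex.map_normalize {m n : ℕ} {θ : Fin (m + 1) → Fin (n + 1)}
    (hθ : Function.Injective θ) {w : Fin (m + 1) → ℝ} {w' : Fin (n + 1) → ℝ}
    (h0 : ∀ i, 0 ≤ w i) (h1 : 0 < ∑ i, w i) (h : ∀ i, w' (θ i) = w i)
    (h' : ∀ j ∉ range θ, w' j = 0) :
    stdSimplex.map θ (stdSimplex.normalize w) = stdSimplex.normalize w' := by
  have hs : ∑ i, w i = ∑ j, w' j :=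
    Fintype.sum_of_injective θ hθ _ _ h' fun i => (h i).symm
  have h0' : ∀ j, 0 ≤ w' j := fun j => by
    by_cases hj : j ∈ range θ
    · obtain ⟨i, rfl⟩ := hj
      rw [h]; exact h0 i
    · rw [h' j hj]
  ext j
  rw [stdSimplex.normalize_apply h0' (hs ▸ h1)]
  by_cases hj : j ∈ range θ
  · obtain ⟨i, rfl⟩ := hj
    rw [stdSimplex.map_apply_of_injective hθ, stdSimplex.normalize_apply h0 h1, h, hs]
  · rw [stdSimplex.map_apply_of_notMem_range _ hj, h' j hj, zero_div]

/-- The inclusion of the initial segment `{0, …, j}` of `{0, …, n}`. -/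
def initEmb {n : ℕ} (j : Fin (n + 1)) : Fin (j.val + 1) ↪o Fin (n + 1) :=
  Fin.castLEOrderEmb (Nat.succ_le_of_lt j.2)

theorem initEmb_le {n : ℕ} (j : Fin (n + 1)) (i : Fin (j.val + 1)) : initEmb j i ≤ j :=
  Fin.le_def.2 (Nat.le_of_lt_succ i.2)

theorem mem_range_initEmb {n : ℕ} {j i : Fin (n + 1)} : i ∈ range (initEmb j) ↔ i ≤ j := by
  constructor
  · rintro ⟨k, rfl⟩
    exact initEmb_le j k
  · intro h
    exact ⟨⟨i.1, Nat.lt_succ_of_le h⟩, rfl⟩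

/-! ### Right modules over a topological category -/

namespace TopEnrichedCat

variable {L : Type u}

/-- A right module (a presheaf of spaces) over `K`.  Chains of `K` with compatible elements of a
module are a common generalization of the nerve (for the trivial module) and of the lower stars
(for the representable modules). -/
structure RightModule (K : TopEnrichedCat L) where
  G : L → Type u
  [top : ∀ a, TopologicalSpace (G a)]
  act : ∀ {a b}, G b → K.Hom a b → G a
  continuous_act : ∀ a b, Continuous fun q : G b × K.Hom a b => act q.1 q.2
  act_one : ∀ {a} (g : G a), act g (K.one a) = g
  act_comp : ∀ {a b c} (g : G c) (h : K.Hom b c) (f : K.Hom a b),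
    act g (K.comp h f) = act (act g h) f

attribute [instance] RightModule.top

/-- The module `Hom(-, l)`. -/
abbrev repr (K : TopEnrichedCat L) (l : L) : K.RightModule where
  G a := K.Hom a l
  act g f := K.comp g f
  continuous_act a b := K.continuous_comp a b l
  act_one g := K.comp_one g
  act_comp g h f := (K.assoc g h f).symm

/-- The module all of whose spaces are points. -/
abbrev trivialModule (K : TopEnrichedCat L) : K.RightModule where
  G _ := PUnit
  act _ _ := PUnit.unit
  continuous_act _ _ := continuous_const
  act_one _ := rfl
  act_comp _ _ _ := rfl

/-- Transport of morphisms along equalities of objects. -/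
def castHom (K : TopEnrichedCat L) {a a' b b' : L} (ha : a = a') (hb : b = b')
    (f : K.Hom a b) : K.Hom a' b' := ha ▸ hb ▸ f

theorem continuous_castHom (K : TopEnrichedCat L) {a a' b b' : L} (ha : a = a') (hb : b = b') :
    Continuous (K.castHom ha hb) := by
  subst ha hb
  exact continuous_id

theorem comp_castHom (K : TopEnrichedCat L) {a a' b b' c c' : L} (ha : a = a') (hb : b = b')
    (hc : c = c') (g : K.Hom b c) (f : K.Hom a b) :
    K.comp (K.castHom hb hc g) (K.castHom ha hb f) = K.castHom ha hc (K.comp g f) := by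
  subst ha hb hc
  rfl

section homTo

variable {K : TopEnrichedCat L} {k : ℕ} {o : Fin (k + 1) → L}

/-- The morphism from vertex `i` to vertex `j ≥ i` of a chain with edges `f`; for `i = j` this is
the identity. -/
def homTo (f : ∀ ij : EdgeIdx k, K.Hom (o ij.1.1) (o ij.1.2)) (i j : Fin (k + 1)) (h : i ≤ j) :
    K.Hom (o i) (o j) :=
  if h' : i < j then f ⟨(i, j), h'⟩ else
    K.castHom rfl (congrArg o (le_antisymm h (not_lt.1 h'))) (K.one (o i))

theorem homTo_self (f : ∀ ij : EdgeIdx k, K.Hom (o ij.1.1) (o ij.1.2)) (i : Fin (k + 1)) :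
    homTo f i i le_rfl = K.one (o i) := by
  rw [homTo, dif_neg (lt_irrefl i)]
  rfl

theorem homTo_of_lt (f : ∀ ij : EdgeIdx k, K.Hom (o ij.1.1) (o ij.1.2)) {i j : Fin (k + 1)}
    (h : i < j) : homTo f i j h.le = f ⟨(i, j), h⟩ := dif_pos h

theorem comp_homTo {f : ∀ ij : EdgeIdx k, K.Hom (o ij.1.1) (o ij.1.2)}
    (hf : ∀ (i j l : Fin (k + 1)) (h : i < j) (h' : j < l),
      f ⟨(i, l), h.trans h'⟩ = K.comp (f ⟨(j, l), h'⟩) (f ⟨(i, j), h⟩))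
    {i j l : Fin (k + 1)} (h : i ≤ j) (h' : j ≤ l) :
    K.comp (homTo f j l h') (homTo f i j h) = homTo f i l (h.trans h') := by
  rcases h.eq_or_lt with rfl | h
  · rw [homTo_self, K.comp_one]
  rcases h'.eq_or_lt with rfl | h'
  · rw [homTo_self, K.one_comp]
  rw [homTo_of_lt f h, homTo_of_lt f h', homTo_of_lt f (h.trans h'), hf i j l h h']

theorem homTo_push {m : ℕ} (f : ∀ ij : EdgeIdx k, K.Hom (o ij.1.1) (o ij.1.2))
    (θ : Fin (m + 1) ↪o Fin (k + 1)) (i j : Fin (m + 1)) (h : i ≤ j) :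
    homTo (o := o ∘ θ) (fun ij => f (ij.push θ)) i j h = homTo f (θ i) (θ j) (θ.monotone h) := by
  rcases h.eq_or_lt with rfl | h
  · exact (homTo_self (o := o ∘ θ) (fun ij => f (ij.push θ)) i).trans (homTo_self f (θ i)).symm
  · exact (homTo_of_lt (o := o ∘ θ) (fun ij => f (ij.push θ)) h).trans
      (homTo_of_lt f (θ.strictMono h)).symm

theorem continuous_homTo (i j : Fin (k + 1)) (h : i ≤ j) :
    Continuous fun f : ∀ ij : EdgeIdx k, K.Hom (o ij.1.1) (o ij.1.2) => homTo f i j h := by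
  rcases h.eq_or_lt with rfl | h
  · simp only [homTo_self]; exact continuous_const
  · simp only [homTo_of_lt _ h]; exact _root_.continuous_apply _

end homTo

namespace RightModule

variable {K : TopEnrichedCat L} (M : K.RightModule)

/-- The conditions on objects, edges and elements that define a chain with elements in `M`. -/
def IsChain {k : ℕ} (o : Fin (k + 1) → L)
    (p : (∀ ij : EdgeIdx k, K.Hom (o ij.1.1) (o ij.1.2)) × (∀ i, M.G (o i))) : Prop :=
  (Function.Injective o ∧
    ∀ (i j l : Fin (k + 1)) (h : i < j) (h' : j < l),
      p.1 ⟨(i, l), h.trans h'⟩ = K.comp (p.1 ⟨(j, l), h'⟩) (p.1 ⟨(i, j), h⟩)) ∧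
    ∀ ij : EdgeIdx k, p.2 ij.1.1 = M.act (p.2 ij.1.2) (p.1 ij)

/-- Nondegenerate `k`-chains of `K` with compatible elements of `M` at their objects; for
`M = K.repr l` this unfolds to `K.LowerStar l k`. -/
def Chain (k : ℕ) : Type u :=
  {x : Σ o : Fin (k + 1) → L,
      (∀ ij : EdgeIdx k, K.Hom (o ij.1.1) (o ij.1.2)) × (∀ i, M.G (o i)) // M.IsChain x.1 x.2}

instance (k : ℕ) : TopologicalSpace (M.Chain k) := instTopologicalSpaceSubtype

variable {M}

/-- The objects of a chain. -/
abbrev Chain.obj {k : ℕ} (u : M.Chain k) : Fin (k + 1) → L := u.1.1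

/-- The morphisms of a chain. -/
abbrev Chain.edge {k : ℕ} (u : M.Chain k) : ∀ ij : EdgeIdx k, K.Hom (u.obj ij.1.1) (u.obj ij.1.2) :=
  u.1.2.1

/-- The elements of the module at the objects of a chain. -/
abbrev Chain.elt {k : ℕ} (u : M.Chain k) : ∀ i, M.G (u.obj i) := u.1.2.2

theorem Chain.elt_eq {k : ℕ} (u : M.Chain k) {i j : Fin (k + 1)} (h : i ≤ j) :
    u.elt i = M.act (u.elt j) (homTo u.edge i j h) := by
  rcases h.eq_or_lt with rfl | h
  · rw [homTo_self, M.act_one]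
  · rw [homTo_of_lt _ h]; exact u.2.2 ⟨(i, j), h⟩

/-- Chains with given objects. -/
abbrev ofFiber {k : ℕ} (o : Fin (k + 1) → L) (p : {p // M.IsChain o p}) : M.Chain k :=
  ⟨⟨o, p.1⟩, p.2⟩

theorem isOpenEmbedding_ofFiber {k : ℕ} (o : Fin (k + 1) → L) :
    IsOpenEmbedding (ofFiber (M := M) o) := by
  have h1 : IsInducing ((Subtype.val : M.Chain k → _) ∘ ofFiber (M := M) o) :=
    (IsOpenEmbedding.sigmaMk (σ := fun o : Fin (k + 1) → L =>
      (∀ ij : EdgeIdx k, K.Hom (o ij.1.1) (o ij.1.2)) × (∀ i, M.G (o i)))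
      (i := o)).isInducing.comp IsInducing.subtypeVal
  refine ⟨⟨IsInducing.of_comp_iff IsInducing.subtypeVal |>.1 h1, ?_⟩, ?_⟩
  · intro p q h
    have := congrArg Subtype.val h
    simpa [Subtype.ext_iff] using this
  · have : range (ofFiber (M := M) o) = Subtype.val ⁻¹' (Sigma.fst ⁻¹' {o}) := by
      ext v
      constructor
      · rintro ⟨p, rfl⟩
        rfl
      · intro hv
        obtain ⟨⟨o', p⟩, hp⟩ := v
        obtain rfl : o' = o := hv
        exact ⟨⟨p, hp⟩, rfl⟩
    rw [this]
    exact (isOpen_sigma_fst_preimage _).preimage continuous_subtype_val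

/-- Continuity on spaces of chains can be checked for fixed objects. -/
theorem Chain.continuous_prod {k : ℕ} {T Z : Type*} [TopologicalSpace T] [TopologicalSpace Z]
    {f : M.Chain k × T → Z}
    (h : ∀ o, Continuous fun q : {p // M.IsChain o p} × T => f (ofFiber o q.1, q.2)) :
    Continuous f := by
  refine continuous_iff_continuousAt.2 fun ⟨⟨⟨o, p⟩, hp⟩, t⟩ => ?_
  have ho := (isOpenEmbedding_ofFiber (M := M) o).prodMap (IsOpenEmbedding.id (X := T))
  exact (ho.continuousAt_iff (x := (⟨p, hp⟩, t))).1 (h o).continuousAt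

theorem Chain.isOpen_prod {k : ℕ} {T : Type*} [TopologicalSpace T] {s : Set (M.Chain k × T)}
    (h : ∀ o, IsOpen {q : {p // M.IsChain o p} × T | (ofFiber o q.1, q.2) ∈ s}) : IsOpen s := by
  have : Continuous fun q => q ∈ s := Chain.continuous_prod fun o => continuous_Prop.2 (h o)
  exact continuous_Prop.1 this

theorem Chain.isClosed_prod {k : ℕ} {T : Type*} [TopologicalSpace T] {s : Set (M.Chain k × T)}
    (h : ∀ o, IsClosed {q : {p // M.IsChain o p} × T | (ofFiber o q.1, q.2) ∈ s}) :
    IsClosed s :=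
  isOpen_compl_iff.1 (Chain.isOpen_prod fun o => (h o).isOpen_compl)

variable (M)

/-- Face maps. -/
def face {m n : ℕ} (θ : Fin (m + 1) ↪o Fin (n + 1)) (x : M.Chain n) : M.Chain m :=
  ⟨⟨x.1.1 ∘ θ, fun ij => x.1.2.1 (ij.push θ), fun i => x.1.2.2 (θ i)⟩,
    ⟨x.2.1.1.comp θ.injective,
      fun _ _ _ h h' => x.2.1.2 _ _ _ (θ.strictMono h) (θ.strictMono h')⟩,
    fun ij => x.2.2 (ij.push θ)⟩

/-- The realization of the space of chains with elements in `M`. -/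
abbrev Real : Type u := Realization M.Chain M.face

variable {M}

/-- The point of the realization given by a chain and barycentric coordinates. -/
abbrev mkPt {k : ℕ} (x : M.Chain k) (t : stdSimplex ℝ (Fin (k + 1))) : M.Real :=
  Realization.mk M.face x t

variable (M)

/-- Acting with `g ∈ M(m)` on a chain over `m`. -/
def smulChain {m : L} (g : M.G m) {k : ℕ} (u : (K.repr m).Chain k) : M.Chain k :=
  ⟨⟨u.1.1, u.1.2.1, fun i => M.act g (u.1.2.2 i)⟩, u.2.1, fun ij => by
    change M.act g (u.1.2.2 ij.1.1) = _
    rw [u.2.2 ij]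
    exact M.act_comp _ _ _⟩

/-- The map from the realization of the lower star of `m` to that of `M` given by `g ∈ M(m)`.  For
`M = K.repr l` these are the maps `b` of the Salvetti complex, and for the trivial module this is
the structure map of the cell of `m`. -/
def smul {m : L} (g : M.G m) : (K.repr m).Real → M.Real :=
  Realization.map (fun _ u => M.smulChain g u) (fun _ _ => rfl)

theorem smul_pt {m : L} (g : M.G m) {k : ℕ} (u : (K.repr m).Chain k)
    (t : stdSimplex ℝ (Fin (k + 1))) : M.smul g (mkPt u t) = mkPt (M.smulChain g u) t := rfl

variable {M}

theorem pt_face {m n : ℕ} (θ : Fin (m + 1) ↪o Fin (n + 1)) (x : M.Chain n)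
    (t : stdSimplex ℝ (Fin (m + 1))) : mkPt (M.face θ x) t = mkPt x (stdSimplex.map θ t) :=
  Realization.mk_face θ x t

/-- The initial part of a chain up to the object with index `j`, as a chain over that object. -/
def trunc {n : ℕ} (u : M.Chain n) (j : Fin (n + 1)) : (K.repr (u.obj j)).Chain j.val :=
  ⟨⟨fun i => u.obj (initEmb j i), fun ij => u.edge (ij.push (initEmb j)),
    fun i => homTo u.edge (initEmb j i) j (initEmb_le j i)⟩,
    ⟨u.2.1.1.comp (initEmb j).injective,
      fun _ _ _ h h' => u.2.1.2 _ _ _ ((initEmb j).strictMono h) ((initEmb j).strictMono h')⟩,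
    fun ij => by
      have h := comp_homTo u.2.1.2 ((initEmb j).monotone ij.2.le) (initEmb_le j ij.1.2)
      rw [homTo_of_lt _ ((initEmb j).strictMono ij.2)] at h
      exact h.symm⟩

/-- The point of the realization over the object with index `j` whose coordinates are proportional
to the first ones of `t`. -/
noncomputable def truncPt {n : ℕ} (u : M.Chain n) (j : Fin (n + 1))
    (t : stdSimplex ℝ (Fin (n + 1))) : (K.repr (u.obj j)).Real :=
  mkPt (trunc u j) (stdSimplex.normalize fun i => t (initEmb j i))

theorem sum_initEmb_pos {n : ℕ} {j : Fin (n + 1)} {t : stdSimplex ℝ (Fin (n + 1))} {i : Fin (n + 1)}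
    (hi : i ≤ j) (h : 0 < t i) : 0 < ∑ i, t (initEmb j i) := by
  obtain ⟨k, rfl⟩ := mem_range_initEmb.2 hi
  exact h.trans_le (Finset.single_le_sum (f := fun i => t (initEmb j i))
    (fun i _ => stdSimplex.zero_le t _) (Finset.mem_univ k))

/-- Truncation at a vertex of positive weight is compatible with the identifications made in the
realization, so it descends to the open star of an object. -/
theorem truncPt_face {m n : ℕ} (θ : Fin (m + 1) ↪o Fin (n + 1)) (u : M.Chain n)
    (t : stdSimplex ℝ (Fin (m + 1))) (i : Fin (m + 1)) (hi : 0 < t i) :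
    truncPt (M.face θ u) i t = truncPt u (θ i) (stdSimplex.map θ t) := by
  -- The restriction of `θ` to the initial segments that end in `i` and `θ i`.
  let θ' : Fin (i.val + 1) ↪o Fin ((θ i).val + 1) :=
    OrderEmbedding.ofStrictMono
      (fun x => ⟨(θ (initEmb i x)).val, Nat.lt_succ_of_le (θ.monotone (initEmb_le i x))⟩)
      (fun x y h => θ.strictMono ((initEmb i).strictMono h))
  have hθ' : ∀ x, initEmb (θ i) (θ' x) = θ (initEmb i x) := fun x => rfl
  have h1 : trunc (M.face θ u) i = (K.repr (u.obj (θ i))).face θ' (trunc u (θ i)) := by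
    refine Subtype.ext (Sigma.ext rfl (heq_of_eq (Prod.ext rfl (funext fun x => ?_))))
    exact homTo_push u.edge θ (initEmb i x) i (initEmb_le i x)
  have h2 : stdSimplex.map θ' (stdSimplex.normalize fun x => t (initEmb i x)) =
      stdSimplex.normalize fun x => stdSimplex.map θ t (initEmb (θ i) x) := by
    refine stdSimplex.map_normalize θ'.injective (fun x => stdSimplex.zero_le t _)
      (sum_initEmb_pos le_rfl hi) (fun x => ?_) (fun y hy => ?_)
    · rw [hθ', stdSimplex.map_apply_of_injective θ.injective]
    · refine stdSimplex.map_apply_of_notMem_range _ ?_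
      rintro ⟨x, hx⟩
      have hxi : x ≤ i := by
        rw [← θ.le_iff_le, hx]
        exact initEmb_le _ _
      obtain ⟨x', rfl⟩ := mem_range_initEmb.2 hxi
      exact hy ⟨x', (initEmb (θ i)).injective hx⟩
  have h3 : truncPt (M.face θ u) i t = mkPt ((K.repr (u.obj (θ i))).face θ' (trunc u (θ i)))
      (stdSimplex.normalize fun x => t (initEmb i x)) := congrArg (fun v =>
      mkPt v (stdSimplex.normalize fun x => t (initEmb i x))) h1
  rw [h3, pt_face, h2]
  rfl

theorem smulChain_trunc {n : ℕ} (u : M.Chain n) (j : Fin (n + 1)) :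
    M.smulChain (u.elt j) (trunc u j) = M.face (initEmb j) u := by
  refine Subtype.ext (Sigma.ext rfl (heq_of_eq (Prod.ext rfl (funext fun x => ?_))))
  exact (u.elt_eq (initEmb_le j x)).symm

/-- A point of a simplex is recovered from its truncation at the last object in its support. -/
theorem smul_truncPt {n : ℕ} (u : M.Chain n) (j : Fin (n + 1)) (t : stdSimplex ℝ (Fin (n + 1)))
    (h : ∀ i, j < i → t i = 0) : M.smul (u.elt j) (truncPt u j t) = mkPt u t := by
  rw [truncPt, smul_pt, smulChain_trunc, pt_face]
  congr 1
  refine (stdSimplex.map_normalize (w' := fun i => t i) (initEmb j).injective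
    (fun x => stdSimplex.zero_le t _) ?_ (fun x => rfl) fun i hi => h i ?_).trans ?_
  · obtain ⟨i, hi⟩ := stdSimplex.exists_pos t
    exact sum_initEmb_pos (not_lt.1 fun hj => hi.ne' (h i hj)) hi
  · exact not_le.1 fun hij => hi (mem_range_initEmb.2 hij)
  · exact stdSimplex.normalize_coe t

theorem truncPt_smulChain {m : L} (g : M.G m) {n : ℕ} (u : (K.repr m).Chain n) (j : Fin (n + 1))
    (t : stdSimplex ℝ (Fin (n + 1))) : truncPt (M.smulChain g u) j t = truncPt u j t := rfl

theorem continuousOn_truncPt {n : ℕ} (o : Fin (n + 1) → L) (j : Fin (n + 1)) :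
    ContinuousOn (Y := (K.repr (o j)).Real)
      (fun q : {p // M.IsChain o p} × stdSimplex ℝ (Fin (n + 1)) =>
      truncPt (ofFiber o q.1) j q.2) {q | 0 < ∑ i, q.2 (initEmb j i)} := by
  have h1 : Continuous (Y := (K.repr (o j)).Chain j.val)
      fun p : {p // M.IsChain o p} => trunc (ofFiber o p) j := by
    have hf : Continuous fun p : {p // M.IsChain o p} => p.1.1 :=
      continuous_fst.comp continuous_subtype_val
    have h1 : Continuous fun p : {p // M.IsChain o p} =>
        fun ij : EdgeIdx j.val => p.1.1 (ij.push (initEmb j)) :=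
      continuous_pi fun ij => continuous_pi_iff.1 hf (ij.push (initEmb j))
    have h2 : Continuous fun p : {p // M.IsChain o p} =>
        fun i : Fin (j.val + 1) => homTo p.1.1 (initEmb j i) j (initEmb_le j i) :=
      continuous_pi fun i => (continuous_homTo (initEmb j i) j (initEmb_le j i)).comp hf
    exact continuous_induced_rng.2 ((continuous_sigmaMk (σ := fun o' : Fin (j.val + 1) → L =>
      (∀ ij : EdgeIdx j.val, K.Hom (o' ij.1.1) (o' ij.1.2)) × (∀ i, K.Hom (o' i) (o j)))
      (i := fun i => o (initEmb j i))).comp (h1.prodMk h2))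
  have h2 : ContinuousOn (fun q : {p // M.IsChain o p} × stdSimplex ℝ (Fin (n + 1)) =>
      stdSimplex.normalize fun i => q.2 (initEmb j i)) {q | 0 < ∑ i, q.2 (initEmb j i)} := by
    refine stdSimplex.continuousOn_normalize.comp (f := fun q : {p // M.IsChain o p} ×
      stdSimplex ℝ (Fin (n + 1)) => fun i => q.2 (initEmb j i)) (Continuous.continuousOn ?_) ?_
    · exact continuous_pi fun i => (stdSimplex.continuous_apply _).comp continuous_snd
    · exact fun q hq => ⟨fun i => stdSimplex.zero_le q.2 _, hq⟩
  exact (Realization.continuous_mk (r := (K.repr (o j)).face) j.val).comp_continuousOn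
    ((h1.comp continuous_fst).continuousOn.prodMk h2)

theorem smul_comp {l m : L} (p : K.Hom m l) (g : M.G l) (x : (K.repr m).Real) :
    M.smul g ((K.repr l).smul p x) = M.smul (M.act g p) x := by
  obtain ⟨n, u, t, -, rfl⟩ := Realization.exists_pos x
  rw [smul_pt, smul_pt, smul_pt]
  refine congrArg (fun v => mkPt v t) ?_
  refine Subtype.ext (Sigma.ext rfl (heq_of_eq (Prod.ext rfl (funext fun i => ?_))))
  exact M.act_comp g p (u.elt i)

theorem one_smul {l : L} (x : (K.repr l).Real) : (K.repr l).smul (K.one l) x = x := by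
  obtain ⟨n, u, t, -, rfl⟩ := Realization.exists_pos x
  rw [smul_pt]
  refine congrArg (fun v => mkPt v t) ?_
  refine Subtype.ext (Sigma.ext rfl (heq_of_eq (Prod.ext rfl (funext fun i => ?_))))
  exact K.one_comp _

theorem continuous_smulChain {m : L} (n : ℕ) :
    Continuous fun q : M.G m × (K.repr m).Chain n => M.smulChain q.1 q.2 := by
  suffices Continuous fun q : (K.repr m).Chain n × M.G m => M.smulChain q.2 q.1 from
    this.comp continuous_swap
  refine Chain.continuous_prod fun o => ?_
  refine Continuous.subtype_mk ((continuous_sigmaMk (σ := fun o : Fin (n + 1) → L =>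
      (∀ ij : EdgeIdx n, K.Hom (o ij.1.1) (o ij.1.2)) × (∀ i, M.G (o i))) (i := o)).comp
      (Continuous.prodMk (continuous_fst.comp (continuous_subtype_val.comp continuous_fst))
      (continuous_pi fun i => (M.continuous_act _ _).comp (continuous_snd.prodMk ?_)))) _
  exact (_root_.continuous_apply i).comp (continuous_snd.comp
    (continuous_subtype_val.comp continuous_fst))

theorem continuous_smul_right {m : L} (g : M.G m) : Continuous (M.smul g) :=
  Realization.continuous_map (fun _ u => M.smulChain g u) (fun _ _ => rfl) fun n =>
    (continuous_smulChain n).comp (continuous_const.prodMk continuous_id)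

theorem continuous_smul_left {m : L} (x : (K.repr m).Real) :
    Continuous fun g : M.G m => M.smul g x := by
  obtain ⟨n, u, t, -, rfl⟩ := Realization.exists_pos x
  exact (Realization.continuous_mk (r := M.face) n).comp
    (((continuous_smulChain n).comp (continuous_id.prodMk continuous_const)).prodMk
      continuous_const)

/-- Joint continuity needs local compactness, since the realization is a quotient space. -/
theorem continuous_smul {m : L} [LocallyCompactSpace (M.G m)] :
    Continuous fun q : M.G m × (K.repr m).Real => M.smul q.1 q.2 :=
  Realization.continuous_prod_iff fun n => (Realization.continuous_mk (r := M.face) n).comp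
    (((continuous_smulChain n).comp (continuous_fst.prodMk
      (continuous_fst.comp continuous_snd))).prodMk (continuous_snd.comp continuous_snd))

end RightModule

end TopEnrichedCat

/-! ### Coordinates on realizations -/

namespace TopEnrichedCat

variable {L : Type u}

namespace RightModule

variable {K : TopEnrichedCat L} {M : K.RightModule}

/-- Transport of elements of a module along an equality of objects. -/
def castElt (M : K.RightModule) {a b : L} (h : a = b) (g : M.G a) : M.G b := h ▸ g

theorem continuous_castElt {a b : L} (h : a = b) : Continuous (M.castElt h) := by
  subst h
  exact continuous_id

/-- The value `w_i ψ(g_i)`, where `i` is the index of the object `a` in the chain, and `0` if `a`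
does not occur. -/
noncomputable def Chain.eltSum {n : ℕ} (u : M.Chain n) (a : L) (ψ : M.G a → ℝ)
    (w : Fin (n + 1) → ℝ) : ℝ :=
  open Classical in
  ∑ i, if h : u.obj i = a then w i * ψ (M.castElt h (u.elt i)) else 0

/-- The value `min w_i w_j * ψ(f_{ij})`, where `i` and `j` are the indices of the objects `a` and
`b` in the chain, and `0` if there is no such edge.  The minimum makes this vanish on the faces not
containing both vertices, and homogeneous of degree one in the weights. -/
noncomputable def Chain.edgeSum {n : ℕ} (u : M.Chain n) (a b : L) (ψ : K.Hom a b → ℝ)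
    (w : Fin (n + 1) → ℝ) : ℝ :=
  open Classical in
  ∑ ij : EdgeIdx n, if h : u.obj ij.1.1 = a ∧ u.obj ij.1.2 = b then
    min (w ij.1.1) (w ij.1.2) * ψ (K.castHom h.1 h.2 (u.edge ij)) else 0

theorem Chain.eltSum_obj {n : ℕ} (u : M.Chain n) (i : Fin (n + 1)) (ψ : M.G (u.obj i) → ℝ)
    (w : Fin (n + 1) → ℝ) : u.eltSum (u.obj i) ψ w = w i * ψ (u.elt i) := by
  rw [Chain.eltSum, Finset.sum_eq_single i]
  · rw [dif_pos rfl]; rfl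
  · intro k _ hk
    exact dif_neg fun h => hk (u.2.1.1 h)
  · simp

theorem Chain.eltSum_eq_zero {n : ℕ} (u : M.Chain n) {a : L} (h : ∀ i, u.obj i ≠ a)
    (ψ : M.G a → ℝ) (w : Fin (n + 1) → ℝ) : u.eltSum a ψ w = 0 :=
  Finset.sum_eq_zero fun i _ => dif_neg (h i)

theorem Chain.edgeSum_obj {n : ℕ} (u : M.Chain n) (ij : EdgeIdx n)
    (ψ : K.Hom (u.obj ij.1.1) (u.obj ij.1.2) → ℝ) (w : Fin (n + 1) → ℝ) :
    u.edgeSum (u.obj ij.1.1) (u.obj ij.1.2) ψ w = min (w ij.1.1) (w ij.1.2) * ψ (u.edge ij) := by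
  rw [Chain.edgeSum, Finset.sum_eq_single ij]
  · rw [dif_pos ⟨rfl, rfl⟩]; rfl
  · intro k _ hk
    exact dif_neg fun h => hk (Subtype.ext (Prod.ext (u.2.1.1 h.1) (u.2.1.1 h.2)))
  · simp

theorem Chain.eltSum_face {m n : ℕ} (θ : Fin (m + 1) ↪o Fin (n + 1)) (x : M.Chain n)
    (t : stdSimplex ℝ (Fin (m + 1))) (a : L) (ψ : M.G a → ℝ) :
    (M.face θ x).eltSum a ψ (fun i => t i) = x.eltSum a ψ fun i => stdSimplex.map θ t i := by
  classical
  exact stdSimplex.sum_map θ.injective t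
    (fun i s => if h : x.obj i = a then s * ψ (M.castElt h (x.elt i)) else 0)
    fun y => by split <;> simp

theorem Chain.edgeSum_face {m n : ℕ} (θ : Fin (m + 1) ↪o Fin (n + 1)) (x : M.Chain n)
    (w : Fin (m + 1) → ℝ) (w' : Fin (n + 1) → ℝ) (h : ∀ i, w' (θ i) = w i)
    (a b : L) (ψ : K.Hom a b → ℝ)
    (h' : ∀ ij ∉ range (EdgeIdx.push θ), min (w' ij.1.1) (w' ij.1.2) = 0 ∨ x.obj ij.1.1 ≠ a ∨
      x.obj ij.1.2 ≠ b) :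
    (M.face θ x).edgeSum a b ψ w = x.edgeSum a b ψ w' := by
  have hinj : Function.Injective (EdgeIdx.push θ) := fun ij ij' h => by
    have h1 := congrArg (fun k => k.1.1) h
    have h2 := congrArg (fun k => k.1.2) h
    exact Subtype.ext (Prod.ext (θ.injective h1) (θ.injective h2))
  refine Fintype.sum_of_injective (EdgeIdx.push θ) hinj _ _ (fun ij hij => ?_) (fun ij => ?_)
  · split_ifs with hab
    · rcases h' ij hij with h0 | h0 | h0
      · rw [h0, zero_mul]
      · exact absurd hab.1 h0
      · exact absurd hab.2 h0
    · rfl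
  · rw [← h, ← h]
    rfl

/-- The coordinate `t_a ψ(g_a)` of a point of the realization. -/
noncomputable def eltCoord (M : K.RightModule) (a : L) (ψ : M.G a → ℝ) : M.Real → ℝ :=
  Quot.lift (fun x => x.2.1.eltSum a ψ fun i => x.2.2 i) (by
    rintro _ _ ⟨θ, x, t⟩
    exact Chain.eltSum_face θ x t a ψ)

/-- The coordinate `min t_a t_b * ψ(f_{ab})` of a point of the realization. -/
noncomputable def edgeCoord (M : K.RightModule) (a b : L) (ψ : K.Hom a b → ℝ) : M.Real → ℝ :=
  Quot.lift (fun x => x.2.1.edgeSum a b ψ fun i => x.2.2 i) (by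
    rintro _ _ ⟨θ, x, t⟩
    refine Chain.edgeSum_face θ x _ _ (fun i => stdSimplex.map_apply_of_injective θ.injective t i)
      a b ψ fun ij hij => Or.inl ?_
    by_cases h1 : ij.1.1 ∈ range θ
    · by_cases h2 : ij.1.2 ∈ range θ
      · obtain ⟨i, hi⟩ := h1
        obtain ⟨j, hj⟩ := h2
        refine absurd ⟨⟨(i, j), ?_⟩, ?_⟩ hij
        · rw [← θ.lt_iff_lt, hi, hj]; exact ij.2
        · exact Subtype.ext (Prod.ext hi hj)
      · exact (congrArg _ (stdSimplex.map_apply_of_notMem_range t h2)).trans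
          (min_eq_right (stdSimplex.zero_le _ _))
    · exact (congrArg (min · _) (stdSimplex.map_apply_of_notMem_range t h1)).trans
        (min_eq_left (stdSimplex.zero_le _ _)))

/-- The barycentric coordinate of the object `a`. -/
noncomputable def wt (M : K.RightModule) (a : L) : M.Real → ℝ := M.eltCoord a fun _ => 1

theorem eltCoord_pt (a : L) (ψ : M.G a → ℝ) {n : ℕ} (u : M.Chain n)
    (t : stdSimplex ℝ (Fin (n + 1))) : M.eltCoord a ψ (mkPt u t) = u.eltSum a ψ fun i => t i := rfl

theorem edgeCoord_pt (a b : L) (ψ : K.Hom a b → ℝ) {n : ℕ} (u : M.Chain n)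
    (t : stdSimplex ℝ (Fin (n + 1))) :
    M.edgeCoord a b ψ (mkPt u t) = u.edgeSum a b ψ fun i => t i := rfl

theorem continuous_eltCoord (a : L) {ψ : M.G a → ℝ} (hψ : Continuous ψ) :
    Continuous (M.eltCoord a ψ) := by
  refine Realization.continuous_iff.2 fun n => Chain.continuous_prod fun o => ?_
  simp only [eltCoord_pt, Chain.eltSum]
  refine continuous_finsetSum _ fun i _ => ?_
  by_cases h : o i = a
  · simp only [dif_pos h]
    refine ((stdSimplex.continuous_apply i).comp continuous_snd).mul
      (hψ.comp ((continuous_castElt h).comp ?_))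
    exact continuous_pi_iff.1 (continuous_snd.comp (continuous_subtype_val.comp continuous_fst)) i
  · simp only [dif_neg h]
    exact continuous_const

theorem continuous_edgeCoord (a b : L) {ψ : K.Hom a b → ℝ} (hψ : Continuous ψ) :
    Continuous (M.edgeCoord a b ψ) := by
  refine Realization.continuous_iff.2 fun n => Chain.continuous_prod fun o => ?_
  simp only [edgeCoord_pt, Chain.edgeSum]
  refine continuous_finsetSum _ fun ij _ => ?_
  by_cases h : o ij.1.1 = a ∧ o ij.1.2 = b
  · simp only [dif_pos h]
    refine (((stdSimplex.continuous_apply _).comp continuous_snd).min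
      ((stdSimplex.continuous_apply _).comp continuous_snd)).mul
      (hψ.comp ((K.continuous_castHom h.1 h.2).comp ?_))
    exact continuous_pi_iff.1 (continuous_fst.comp (continuous_subtype_val.comp continuous_fst)) ij
  · simp only [dif_neg h]
    exact continuous_const

theorem continuous_wt (a : L) : Continuous (M.wt a) := continuous_eltCoord a continuous_const

theorem wt_obj {n : ℕ} (u : M.Chain n) (t : stdSimplex ℝ (Fin (n + 1))) (i : Fin (n + 1)) :
    M.wt (u.obj i) (mkPt u t) = t i := by
  rw [wt, eltCoord_pt, Chain.eltSum_obj, mul_one]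

theorem wt_eq_zero {n : ℕ} (u : M.Chain n) (t : stdSimplex ℝ (Fin (n + 1))) {a : L}
    (h : ∀ i, u.obj i ≠ a) : M.wt a (mkPt u t) = 0 :=
  (eltCoord_pt a _ u t).trans (Chain.eltSum_eq_zero u h _ _)

theorem wt_pos_iff {n : ℕ} {u : M.Chain n} {t : stdSimplex ℝ (Fin (n + 1))} {a : L} :
    0 < M.wt a (mkPt u t) ↔ ∃ i, u.obj i = a ∧ 0 < t i := by
  constructor
  · intro h
    by_contra! h'
    by_cases ha : ∃ i, u.obj i = a
    · obtain ⟨i, rfl⟩ := ha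
      rw [wt_obj] at h
      exact absurd h (not_lt.2 (h' i rfl))
    · rw [wt_eq_zero u t fun i hi => ha ⟨i, hi⟩] at h
      exact lt_irrefl _ h
  · rintro ⟨i, rfl, hi⟩
    rwa [wt_obj]

theorem wt_nonneg (a : L) (x : M.Real) : 0 ≤ M.wt a x := by
  obtain ⟨n, u, t, -, rfl⟩ := Realization.exists_pos x
  by_cases ha : ∃ i, u.obj i = a
  · obtain ⟨i, rfl⟩ := ha
    rw [wt_obj]; exact stdSimplex.zero_le t i
  · rw [wt_eq_zero u t fun i hi => ha ⟨i, hi⟩]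

theorem wt_smul (a : L) {m : L} (g : M.G m) (x : (K.repr m).Real) :
    M.wt a (M.smul g x) = (K.repr m).wt a x := by
  obtain ⟨n, u, t, -, rfl⟩ := Realization.exists_pos x
  rfl

end RightModule

/-! ### Acyclic categories with Euclidean morphism spaces -/

/-- An acyclic topological category with a rank function, whose morphism spaces embed in Euclidean
spaces.  The cylindrical face category of a cylindrically normal stellar stratified space has these
properties. -/
structure IsTame (K : TopEnrichedCat L) : Prop where
  subsingleton : ∀ l, Subsingleton (K.Hom l l)
  exists_rank : ∃ h : L → ℕ, ∀ m l, m ≠ l → Nonempty (K.Hom m l) → h m < h l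
  exists_embedding : ∀ a b, ∃ (N : ℕ) (j : K.Hom a b → Eucl N), IsEmbedding j

variable {K : TopEnrichedCat L}

theorem IsTame.antisymm (hK : K.IsTame) {m l : L} (f : K.Hom m l) (g : K.Hom l m) : m = l := by
  obtain ⟨h, hh⟩ := hK.exists_rank
  by_contra hne
  exact lt_asymm (hh m l hne ⟨f⟩) (hh l m (Ne.symm hne) ⟨g⟩)

theorem IsTame.eq_one (hK : K.IsTame) {l : L} (f : K.Hom l l) : f = K.one l :=
  (hK.subsingleton l).elim _ _

theorem IsTame.t2Space_hom (hK : K.IsTame) (a b : L) : T2Space (K.Hom a b) := by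
  obtain ⟨N, j, hj⟩ := hK.exists_embedding a b
  exact hj.t2Space

/-- The dimension of a Euclidean space containing `Hom(a, b)`. -/
noncomputable def IsTame.homDim (hK : K.IsTame) (a b : L) : ℕ := (hK.exists_embedding a b).choose

/-- A Euclidean embedding of `Hom(a, b)`. -/
noncomputable def IsTame.homEmb (hK : K.IsTame) (a b : L) : K.Hom a b → Eucl (hK.homDim a b) :=
  (hK.exists_embedding a b).choose_spec.choose

theorem IsTame.isEmbedding_homEmb (hK : K.IsTame) (a b : L) : IsEmbedding (hK.homEmb a b) :=
  (hK.exists_embedding a b).choose_spec.choose_spec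

theorem IsTame.continuous_homEmb_apply (hK : K.IsTame) (a b : L) (c : Fin (hK.homDim a b)) :
    Continuous fun f => hK.homEmb a b f c :=
  (EuclideanSpace.proj (𝕜 := ℝ) c).continuous.comp (hK.isEmbedding_homEmb a b).continuous

theorem IsTame.homEmb_ext (hK : K.IsTame) {a b : L} {f g : K.Hom a b}
    (h : ∀ c, hK.homEmb a b f c = hK.homEmb a b g c) : f = g :=
  (hK.isEmbedding_homEmb a b).injective (PiLp.ext h)

/-- The objects strictly below `l`. -/
abbrev Below (K : TopEnrichedCat L) (l : L) : Type u := {a : L // a ≠ l ∧ Nonempty (K.Hom a l)}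

/-- Indices of the homogeneous coordinates on the realization of the lower star of `l`. -/
abbrev IsTame.CoordIdx (hK : K.IsTame) (l : L) : Type u :=
  K.Below l ⊕ (Σ a : K.Below l, Fin (hK.homDim a l)) ⊕
    (Σ ab : K.Below l × K.Below l, Fin (hK.homDim ab.1 ab.2))

open RightModule

/-- The homogeneous coordinates on the realization of the lower star of `l`: barycentric
coordinates, and Euclidean coordinates of morphisms weighted by barycentric coordinates. -/
noncomputable def IsTame.coord (hK : K.IsTame) (l : L) : hK.CoordIdx l → (K.repr l).Real → ℝ
  | .inl a => (K.repr l).wt a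
  | .inr (.inl ⟨a, c⟩) => (K.repr l).eltCoord a fun f => hK.homEmb a l f c
  | .inr (.inr ⟨ab, c⟩) => (K.repr l).edgeCoord ab.1 ab.2 fun f => hK.homEmb ab.1 ab.2 f c

theorem IsTame.continuous_coord (hK : K.IsTame) (l : L) (i : hK.CoordIdx l) :
    Continuous (hK.coord l i) := by
  rcases i with a | ⟨a, c⟩ | ⟨ab, c⟩
  · exact continuous_wt _
  · exact continuous_eltCoord (M := K.repr l) _ (hK.continuous_homEmb_apply _ _ c)
  · exact continuous_edgeCoord _ _ (hK.continuous_homEmb_apply _ _ c)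

/-- In a chain over `l`, only the last object can be `l`. -/
theorem IsTame.obj_ne (hK : K.IsTame) {l : L} {n : ℕ} (u : (K.repr l).Chain n) {i j : Fin (n + 1)}
    (h : i < j) : u.obj i ≠ l := by
  intro hi
  have e : K.Hom l (u.obj j) := K.castHom hi rfl (u.edge ⟨(i, j), h⟩)
  have := hK.antisymm e (u.elt j)
  exact h.ne (u.2.1.1 (hi.trans this))

/-- A composition with an endomorphism of `l` only transports along the equality of objects. -/
theorem IsTame.comp_end (hK : K.IsTame) {a b l : L} (h : b = l) (g : K.Hom b l) (f : K.Hom a b) :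
    K.comp g f = K.castHom rfl h f := by
  subst h
  rw [hK.eq_one g, K.one_comp]
  rfl

theorem castHom_injective {a a' b b' : L} (ha : a = a') (hb : b = b') :
    Function.Injective (K.castHom ha hb) := by
  subst ha hb
  exact fun _ _ h => h

/-- The rank function orders the objects of a chain, so that a chain is determined by the set of its
objects and its morphisms. -/
theorem IsTame.obj_eq_of_range_eq (hK : K.IsTame) {M : K.RightModule} {n : ℕ} {u u' : M.Chain n}
    (h : range u.obj = range u'.obj) : u.obj = u'.obj := by
  obtain ⟨r, hr⟩ := hK.exists_rank
  have hm : ∀ v : M.Chain n, StrictMono (r ∘ v.obj) := fun v i j hij =>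
    hr _ _ (fun h => hij.ne (v.2.1.1 h)) ⟨v.edge ⟨(i, j), hij⟩⟩
  have he : r ∘ u.obj = r ∘ u'.obj :=
    StrictMono.range_inj (hm u) (hm u') |>.1 (by rw [range_comp, range_comp, h])
  funext i
  obtain ⟨k, hk⟩ : u'.obj i ∈ range u.obj := h ▸ mem_range_self i
  have h1 : r (u.obj k) = r (u.obj i) := by rw [hk]; exact (congrFun he i).symm
  rw [← hk, (hm u).injective h1]

/-- The homogeneous coordinates and the coordinate of `l` determine the open simplex that contains
a point, and the point. -/
theorem IsTame.eq_of_coord_eq (hK : K.IsTame) {l : L} {n n' : ℕ} {u : (K.repr l).Chain n}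
    {u' : (K.repr l).Chain n'} {t : stdSimplex ℝ (Fin (n + 1))} {t' : stdSimplex ℝ (Fin (n' + 1))}
    (ht : ∀ i, 0 < t i) (ht' : ∀ i, 0 < t' i)
    (hl : (K.repr l).wt l (mkPt u t) = (K.repr l).wt l (mkPt u' t'))
    (hc : ∀ i, hK.coord l i (mkPt u t) = hK.coord l i (mkPt u' t')) :
    (⟨n, u, t⟩ : Σ n, (K.repr l).Chain n × stdSimplex ℝ (Fin (n + 1))) = ⟨n', u', t'⟩ := by
  -- All barycentric coordinates agree, hence so do the objects of the chains and the weights.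
  have hwt : ∀ a, (K.repr l).wt a (mkPt u t) = (K.repr l).wt a (mkPt u' t') := fun a => by
    by_cases hal : a = l
    · rw [hal, hl]
    by_cases ha : Nonempty (K.Hom a l)
    · exact hc (.inl ⟨a, hal, ha⟩)
    · rw [wt_eq_zero u t fun i hi => ha ⟨K.castHom hi rfl (u.elt i)⟩,
        wt_eq_zero u' t' fun i hi => ha ⟨K.castHom hi rfl (u'.elt i)⟩]
  have hmem : ∀ {k : ℕ} (v : (K.repr l).Chain k) (s : stdSimplex ℝ (Fin (k + 1))),
      (∀ i, 0 < s i) → ∀ a, a ∈ range v.obj ↔ 0 < (K.repr l).wt a (mkPt v s) := fun v s hs a => by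
    rw [wt_pos_iff]
    exact ⟨fun ⟨i, hi⟩ => ⟨i, hi, hs i⟩, fun ⟨i, hi, _⟩ => ⟨i, hi⟩⟩
  have hr : range u.obj = range u'.obj := by
    ext a
    rw [hmem u t ht, hmem u' t' ht', hwt]
  obtain rfl : n = n' := by
    have e : Fin (n + 1) ≃ Fin (n' + 1) := (Equiv.ofInjective _ u.2.1.1).trans
      ((Equiv.setCongr hr).trans (Equiv.ofInjective _ u'.2.1.1).symm)
    exact Nat.succ_injective (Fin.equiv_iff_eq.1 ⟨e⟩)
  have ho := hK.obj_eq_of_range_eq hr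
  obtain ⟨⟨o, f, g⟩, hu⟩ := u
  obtain ⟨⟨o', f', g'⟩, hu'⟩ := u'
  obtain rfl : o = o' := ho
  obtain rfl : t = t' := by
    ext i
    have h := hwt (o i)
    exact (wt_obj ⟨⟨o, f, g⟩, hu⟩ t i).symm.trans (h.trans (wt_obj ⟨⟨o, f', g'⟩, hu'⟩ t' i))
  -- The Euclidean coordinates are weighted by positive numbers, so the morphisms agree.
  have hg : ∀ i, g i = g' i := fun i => by
    by_cases hi : o i = l
    · have : ∀ (b : L) (_ : b = l) (x y : K.Hom b l), x = y := by
        rintro b rfl x y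
        exact (hK.subsingleton b).elim _ _
      exact this _ hi _ _
    · refine hK.homEmb_ext fun c => ?_
      have h := hc (.inr (.inl ⟨⟨o i, hi, ⟨g i⟩⟩, c⟩))
      have h1 := Chain.eltSum_obj (M := K.repr l) ⟨⟨o, f, g⟩, hu⟩ i
        (fun f => hK.homEmb _ l f c) (fun i => t i)
      have h2 := Chain.eltSum_obj (M := K.repr l) ⟨⟨o, f', g'⟩, hu'⟩ i
        (fun f => hK.homEmb _ l f c) (fun i => t i)
      exact mul_left_cancel₀ (ht i).ne' (h1.symm.trans (h.trans h2))
  -- Edges that end in `l` are determined by the morphisms to `l`; the other ones by coordinates.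
  have hf : ∀ ij, f ij = f' ij := fun ij => by
    by_cases hj : o ij.1.2 = l
    · have h1 := hu.2 ij
      have h2 := hu'.2 ij
      have h3 : K.comp (g ij.1.2) (f ij) = K.comp (g' ij.1.2) (f' ij) :=
        h1.symm.trans ((hg _).trans h2)
      rw [hK.comp_end hj, hK.comp_end hj] at h3
      exact castHom_injective _ _ h3
    · have hi : o ij.1.1 ≠ l := hK.obj_ne (⟨⟨o, f, g⟩, hu⟩ : (K.repr l).Chain n) ij.2
      refine hK.homEmb_ext fun c => ?_
      have h := hc (.inr (.inr ⟨(⟨o ij.1.1, hi, ⟨g _⟩⟩, ⟨o ij.1.2, hj, ⟨g _⟩⟩), c⟩))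
      have h1 := Chain.edgeSum_obj (M := K.repr l) ⟨⟨o, f, g⟩, hu⟩ ij
        (fun f => hK.homEmb _ _ f c) (fun i => t i)
      have h2 := Chain.edgeSum_obj (M := K.repr l) ⟨⟨o, f', g'⟩, hu'⟩ ij
        (fun f => hK.homEmb _ _ f c) (fun i => t i)
      exact mul_left_cancel₀ (lt_min (ht _) (ht _)).ne' (h1.symm.trans (h.trans h2))
  obtain rfl : f = f' := funext hf
  obtain rfl : g = g' := funext hg
  rfl

theorem IsTame.ext_of_coord (hK : K.IsTame) {l : L} {x y : (K.repr l).Real}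
    (hl : (K.repr l).wt l x = (K.repr l).wt l y)
    (hc : ∀ i, hK.coord l i x = hK.coord l i y) : x = y := by
  obtain ⟨n, u, t, ht, rfl⟩ := Realization.exists_pos x
  obtain ⟨n', u', t', ht', rfl⟩ := Realization.exists_pos y
  have := hK.eq_of_coord_eq ht ht' hl hc
  exact congrArg (fun z : Σ n, (K.repr l).Chain n × stdSimplex ℝ (Fin (n + 1)) =>
    mkPt z.2.1 z.2.2) this

theorem IsTame.t2Space_real (hK : K.IsTame) (l : L) : T2Space (K.repr l).Real := by
  let Φ : (K.repr l).Real → ℝ × (hK.CoordIdx l → ℝ) :=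
    fun x => ((K.repr l).wt l x, fun i => hK.coord l i x)
  have hΦ : Continuous Φ :=
    (continuous_wt l).prodMk (continuous_pi fun i => hK.continuous_coord l i)
  refine T2Space.of_injective_continuous (f := Φ) (fun x y h => ?_) hΦ
  exact hK.ext_of_coord (congrArg Prod.fst h) fun i => congrFun (congrArg Prod.snd h) i

end TopEnrichedCat

/-! ### The radial structure of lower stars -/

/-- The point `s t + (1 - s) v` of a simplex, where `v` is the last vertex. -/
noncomputable def stdSimplex.segment {n : ℕ} (s : unitInterval) (t : stdSimplex ℝ (Fin (n + 1))) :
    stdSimplex ℝ (Fin (n + 1)) :=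
  ⟨fun i => s * t i + (1 - s) * (if i = Fin.last n then 1 else 0), fun i =>
    add_nonneg (mul_nonneg s.2.1 (stdSimplex.zero_le t i))
      (mul_nonneg (sub_nonneg.2 s.2.2) (by split_ifs <;> norm_num)), by
    rw [Finset.sum_add_distrib, ← Finset.mul_sum, ← Finset.mul_sum, stdSimplex.sum_eq_one]
    simp⟩

theorem stdSimplex.segment_apply {n : ℕ} (s : unitInterval) (t : stdSimplex ℝ (Fin (n + 1)))
    (i : Fin (n + 1)) : stdSimplex.segment s t i =
      s * t i + (1 - s) * (if i = Fin.last n then 1 else 0) := rfl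

theorem stdSimplex.segment_last {n : ℕ} (s : unitInterval) (t : stdSimplex ℝ (Fin (n + 1))) :
    stdSimplex.segment s t (Fin.last n) = s * t (Fin.last n) + (1 - s) := by
  rw [stdSimplex.segment_apply, if_pos rfl, mul_one]

theorem stdSimplex.segment_of_ne {n : ℕ} (s : unitInterval) (t : stdSimplex ℝ (Fin (n + 1)))
    {i : Fin (n + 1)} (h : i ≠ Fin.last n) : stdSimplex.segment s t i = s * t i := by
  rw [stdSimplex.segment_apply, if_neg h, mul_zero, add_zero]

theorem stdSimplex.continuous_segment {n : ℕ} :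
    Continuous fun q : unitInterval × stdSimplex ℝ (Fin (n + 1)) =>
      stdSimplex.segment q.1 q.2 := by
  have hs : Continuous fun q : unitInterval × stdSimplex ℝ (Fin (n + 1)) => (q.1 : ℝ) :=
    continuous_subtype_val.comp continuous_fst
  refine continuous_induced_rng.2 (continuous_pi fun i => ?_)
  exact (hs.mul ((stdSimplex.continuous_apply i).comp continuous_snd)).add
    ((continuous_const.sub hs).mul continuous_const)

namespace TopEnrichedCat

variable {L : Type u} {K : TopEnrichedCat L}

theorem castHom_castHom {a a' a'' b b' b'' : L} (ha : a = a') (hb : b = b') (ha' : a' = a'')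
    (hb' : b' = b'') (f : K.Hom a b) :
    K.castHom ha' hb' (K.castHom ha hb f) = K.castHom (ha.trans ha') (hb.trans hb') f := by
  subst ha hb ha' hb'
  rfl

open RightModule

/-- Equality of chains, with transport along the equalities of objects. -/
theorem chain_ext {l : L} {n : ℕ} {u v : (K.repr l).Chain n} (ho : ∀ i, u.obj i = v.obj i)
    (hf : ∀ ij, K.castHom (ho _) (ho _) (u.edge ij) = v.edge ij)
    (hg : ∀ i, K.castHom (ho i) rfl (u.elt i) = v.elt i) : u = v := by
  obtain ⟨⟨o, f, g⟩, hu⟩ := u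
  obtain ⟨⟨o', f', g'⟩, hv⟩ := v
  obtain rfl : o = o' := funext ho
  obtain rfl : f = f' := funext hf
  obtain rfl : g = g' := funext hg
  rfl

/-- The objects of a chain followed by `l`. -/
def coneObj {n : ℕ} (o : Fin (n + 1) → L) (l : L) (i : Fin (n + 2)) : L :=
  if h : i.1 < n + 1 then o ⟨i.1, h⟩ else l

theorem coneObj_of_lt {n : ℕ} (o : Fin (n + 1) → L) (l : L) {i : Fin (n + 2)} (h : i.1 < n + 1) :
    o ⟨i.1, h⟩ = coneObj o l i := by
  rw [coneObj, dif_pos h]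

theorem coneObj_of_not_lt {n : ℕ} (o : Fin (n + 1) → L) (l : L) {i : Fin (n + 2)}
    (h : ¬ i.1 < n + 1) : l = coneObj o l i := by
  rw [coneObj, dif_neg h]

theorem val_lt_of_edge {n : ℕ} (ij : EdgeIdx (n + 1)) : ij.1.1.1 < n + 1 :=
  lt_of_lt_of_le (Fin.lt_def.1 ij.2) (Nat.le_of_lt_succ ij.1.2.2)

/-- The edges of a chain over `l` followed by `l`. -/
def coneEdge {n : ℕ} {o : Fin (n + 1) → L} {l : L}
    (p : (∀ ij : EdgeIdx n, K.Hom (o ij.1.1) (o ij.1.2)) × (∀ i, K.Hom (o i) l))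
    (ij : EdgeIdx (n + 1)) : K.Hom (coneObj o l ij.1.1) (coneObj o l ij.1.2) :=
  if h : ij.1.2.1 < n + 1 then
    K.castHom (coneObj_of_lt o l (val_lt_of_edge ij)) (coneObj_of_lt o l h)
      (p.1 ⟨(⟨_, val_lt_of_edge ij⟩, ⟨_, h⟩), ij.2⟩)
  else K.castHom (coneObj_of_lt o l (val_lt_of_edge ij)) (coneObj_of_not_lt o l h)
    (p.2 ⟨_, val_lt_of_edge ij⟩)

/-- The morphisms to `l` from the objects of a chain over `l` followed by `l`. -/
def coneElt {n : ℕ} {o : Fin (n + 1) → L} {l : L}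
    (p : (∀ ij : EdgeIdx n, K.Hom (o ij.1.1) (o ij.1.2)) × (∀ i, K.Hom (o i) l))
    (i : Fin (n + 2)) : K.Hom (coneObj o l i) l :=
  if h : i.1 < n + 1 then K.castHom (coneObj_of_lt o l h) rfl (p.2 ⟨_, h⟩)
  else K.castHom (coneObj_of_not_lt o l h) rfl (K.one l)

/-- A chain over `l` that does not involve `l`, followed by the identity of `l`. -/
def coneChain {l : L} {n : ℕ} (u : (K.repr l).Chain n) (hu : ∀ i, u.obj i ≠ l) :
    (K.repr l).Chain (n + 1) :=
  ⟨⟨coneObj u.obj l, coneEdge u.1.2, coneElt u.1.2⟩, by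
    refine ⟨⟨fun i j hij => ?_, fun i j k h h' => ?_⟩, fun ij => ?_⟩
    · change coneObj _ _ _ = coneObj _ _ _ at hij
      by_cases hi : i.1 < n + 1 <;> by_cases hj : j.1 < n + 1
      · rw [← coneObj_of_lt _ _ hi, ← coneObj_of_lt _ _ hj] at hij
        exact Fin.ext (by simpa using congrArg Fin.val (u.2.1.1 hij))
      · rw [← coneObj_of_lt _ _ hi, ← coneObj_of_not_lt _ _ hj] at hij
        exact absurd hij (hu _)
      · rw [← coneObj_of_not_lt _ _ hi, ← coneObj_of_lt _ _ hj] at hij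
        exact absurd hij.symm (hu _)
      · exact Fin.ext (by omega)
    · have hj : j.1 < n + 1 := val_lt_of_edge ⟨(j, k), h'⟩
      by_cases hk : k.1 < n + 1
      · simp only [coneEdge, dif_pos hk, dif_pos hj]
        rw [comp_castHom]
        exact congrArg _ (u.2.1.2 _ _ _ h h')
      · simp only [coneEdge, dif_neg hk, dif_pos hj]
        rw [comp_castHom]
        exact congrArg _ (u.2.2 ⟨(⟨i.1, _⟩, ⟨j.1, hj⟩), h⟩)
    · have hi := val_lt_of_edge ij
      by_cases hj : ij.1.2.1 < n + 1
      · simp only [coneEdge, coneElt, dif_pos hi, dif_pos hj]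
        rw [comp_castHom]
        exact congrArg _ (u.2.2 ⟨(⟨ij.1.1.1, _⟩, ⟨ij.1.2.1, hj⟩), ij.2⟩)
      · simp only [coneEdge, coneElt, dif_pos hi, dif_neg hj]
        rw [comp_castHom, K.one_comp]⟩

theorem coneChain_last {l : L} {n : ℕ} (u : (K.repr l).Chain n) (hu : ∀ i, u.obj i ≠ l) :
    (coneChain u hu).obj (Fin.last (n + 1)) = l :=
  (coneObj_of_not_lt _ _ (lt_irrefl _)).symm

theorem face_coneChain {l : L} {n : ℕ} (u : (K.repr l).Chain n) (hu : ∀ i, u.obj i ≠ l) :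
    (K.repr l).face Fin.castSuccOrderEmb (coneChain u hu) = u := by
  refine chain_ext (fun i => (coneObj_of_lt u.obj l (i := i.castSucc) i.2).symm) (fun ij => ?_)
    (fun i => ?_)
  · refine (congrArg _ (dif_pos (c := (ij.1.2.castSucc).1 < n + 1) ij.1.2.2)).trans ?_
    exact castHom_castHom _ _ _ _ _
  · refine (congrArg _ (dif_pos (c := (i.castSucc).1 < n + 1) i.2)).trans ?_
    exact castHom_castHom _ _ _ _ _

theorem continuous_coneChain {l : L} {n : ℕ} {o : Fin (n + 1) → L} (ho : ∀ i, o i ≠ l) :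
    Continuous fun p : {p // (K.repr l).IsChain o p} => coneChain (ofFiber o p) ho := by
  have hp : Continuous fun p : {p // (K.repr l).IsChain o p} => p.1 := continuous_subtype_val
  have h1 : Continuous fun p : {p // (K.repr l).IsChain o p} =>
      fun ij => coneEdge (K := K) (l := l) p.1 ij := continuous_pi fun ij => by
    by_cases h : ij.1.2.1 < n + 1
    · simp only [coneEdge, dif_pos h]
      exact (K.continuous_castHom _ _).comp (continuous_pi_iff.1 (continuous_fst.comp hp) _)
    · simp only [coneEdge, dif_neg h]
      exact (K.continuous_castHom _ _).comp (continuous_pi_iff.1 (continuous_snd.comp hp) _)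
  have h2 : Continuous fun p : {p // (K.repr l).IsChain o p} =>
      fun i => coneElt (K := K) (l := l) p.1 i := continuous_pi fun i => by
    by_cases h : i.1 < n + 1
    · simp only [coneElt, dif_pos h]
      exact (K.continuous_castHom _ _).comp (continuous_pi_iff.1 (continuous_snd.comp hp) _)
    · simp only [coneElt, dif_neg h]
      exact continuous_const
  exact continuous_induced_rng.2 ((continuous_sigmaMk (σ := fun o' : Fin (n + 2) → L =>
    (∀ ij : EdgeIdx (n + 1), K.Hom (o' ij.1.1) (o' ij.1.2)) × (∀ i, K.Hom (o' i) l))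
    (i := coneObj o l)).comp (h1.prodMk h2))

/-- A point of a simplex over `l` not involving `l` lies on a face of the cone over it. -/
theorem mkPt_coneChain {l : L} {n : ℕ} (u : (K.repr l).Chain n) (hu : ∀ i, u.obj i ≠ l)
    (t : stdSimplex ℝ (Fin (n + 1))) :
    mkPt (coneChain u hu) (stdSimplex.map Fin.castSuccOrderEmb t) = mkPt u t := by
  rw [← pt_face, face_coneChain]

theorem IsTame.last_of_obj_eq (hK : K.IsTame) {l : L} {n : ℕ} (u : (K.repr l).Chain n)
    {i : Fin (n + 1)} (h : u.obj i = l) : i = Fin.last n := by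
  by_contra hi
  exact hK.obj_ne u (lt_of_le_of_ne (Fin.le_last i) hi) h

/-- Every point lies on a simplex that has the identity of `l` as its last vertex. -/
theorem IsTame.exists_last (hK : K.IsTame) {l : L} (x : (K.repr l).Real) :
    ∃ (n : ℕ) (v : (K.repr l).Chain n) (w : stdSimplex ℝ (Fin (n + 1))),
      v.obj (Fin.last n) = l ∧ mkPt v w = x := by
  obtain ⟨n, u, t, -, rfl⟩ := Realization.exists_pos x
  by_cases h : ∃ i, u.obj i = l
  · obtain ⟨i, hi⟩ := h
    exact ⟨n, u, t, hK.last_of_obj_eq u hi ▸ hi, rfl⟩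
  · push Not at h
    exact ⟨n + 1, coneChain u h, _, coneChain_last u h, mkPt_coneChain u h t⟩

/-- Radial multiplication by `s` on the realization of the lower star of `l`, which is the cone over
the link with vertex the identity of `l`.  The value does not depend on the chosen simplex with last
vertex the identity of `l`, by `IsTame.radial_mkPt`. -/
noncomputable def IsTame.radial (hK : K.IsTame) {l : L} (s : unitInterval) (x : (K.repr l).Real) :
    (K.repr l).Real :=
  mkPt (hK.exists_last x).choose_spec.choose
    (stdSimplex.segment s (hK.exists_last x).choose_spec.choose_spec.choose)

theorem wt_segment {l : L} {n : ℕ} {v : (K.repr l).Chain n} (hv : v.obj (Fin.last n) = l)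
    (s : unitInterval) (w : stdSimplex ℝ (Fin (n + 1))) :
    (K.repr l).wt l (mkPt v (stdSimplex.segment s w)) =
      s * (K.repr l).wt l (mkPt v w) + (1 - s) := by
  have h : ∀ w, (K.repr l).wt l (mkPt v w) = w (Fin.last n) := fun w => by
    have := wt_obj v w (Fin.last n)
    rwa [hv] at this
  rw [h, h, stdSimplex.segment_last]

theorem eltSum_segment {l : L} {n : ℕ} {v : (K.repr l).Chain n} (hv : v.obj (Fin.last n) = l)
    (s : unitInterval) (w : stdSimplex ℝ (Fin (n + 1))) {a : L} (ha : a ≠ l)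
    (ψ : (K.repr l).G a → ℝ) :
    v.eltSum a ψ (fun i => stdSimplex.segment s w i) = s * v.eltSum a ψ fun i => w i := by
  rw [Chain.eltSum, Chain.eltSum, Finset.mul_sum]
  refine Finset.sum_congr rfl fun i _ => ?_
  by_cases h : v.obj i = a
  · rw [dif_pos h, dif_pos h, stdSimplex.segment_of_ne, mul_assoc]
    rintro rfl
    exact ha (h.symm.trans hv)
  · rw [dif_neg h, dif_neg h, mul_zero]

theorem edgeSum_segment {l : L} {n : ℕ} {v : (K.repr l).Chain n} (hv : v.obj (Fin.last n) = l)
    (s : unitInterval) (w : stdSimplex ℝ (Fin (n + 1))) {a b : L} (ha : a ≠ l) (hb : b ≠ l)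
    (ψ : K.Hom a b → ℝ) :
    v.edgeSum a b ψ (fun i => stdSimplex.segment s w i) = s * v.edgeSum a b ψ fun i => w i := by
  rw [Chain.edgeSum, Chain.edgeSum, Finset.mul_sum]
  refine Finset.sum_congr rfl fun ij _ => ?_
  by_cases h : v.obj ij.1.1 = a ∧ v.obj ij.1.2 = b
  · rw [dif_pos h, dif_pos h, stdSimplex.segment_of_ne, stdSimplex.segment_of_ne,
      ← mul_min_of_nonneg _ _ s.2.1, mul_assoc]
    · intro h'
      exact hb (h.2.symm.trans (h' ▸ hv))
    · intro h'
      exact ha (h.1.symm.trans (h' ▸ hv))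
  · rw [dif_neg h, dif_neg h, mul_zero]

theorem IsTame.coord_segment (hK : K.IsTame) {l : L} {n : ℕ} {v : (K.repr l).Chain n}
    (hv : v.obj (Fin.last n) = l) (s : unitInterval) (w : stdSimplex ℝ (Fin (n + 1)))
    (i : hK.CoordIdx l) :
    hK.coord l i (mkPt v (stdSimplex.segment s w)) = s * hK.coord l i (mkPt v w) := by
  rcases i with a | ⟨a, c⟩ | ⟨ab, c⟩
  · exact eltSum_segment hv s w a.2.1 fun _ => 1
  · exact eltSum_segment hv s w a.2.1 fun f => hK.homEmb a l f c
  · exact edgeSum_segment hv s w ab.1.2.1 ab.2.2.1 fun f => hK.homEmb ab.1 ab.2 f c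

theorem IsTame.wt_radial (hK : K.IsTame) {l : L} (s : unitInterval) (x : (K.repr l).Real) :
    (K.repr l).wt l (hK.radial s x) = s * (K.repr l).wt l x + (1 - s) := by
  have h := (hK.exists_last x).choose_spec.choose_spec.choose_spec
  conv_rhs => rw [← h.2]
  exact wt_segment h.1 s _

theorem IsTame.coord_radial (hK : K.IsTame) {l : L} (s : unitInterval) (x : (K.repr l).Real)
    (i : hK.CoordIdx l) : hK.coord l i (hK.radial s x) = s * hK.coord l i x := by
  have h := (hK.exists_last x).choose_spec.choose_spec.choose_spec
  conv_rhs => rw [← h.2]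
  exact hK.coord_segment h.1 s _ i

/-- The result of radial multiplication is determined by its coordinates, since these separate
points. -/
theorem IsTame.radial_mkPt (hK : K.IsTame) {l : L} {n : ℕ} {v : (K.repr l).Chain n}
    (hv : v.obj (Fin.last n) = l) (s : unitInterval) (w : stdSimplex ℝ (Fin (n + 1))) :
    hK.radial s (mkPt v w) = mkPt v (stdSimplex.segment s w) :=
  hK.ext_of_coord (by rw [hK.wt_radial, wt_segment hv])
    fun i => by rw [hK.coord_radial, hK.coord_segment hv]

theorem IsTame.continuous_radial (hK : K.IsTame) (l : L) :
    Continuous fun q : unitInterval × (K.repr l).Real => hK.radial q.1 q.2 := by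
  refine Realization.continuous_prod_iff fun n => ?_
  suffices h : Continuous fun p : (K.repr l).Chain n × unitInterval × stdSimplex ℝ (Fin (n + 1)) =>
      hK.radial p.2.1 (mkPt p.1 p.2.2) from
    h.comp ((continuous_fst.comp continuous_snd).prodMk (continuous_fst.prodMk
      (continuous_snd.comp continuous_snd)))
  refine Chain.continuous_prod fun o => ?_
  have hc : Continuous fun q : {p // (K.repr l).IsChain o p} × unitInterval ×
      stdSimplex ℝ (Fin (n + 1)) => ofFiber o q.1 :=
    (isOpenEmbedding_ofFiber o).continuous.comp continuous_fst
  by_cases h : ∃ i, o i = l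
  · obtain ⟨i, hi⟩ := h
    by_cases hl : i = Fin.last n
    · subst hl
      have : ∀ q : {p // (K.repr l).IsChain o p} × unitInterval × stdSimplex ℝ (Fin (n + 1)),
          hK.radial q.2.1 (mkPt (ofFiber o q.1) q.2.2) =
            mkPt (ofFiber o q.1) (stdSimplex.segment q.2.1 q.2.2) := fun q =>
        hK.radial_mkPt hi _ _
      simp only [this]
      exact (Realization.continuous_mk (r := (K.repr l).face) n).comp
        (hc.prodMk (stdSimplex.continuous_segment.comp continuous_snd))
    · refine continuous_iff_continuousAt.2 fun q => ?_
      exact absurd (hK.last_of_obj_eq (ofFiber o q.1) hi) hl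
  · push Not at h
    have : ∀ q : {p // (K.repr l).IsChain o p} × unitInterval × stdSimplex ℝ (Fin (n + 1)),
        hK.radial q.2.1 (mkPt (ofFiber o q.1) q.2.2) =
          mkPt (coneChain (ofFiber o q.1) h)
            (stdSimplex.segment q.2.1 (stdSimplex.map Fin.castSuccOrderEmb q.2.2)) := fun q => by
      rw [← mkPt_coneChain _ h, hK.radial_mkPt (coneChain_last _ h)]
    simp only [this]
    exact (Realization.continuous_mk (r := (K.repr l).face) (n + 1)).comp
      (((continuous_coneChain h).comp continuous_fst).prodMk
      (stdSimplex.continuous_segment.comp ((continuous_fst.comp continuous_snd).prodMk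
        ((stdSimplex.continuous_map _).comp (continuous_snd.comp continuous_snd)))))

/-- The one-object chain at `l`. -/
def centerChain (K : TopEnrichedCat L) (l : L) : (K.repr l).Chain 0 :=
  ⟨⟨fun _ => l, fun _ => K.one l, fun _ => K.one l⟩,
    ⟨fun _ _ _ => Subsingleton.elim (α := Fin 1) _ _, fun _ _ _ _ _ => (K.one_comp _).symm⟩,
    fun _ => (K.one_comp _).symm⟩

/-- The cone point of the realization of the lower star of `l`. -/
noncomputable def starCenter (K : TopEnrichedCat L) (l : L) : (K.repr l).Real :=
  mkPt (K.centerChain l) (stdSimplex.vertex 0)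

theorem wt_starCenter (l : L) : (K.repr l).wt l (K.starCenter l) = 1 := by
  refine (wt_obj (K.centerChain l) (stdSimplex.vertex 0) 0).trans ?_
  rw [stdSimplex.vertex_coe, Pi.single_eq_same]

theorem IsTame.coord_starCenter (hK : K.IsTame) (l : L) (i : hK.CoordIdx l) :
    hK.coord l i (K.starCenter l) = 0 := by
  rcases i with a | ⟨a, c⟩ | ⟨ab, c⟩
  · exact Chain.eltSum_eq_zero (K.centerChain l) (fun _ => a.2.1.symm) (fun _ => 1) _
  · exact Chain.eltSum_eq_zero (K.centerChain l) (fun _ => a.2.1.symm)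
      (fun f => hK.homEmb a l f c) _
  · refine (edgeCoord_pt (M := K.repr l) ab.1 ab.2
      (fun f => hK.homEmb ab.1 ab.2 f c) (K.centerChain l) (stdSimplex.vertex 0)).trans ?_
    rw [Chain.edgeSum]
    exact Finset.sum_eq_zero fun ij _ => dif_neg fun h => ab.1.2.1 h.1.symm

theorem IsTame.radial_zero (hK : K.IsTame) {l : L} (x : (K.repr l).Real) :
    hK.radial 0 x = K.starCenter l :=
  hK.ext_of_coord (by rw [hK.wt_radial, wt_starCenter]; simp)
    fun i => by rw [hK.coord_radial, hK.coord_starCenter]; simp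

theorem IsTame.radial_one (hK : K.IsTame) {l : L} (x : (K.repr l).Real) : hK.radial 1 x = x :=
  hK.ext_of_coord (by rw [hK.wt_radial]; simp) fun i => by rw [hK.coord_radial]; simp

theorem IsTame.radial_mul (hK : K.IsTame) {l : L} (s t : unitInterval) (x : (K.repr l).Real) :
    hK.radial (s * t) x = hK.radial s (hK.radial t x) :=
  hK.ext_of_coord (by simp only [hK.wt_radial, Set.Icc.coe_mul]; ring)
    fun i => by simp only [hK.coord_radial, Set.Icc.coe_mul]; ring

theorem IsTame.radial_mem_boundary (hK : K.IsTame) {l : L} {s : unitInterval}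
    {x : (K.repr l).Real} (h : (K.repr l).wt l (hK.radial s x) = 0) : s = 1 := by
  rw [hK.wt_radial] at h
  have h1 : 0 ≤ (s : ℝ) * (K.repr l).wt l x := mul_nonneg s.2.1 (wt_nonneg _ _)
  exact Subtype.ext (le_antisymm s.2.2 (by simp only [Set.Icc.coe_one]; linarith))

theorem IsTame.radial_injective (hK : K.IsTame) {l : L} {s t : unitInterval}
    {x y : (K.repr l).Real} (hx : (K.repr l).wt l x = 0) (hy : (K.repr l).wt l y = 0)
    (hs : s ≠ 0) (h : hK.radial s x = hK.radial t y) : s = t ∧ x = y := by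
  have h1 := congrArg ((K.repr l).wt l) h
  rw [hK.wt_radial, hK.wt_radial, hx, hy] at h1
  obtain rfl : s = t := Subtype.ext (by linarith)
  refine ⟨rfl, hK.ext_of_coord (hx.trans hy.symm) fun i => ?_⟩
  have h2 := congrArg (hK.coord l i) h
  rw [hK.coord_radial, hK.coord_radial] at h2
  exact mul_left_cancel₀ (fun h0 => hs (Subtype.ext h0)) h2

/-- The open cone is dense in the cone. -/
theorem IsTame.dense_interior (hK : K.IsTame) (l : L) :
    Dense {x : (K.repr l).Real | 0 < (K.repr l).wt l x} := by
  intro x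
  have hc : Continuous fun s : ℝ => hK.radial (projIcc 0 1 zero_le_one s) x :=
    (hK.continuous_radial l).comp
      ((continuous_projIcc (h := zero_le_one)).prodMk (continuous_const (y := x)))
  have h1 : (1 : ℝ) ∈ closure (Iio (1 : ℝ)) := by rw [closure_Iio]; exact mem_Iic.2 le_rfl
  have h2 := map_mem_closure hc h1 (t := {x : (K.repr l).Real | 0 < (K.repr l).wt l x})
    fun s hs => ?_
  · have : projIcc (0 : ℝ) 1 zero_le_one 1 = 1 := projIcc_right _
    rwa [this, hK.radial_one] at h2
  · change 0 < (K.repr l).wt l (hK.radial _ x)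
    rw [hK.wt_radial]
    have h3 : (projIcc (0 : ℝ) 1 zero_le_one s : ℝ) < 1 := by
      rw [coe_projIcc]
      exact max_lt one_pos (lt_of_le_of_lt (min_le_right _ _) hs)
    have := mul_nonneg (projIcc (0 : ℝ) 1 zero_le_one s).2.1 (wt_nonneg l x)
    linarith

theorem IsTame.isConnected_interior (hK : K.IsTame) (l : L) :
    IsConnected {x : (K.repr l).Real | 0 < (K.repr l).wt l x} := by
  have hc : 0 < (K.repr l).wt l (K.starCenter l) := by rw [wt_starCenter]; exact one_pos
  refine ⟨⟨K.starCenter l, hc⟩, isPreconnected_of_forall (K.starCenter l) fun x hx => ?_⟩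
  refine ⟨range fun s => hK.radial s x, ?_, ⟨0, hK.radial_zero x⟩, ⟨1, hK.radial_one x⟩,
    isPreconnected_range ((hK.continuous_radial l).comp (continuous_id.prodMk continuous_const))⟩
  rintro _ ⟨s, rfl⟩
  change 0 < (K.repr l).wt l (hK.radial s x)
  rw [hK.wt_radial]
  rcases eq_or_lt_of_le s.2.2 with h | h
  · rw [h]; simpa using hx
  · have := mul_nonneg s.2.1 (wt_nonneg l x)
    linarith

end TopEnrichedCat

/-! ### The strata of a realization -/

namespace TopEnrichedCat

variable {L : Type u} {K : TopEnrichedCat L}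

namespace RightModule

variable {M : K.RightModule}

/-- A family of subsets of the spaces of a module that is stable under the action. -/
def IsStable (M : K.RightModule) (Q : ∀ a, Set (M.G a)) : Prop :=
  ∀ {a b : L} (g : M.G b) (f : K.Hom a b), g ∈ Q b → M.act g f ∈ Q a

/-- The subcomplex of chains with elements in a stable family `Q`.  It suffices to look at the
element at an object beyond which all coordinates vanish. -/
def sub (Q : ∀ a, Set (M.G a)) (hQ : M.IsStable Q) : Set M.Real :=
  {x | Quot.lift (fun x : Σ n, M.Chain n × stdSimplex ℝ (Fin (n + 1)) =>
    ∃ j, x.2.1.elt j ∈ Q (x.2.1.obj j) ∧ ∀ i, j < i → x.2.2 i = 0) (by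
      rintro _ _ ⟨θ, x, t⟩
      refine propext ⟨?_, ?_⟩
      · rintro ⟨j, hj, h⟩
        refine ⟨θ j, hj, fun i hi => ?_⟩
        by_cases hr : i ∈ range θ
        · obtain ⟨k, rfl⟩ := hr
          exact (stdSimplex.map_apply_of_injective θ.injective t k).trans
            (h k (θ.lt_iff_lt.1 hi))
        · exact stdSimplex.map_apply_of_notMem_range t hr
      · rintro ⟨j, hj, h⟩
        have h' : ∀ k, 0 < t k → θ k ≤ j := fun k hk => by
          by_contra hkj
          refine hk.ne' ?_
          exact (stdSimplex.map_apply_of_injective θ.injective t k).symm.trans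
            (h _ (not_le.1 hkj))
        obtain ⟨k, hk⟩ := stdSimplex.exists_pos t
        let S : Finset (Fin _) := Finset.univ.filter fun k => θ k ≤ j
        have hS : S.Nonempty := ⟨k, by simpa [S] using h' k hk⟩
        have hm : θ (S.max' hS) ≤ j := by simpa [S] using S.max'_mem hS
        refine ⟨S.max' hS, ?_, fun i hi => ?_⟩
        · have := hQ _ (homTo x.edge _ _ hm) hj
          rwa [← x.elt_eq] at this
        · by_contra hne
          have hpos : 0 < t i := lt_of_le_of_ne (stdSimplex.zero_le t i) (Ne.symm hne)
          exact absurd hi (not_lt.2 (S.le_max' i (by simpa [S] using h' i hpos)))) x}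

theorem mkPt_mem_sub {Q : ∀ a, Set (M.G a)} (hQ : M.IsStable Q) {n : ℕ} {u : M.Chain n}
    {t : stdSimplex ℝ (Fin (n + 1))} :
    mkPt u t ∈ sub Q hQ ↔ ∃ j, u.elt j ∈ Q (u.obj j) ∧ ∀ i, j < i → t i = 0 := Iff.rfl

theorem isClosed_sub {Q : ∀ a, Set (M.G a)} (hQ : M.IsStable Q) (h : ∀ a, IsClosed (Q a)) :
    IsClosed (sub Q hQ) := by
  refine Realization.isClosed_iff.2 fun n => Chain.isClosed_prod fun o => ?_
  have : {q : {p // M.IsChain o p} × stdSimplex ℝ (Fin (n + 1)) |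
      (ofFiber o q.1, q.2) ∈ {p : M.Chain n × stdSimplex ℝ (Fin (n + 1)) | mkPt p.1 p.2 ∈ sub Q hQ}}
      = ⋃ j, ({q | q.1.1.2 j ∈ Q (o j)} ∩ ⋂ i, ⋂ (_ : j < i), {q | q.2 i = 0}) := by
    ext q
    change mkPt _ _ ∈ sub Q hQ ↔ _
    rw [mkPt_mem_sub]
    simp only [mem_iUnion, mem_inter_iff, mem_iInter]
    rfl
  rw [this]
  refine isClosed_iUnion_of_finite fun j => IsClosed.inter ?_ ?_
  · have hc : Continuous fun q : {p // M.IsChain o p} × stdSimplex ℝ (Fin (n + 1)) => q.1.1.2 :=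
      continuous_snd.comp (continuous_subtype_val.comp continuous_fst)
    exact (h _).preimage (continuous_pi_iff.1 hc j)
  · exact isClosed_iInter fun i => isClosed_iInter fun _ =>
      isClosed_eq ((stdSimplex.continuous_apply i).comp continuous_snd) continuous_const

theorem smul_mem_sub_of_mem {Q : ∀ a, Set (M.G a)} (hQ : M.IsStable Q) {m : L} {g : M.G m}
    (hg : g ∈ Q m) (x : (K.repr m).Real) : M.smul g x ∈ sub Q hQ := by
  obtain ⟨n, u, t, -, rfl⟩ := Realization.exists_pos x
  rw [smul_pt, mkPt_mem_sub]
  exact ⟨Fin.last n, hQ _ _ hg, fun i hi => absurd hi (not_lt.2 (Fin.le_last i))⟩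

theorem act_eq_castElt (hK : K.IsTame) {b m : L} (h : b = m) (g : M.G m) (f : K.Hom b m) :
    M.castElt h (M.act g f) = g := by
  subst h
  rw [hK.eq_one f, M.act_one]
  rfl

/-- Transport of points along equalities of objects. -/
def castReal (K : TopEnrichedCat L) {a b : L} (h : a = b) (x : (K.repr a).Real) : (K.repr b).Real :=
  h ▸ x

theorem smul_eq_castReal (hK : K.IsTame) {b m : L} (h : b = m) (f : K.Hom b m)
    (x : (K.repr b).Real) : (K.repr m).smul f x = castReal K h x := by
  subst h
  rw [hK.eq_one f, one_smul]
  rfl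

/-- A point of an open cone determines the morphisms of its last object, so membership in a
subcomplex is membership of the module element. -/
theorem smul_mem_sub_iff (hK : K.IsTame) {Q : ∀ a, Set (M.G a)} (hQ : M.IsStable Q) {m : L}
    {g : M.G m} {x : (K.repr m).Real} (hx : 0 < (K.repr m).wt m x) :
    M.smul g x ∈ sub Q hQ ↔ g ∈ Q m := by
  refine ⟨fun h => ?_, fun h => smul_mem_sub_of_mem hQ h x⟩
  obtain ⟨n, u, t, -, rfl⟩ := Realization.exists_pos x
  obtain ⟨i, hi, hti⟩ := wt_pos_iff.1 hx
  rw [smul_pt, mkPt_mem_sub] at h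
  obtain ⟨j, hj, h⟩ := h
  have hij : i ≤ j := not_lt.1 fun hji => hti.ne' (h i hji)
  obtain rfl : i = j := by
    rcases hij.eq_or_lt with h | h
    · exact h
    · exact absurd hi (hK.obj_ne u h)
  have key : ∀ (b : L) (_ : b = m) (f : K.Hom b m), M.act g f ∈ Q b → g ∈ Q m := by
    rintro b rfl f hf
    rwa [hK.eq_one f, M.act_one] at hf
  exact key _ hi (u.elt i) hj

theorem wt_truncPt_pos {n : ℕ} (u : M.Chain n) (j : Fin (n + 1)) (t : stdSimplex ℝ (Fin (n + 1)))
    (h : 0 < t j) : 0 < (K.repr (u.obj j)).wt (u.obj j) (truncPt u j t) := by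
  rw [truncPt, wt_pos_iff]
  refine ⟨Fin.last j.val, rfl, ?_⟩
  rw [stdSimplex.normalize_apply (fun i => stdSimplex.zero_le t _) (sum_initEmb_pos le_rfl h)]
  exact div_pos h (sum_initEmb_pos le_rfl h)

/-- Every point lies in the image of an open cone, the cone of the last object of its simplex. -/
theorem exists_smul_eq (x : M.Real) :
    ∃ (m : L) (g : M.G m) (y : (K.repr m).Real), 0 < (K.repr m).wt m y ∧ M.smul g y = x := by
  obtain ⟨n, u, t, ht, rfl⟩ := Realization.exists_pos x
  exact ⟨u.obj (Fin.last n), u.elt (Fin.last n), truncPt u (Fin.last n) t,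
    wt_truncPt_pos u _ t (ht _),
    smul_truncPt u _ t fun i hi => absurd hi (not_lt.2 (Fin.le_last i))⟩

/-- The family of those module elements whose object maps to `m`. -/
theorem isStable_below (M : K.RightModule) (m : L) :
    M.IsStable fun a => {_g : M.G a | Nonempty (K.Hom a m)} :=
  fun _ f ⟨h⟩ => ⟨K.comp h f⟩

theorem nonempty_hom_of_smul_eq (hK : K.IsTame) {m m' : L} {g : M.G m} {g' : M.G m'}
    {x : (K.repr m).Real} {x' : (K.repr m').Real} (hx : 0 < (K.repr m).wt m x)
    (h : M.smul g x = M.smul g' x') : Nonempty (K.Hom m m') := by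
  have h1 : M.smul g' x' ∈ sub _ (isStable_below M m') :=
    smul_mem_sub_of_mem (isStable_below M m') ⟨K.one m'⟩ x'
  rw [← h, smul_mem_sub_iff hK _ hx] at h1
  exact h1

/-- Images of different open cones are disjoint. -/
theorem eq_of_smul_eq (hK : K.IsTame) {m m' : L} {g : M.G m} {g' : M.G m'}
    {x : (K.repr m).Real} {x' : (K.repr m').Real} (hx : 0 < (K.repr m).wt m x)
    (hx' : 0 < (K.repr m').wt m' x') (h : M.smul g x = M.smul g' x') : m = m' := by
  obtain ⟨f⟩ := nonempty_hom_of_smul_eq hK hx h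
  obtain ⟨f'⟩ := nonempty_hom_of_smul_eq hK hx' h.symm
  exact hK.antisymm f f'

/-- The open subset of the realization on which the truncation at `m` is defined and has a given
property. -/
def truncSet (M : K.RightModule) {m : L} (O : Set (M.G m × (K.repr m).Real)) : Set M.Real :=
  {x | Quot.lift (fun x : Σ n, M.Chain n × stdSimplex ℝ (Fin (n + 1)) =>
    ∃ (i : _) (h : x.2.1.obj i = m), 0 < x.2.2 i ∧
      (M.castElt h (x.2.1.elt i), castReal K h (truncPt x.2.1 i x.2.2)) ∈ O) (by
      rintro _ _ ⟨θ, x, t⟩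
      refine propext ⟨?_, ?_⟩
      · rintro ⟨i, hi, ht, hO⟩
        refine ⟨θ i, hi, ?_, ?_⟩
        · exact lt_of_lt_of_eq ht (stdSimplex.map_apply_of_injective θ.injective t i).symm
        · have := truncPt_face θ x t i ht
          exact this ▸ hO
      · rintro ⟨k, hi, ht, hO⟩
        by_cases hk : k ∈ range θ
        · obtain ⟨i, rfl⟩ := hk
          have ht' : 0 < t i :=
            lt_of_lt_of_eq ht (stdSimplex.map_apply_of_injective θ.injective t i)
          refine ⟨i, hi, ht', ?_⟩
          have := truncPt_face θ x t i ht'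
          exact this.symm ▸ hO
        · exact absurd (stdSimplex.map_apply_of_notMem_range t hk) ht.ne') x}

theorem mkPt_mem_truncSet {m : L} {O : Set (M.G m × (K.repr m).Real)} {n : ℕ} {u : M.Chain n}
    {t : stdSimplex ℝ (Fin (n + 1))} : mkPt u t ∈ M.truncSet O ↔
      ∃ (i : _) (h : u.obj i = m), 0 < t i ∧
        (M.castElt h (u.elt i), castReal K h (truncPt u i t)) ∈ O := Iff.rfl

theorem isOpen_truncSet {m : L} {O : Set (M.G m × (K.repr m).Real)} (hO : IsOpen O) :
    IsOpen (M.truncSet O) := by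
  refine Realization.isOpen_iff.2 fun n => Chain.isOpen_prod fun o => ?_
  have : {q : {p // M.IsChain o p} × stdSimplex ℝ (Fin (n + 1)) |
      (ofFiber o q.1, q.2) ∈ {p : M.Chain n × stdSimplex ℝ (Fin (n + 1)) |
        mkPt p.1 p.2 ∈ M.truncSet O}}
      = ⋃ i, ⋃ h : o i = m, {q | 0 < q.2 i ∧ (M.castElt h (q.1.1.2 i),
          castReal K h (truncPt (ofFiber o q.1) i q.2)) ∈ O} := by
    ext q
    change mkPt _ _ ∈ M.truncSet O ↔ _
    rw [mkPt_mem_truncSet]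
    simp only [mem_iUnion]
    rfl
  rw [this]
  refine isOpen_iUnion fun i => isOpen_iUnion fun h => ?_
  subst h
  have hc : Continuous fun q : {p // M.IsChain o p} × stdSimplex ℝ (Fin (n + 1)) => q.1.1.2 :=
    continuous_snd.comp (continuous_subtype_val.comp continuous_fst)
  have hi : IsOpen {q : {p // M.IsChain o p} × stdSimplex ℝ (Fin (n + 1)) | 0 < q.2 i} :=
    isOpen_lt continuous_const ((stdSimplex.continuous_apply i).comp continuous_snd)
  have h1 := (continuous_pi_iff.1 hc i).continuousOn.prodMk
    ((continuousOn_truncPt (M := M) o i).mono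
      (fun q (hq : q ∈ {q : {p // M.IsChain o p} × stdSimplex ℝ (Fin (n + 1)) | 0 < q.2 i}) =>
        sum_initEmb_pos (t := q.2) le_rfl hq))
  exact h1.isOpen_inter_preimage hi hO

/-- The image of the product of `M(m)` with an open cone carries the product topology: truncation
at `m` is a continuous inverse. -/
theorem isEmbedding_smul (hK : K.IsTame) {m : L} [T2Space (M.G m)] [LocallyCompactSpace (M.G m)] :
    IsEmbedding fun q : M.G m × {x : (K.repr m).Real // 0 < (K.repr m).wt m x} =>
      M.smul q.1 q.2.1 := by
  have := hK.t2Space_real m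
  have hcont : Continuous fun q : M.G m × {x : (K.repr m).Real // 0 < (K.repr m).wt m x} =>
      M.smul q.1 q.2.1 :=
    continuous_smul.comp (continuous_fst.prodMk (continuous_subtype_val.comp continuous_snd))
  have hw : IsOpen {x : (K.repr m).Real | 0 < (K.repr m).wt m x} :=
    isOpen_lt continuous_const (continuous_wt m)
  have he : IsOpenEmbedding (Prod.map (id : M.G m → M.G m)
      (Subtype.val : {x : (K.repr m).Real // 0 < (K.repr m).wt m x} → _)) :=
    IsOpenEmbedding.id.prodMap hw.isOpenEmbedding_subtypeVal
  refine IsInducing.isEmbedding ⟨le_antisymm hcont.le_induced fun O hO => ?_⟩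
  refine isOpen_induced_iff.2 ⟨M.truncSet (Prod.map id Subtype.val '' O),
    isOpen_truncSet (he.isOpenMap O hO), ?_⟩
  ext ⟨g, x, hx⟩
  obtain ⟨n, u, t, ht, rfl⟩ := Realization.exists_pos x
  have key : ∀ (i : _) (h : u.obj i = m),
      (M.castElt h ((M.smulChain g u).elt i), castReal K h (truncPt (M.smulChain g u) i t)) =
        (g, mkPt u t) := fun i h => by
    refine Prod.ext (act_eq_castElt hK h g (u.elt i)) ?_
    change castReal K h (truncPt (M.smulChain g u) i t) = mkPt u t
    rw [truncPt_smulChain]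
    refine (smul_eq_castReal hK h (u.elt i) _).symm.trans (smul_truncPt u i t fun k hk => ?_)
    exact absurd h (hK.obj_ne u hk)
  change mkPt (M.smulChain g u) t ∈ M.truncSet _ ↔ _
  rw [mkPt_mem_truncSet]
  constructor
  · rintro ⟨i, h, -, hO⟩
    obtain ⟨⟨g', x'⟩, hO', h'⟩ :=
      (congrArg (· ∈ Prod.map id Subtype.val '' O) (key i h)).mp hO
    obtain rfl : g' = g := congrArg Prod.fst h'
    obtain rfl : x' = ⟨mkPt u t, hx⟩ := Subtype.ext (congrArg Prod.snd h')
    exact hO'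
  · intro hO'
    obtain ⟨i, hi, hti⟩ := wt_pos_iff.1 hx
    exact ⟨i, hi, hti, (congrArg (· ∈ Prod.map id Subtype.val '' O) (key i hi)).mpr
      ⟨(g, ⟨mkPt u t, hx⟩), hO', rfl⟩⟩

/-- The stratum of the realization given by a set of elements of `M(m)`. -/
def stratum (M : K.RightModule) {m : L} (P : Set (M.G m)) : Set M.Real :=
  image2 M.smul P {x | 0 < (K.repr m).wt m x}

/-- The closed stable family generated by a set of elements of `M(m)`. -/
def gen (M : K.RightModule) {m : L} (P : Set (M.G m)) (a : L) : Set (M.G a) :=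
  closure (image2 (fun g (f : K.Hom a m) => M.act g f) P univ)

theorem isStable_gen (M : K.RightModule) {m : L} (P : Set (M.G m)) : M.IsStable (M.gen P) := by
  intro a b g f hg
  have hc : Continuous fun g : M.G b => M.act g f :=
    (M.continuous_act a b).comp (continuous_id.prodMk continuous_const)
  refine map_mem_closure (f := fun g => M.act g f) hc hg ?_
  rintro _ ⟨p, hp, h, -, rfl⟩
  exact ⟨p, hp, K.comp h f, mem_univ _, M.act_comp p h f⟩

theorem subset_gen (M : K.RightModule) {m : L} (P : Set (M.G m)) : P ⊆ M.gen P m :=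
  fun p hp => subset_closure ⟨p, hp, K.one m, mem_univ _, M.act_one p⟩

/-- The closure of a stratum is the subcomplex of the closed stable family generated by it. -/
theorem closure_stratum (hK : K.IsTame) {m : L} (P : Set (M.G m)) :
    closure (M.stratum P) = sub (M.gen P) (M.isStable_gen P) := by
  refine subset_antisymm ?_ ?_
  · refine closure_minimal ?_ (isClosed_sub _ fun a => isClosed_closure)
    rintro _ ⟨p, hp, x, -, rfl⟩
    exact smul_mem_sub_of_mem _ (M.subset_gen P hp) x
  · intro z hz
    obtain ⟨a, g, x, hx, rfl⟩ := exists_smul_eq z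
    rw [smul_mem_sub_iff hK _ hx] at hz
    rw [← closure_closure]
    refine map_mem_closure (f := fun g => M.smul g x) (continuous_smul_left x) hz ?_
    rintro _ ⟨p, hp, f, -, rfl⟩
    change M.smul (M.act p f) x ∈ _
    rw [← smul_comp]
    refine map_mem_closure (continuous_smul_right p) (hK.dense_interior m _) ?_
    exact fun y hy => ⟨p, hp, y, hy, rfl⟩

theorem smul_mem_closure_stratum (hK : K.IsTame) {m a : L} {P : Set (M.G m)} {g : M.G a}
    {x : (K.repr a).Real} (hx : 0 < (K.repr a).wt a x) :
    M.smul g x ∈ closure (M.stratum P) ↔ g ∈ M.gen P a := by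
  rw [closure_stratum hK, smul_mem_sub_iff hK _ hx]

theorem smul_mem_stratum (hK : K.IsTame) {m : L} [T2Space (M.G m)] [LocallyCompactSpace (M.G m)]
    {P : Set (M.G m)} {g : M.G m} {x : (K.repr m).Real} (hx : 0 < (K.repr m).wt m x) :
    M.smul g x ∈ M.stratum P ↔ g ∈ P := by
  constructor
  · rintro ⟨p, hp, y, hy, h⟩
    have := (isEmbedding_smul (M := M) hK (m := m)).injective
      (show M.smul p (⟨y, hy⟩ : {x : (K.repr m).Real // 0 < (K.repr m).wt m x}).1 =
        M.smul g (⟨x, hx⟩ : {x : (K.repr m).Real // 0 < (K.repr m).wt m x}).1 from h)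
      (a₁ := (p, ⟨y, hy⟩)) (a₂ := (g, ⟨x, hx⟩))
    exact (show p = g from congrArg Prod.fst this) ▸ hp
  · exact fun hg => ⟨g, hg, x, hx, rfl⟩

/-- The stratum of `m` is the intersection of the closed subcomplex of the objects below `m` with
the open star of `m`. -/
theorem isLocallyClosed_stratum_univ (hK : K.IsTame) (m : L) :
    IsLocallyClosed (M.stratum (univ : Set (M.G m))) := by
  have : M.stratum (univ : Set (M.G m)) =
      sub _ (isStable_below M m) ∩ {x | 0 < M.wt m x} := by
    ext z
    constructor
    · rintro ⟨g, -, x, hx, rfl⟩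
      exact ⟨smul_mem_sub_of_mem (isStable_below M m) ⟨K.one m⟩ x, by
        change 0 < M.wt m (M.smul g x); rwa [wt_smul]⟩
    · rintro ⟨h1, h2⟩
      obtain ⟨a, g, x, hx, rfl⟩ := exists_smul_eq z
      change 0 < M.wt m (M.smul g x) at h2
      rw [smul_mem_sub_iff hK _ hx] at h1
      obtain ⟨f⟩ := h1
      rw [wt_smul] at h2
      obtain ⟨n, u, t, ht, rfl⟩ := Realization.exists_pos x
      obtain ⟨i, hi, -⟩ := wt_pos_iff.1 h2
      obtain rfl : m = a := hK.antisymm (K.castHom hi rfl (u.elt i)) f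
      exact ⟨g, mem_univ _, _, hx, rfl⟩
  rw [this]
  refine IsLocallyClosed.inter (isClosed_sub _ fun a => ?_).isLocallyClosed
    (isOpen_lt continuous_const (continuous_wt m)).isLocallyClosed
  by_cases h : Nonempty (K.Hom a m)
  · simp [h]
  · simp [h]

/-- Inside the locally closed stratum of `m`, which is a product, the stratum of `P` is the preimage
of `P` under the projection. -/
theorem isLocallyClosed_stratum (hK : K.IsTame) {m : L} [T2Space (M.G m)]
    [LocallyCompactSpace (M.G m)] {P : Set (M.G m)} (hP : IsLocallyClosed P) :
    IsLocallyClosed (M.stratum P) := by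
  have he := isEmbedding_smul (M := M) hK (m := m)
  have h1 : IsLocallyClosed ((fun q : M.G m × {x : (K.repr m).Real // 0 < (K.repr m).wt m x} => q.1)
      ⁻¹' P) := hP.preimage continuous_fst
  obtain ⟨V, hV, hV'⟩ := (he.isInducing.isLocallyClosed_iff).1 h1
  have : M.stratum P = M.stratum (univ : Set (M.G m)) ∩ V := by
    ext z
    constructor
    · rintro ⟨g, hg, x, hx, rfl⟩
      refine ⟨⟨g, mem_univ _, x, hx, rfl⟩, ?_⟩
      have : (g, ⟨x, hx⟩) ∈ (fun q : M.G m × {x : (K.repr m).Real // 0 < (K.repr m).wt m x} =>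
        M.smul q.1 q.2.1) ⁻¹' V := hV' ▸ hg
      exact this
    · rintro ⟨⟨g, -, x, hx, rfl⟩, hz⟩
      have : (g, ⟨x, hx⟩) ∈ (fun q : M.G m × {x : (K.repr m).Real // 0 < (K.repr m).wt m x} =>
        q.1) ⁻¹' P := hV' ▸ hz
      exact ⟨g, this, x, hx, rfl⟩
  rw [this]
  exact (isLocallyClosed_stratum_univ hK m).inter hV

theorem isConnected_stratum (hK : K.IsTame) {m : L} [LocallyCompactSpace (M.G m)]
    {P : Set (M.G m)} (hP : IsConnected P) : IsConnected (M.stratum P) := by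
  have := (hP.prod (hK.isConnected_interior m)).image (fun q => M.smul q.1 q.2)
    continuous_smul.continuousOn
  rwa [image_prod] at this

end RightModule

end TopEnrichedCat

/-! ### The Salvetti complex of a topological category -/

namespace TopEnrichedCat

variable {L : Type u} {K : TopEnrichedCat L}

open RightModule

/-- The classifying space is the realization for the trivial module. -/
def classifyingHomeo (K : TopEnrichedCat L) : K.trivialModule.Real ≃ₜ K.Classifying where
  toFun := Realization.map (fun _ v => ⟨⟨v.obj, v.edge⟩, v.2.1⟩) (fun _ _ => rfl)
  invFun := Realization.map (fun _ u => ⟨⟨u.1.1, u.1.2, fun _ => PUnit.unit⟩, u.2, fun _ => rfl⟩)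
    (fun _ _ => rfl)
  left_inv x := by
    obtain ⟨n, u, t, -, rfl⟩ := Realization.exists_pos x
    rfl
  right_inv x := by
    obtain ⟨n, u, t, -, rfl⟩ := Realization.exists_pos x
    rfl
  continuous_toFun := Realization.continuous_map _ _ fun n => by
    suffices h : Continuous fun q : K.trivialModule.Chain n × Unit =>
        (⟨⟨q.1.obj, q.1.edge⟩, q.1.2.1⟩ : K.Nerve n) from
      h.comp (continuous_id.prodMk (continuous_const (y := ())))
    refine Chain.continuous_prod fun o => continuous_induced_rng.2 ?_
    exact (continuous_sigmaMk (σ := fun o : Fin (n + 1) → L =>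
      ∀ ij : EdgeIdx n, K.Hom (o ij.1.1) (o ij.1.2)) (i := o)).comp
      (continuous_fst.comp (continuous_subtype_val.comp continuous_fst))
  continuous_invFun := Realization.continuous_map _ _ fun n => by
    refine continuous_induced_rng.2 ?_
    have h : Continuous fun x : Σ o : Fin (n + 1) → L,
        ∀ ij : EdgeIdx n, K.Hom (o ij.1.1) (o ij.1.2) =>
        (⟨x.1, x.2, fun _ => PUnit.unit⟩ : Σ o : Fin (n + 1) → L,
          (∀ ij : EdgeIdx n, K.Hom (o ij.1.1) (o ij.1.2)) × (∀ i, K.trivialModule.G (o i))) := by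
      refine continuous_sigma fun o => ?_
      exact (continuous_sigmaMk (σ := fun o : Fin (n + 1) → L =>
        (∀ ij : EdgeIdx n, K.Hom (o ij.1.1) (o ij.1.2)) × (∀ i, K.trivialModule.G (o i)))
        (i := o)).comp (continuous_id.prodMk (continuous_const (y := fun _ => PUnit.unit)))
    exact h.comp continuous_subtype_val

/-- The Salvetti complex depends only on the cylindrical face category: `C.Sal` unfolds to
`C.K.salvetti`. -/
noncomputable abbrev salvetti (K : TopEnrichedCat L) : CylData K.Classifying where
  L := L
  str l := {x | ∃ (k : ℕ) (u : K.Nerve k) (t : stdSimplex ℝ (Fin (k + 1))),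
    (∀ i, 0 < t i) ∧ u.1.1 (Fin.last k) = l ∧ x = K.pt u t}
  K := K
  D l := K.RealLower l
  center l := Realization.mk (K.lowerFace l) (n := 0)
    ⟨⟨fun _ => l, fun _ => K.one l, fun _ => K.one l⟩,
      ⟨fun _ _ _ => Subsingleton.elim (α := Fin 1) _ _, fun _ _ _ _ _ => (K.one_comp _).symm⟩,
      fun _ => (K.one_comp _).symm⟩
    (stdSimplex.vertex 0)
  bdry l := {x | ∃ (k : ℕ) (u : K.LowerStar l k) (t : stdSimplex ℝ (Fin (k + 1))),
    (∀ i, u.1.1 i ≠ l) ∧ x = Realization.mk (K.lowerFace l) u t}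
  φ l := Realization.map (fun _ u => ⟨⟨u.1.1, u.1.2.1⟩, u.2.1⟩) (fun _ _ => rfl)
  act q := Realization.map
    (fun _ u => ⟨⟨u.1.1, u.1.2.1, fun i => K.comp q (u.1.2.2 i)⟩, u.2.1, fun ij => by
      simp only [u.2.2 ij, K.assoc]⟩) (fun _ _ => rfl)

theorem salvetti_φ {l : L} (x : (K.repr l).Real) :
    K.salvetti.φ l x = K.classifyingHomeo (K.trivialModule.smul (m := l) PUnit.unit x) := by
  obtain ⟨n, u, t, -, rfl⟩ := Realization.exists_pos x
  rfl

theorem mem_salvetti_bdry {l : L} {x : (K.repr l).Real} :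
    x ∈ K.salvetti.bdry l ↔ (K.repr l).wt l x = 0 := by
  constructor
  · rintro ⟨k, u, t, hu, rfl⟩
    exact wt_eq_zero (M := K.repr l) u t hu
  · intro h
    obtain ⟨n, u, t, ht, rfl⟩ := Realization.exists_pos x
    refine ⟨n, u, t, fun i hi => ?_, rfl⟩
    exact (wt_pos_iff.2 ⟨i, hi, ht i⟩).ne' h

theorem notMem_salvetti_bdry {l : L} {x : (K.repr l).Real} :
    x ∉ K.salvetti.bdry l ↔ 0 < (K.repr l).wt l x := by
  rw [mem_salvetti_bdry]
  exact (wt_nonneg l x).lt_iff_ne'.symm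

theorem compl_salvetti_bdry (l : L) :
    (K.salvetti.bdry l)ᶜ = {x : (K.repr l).Real | 0 < (K.repr l).wt l x} :=
  Set.ext fun _ => notMem_salvetti_bdry

theorem image_φ_interior (l : L) : K.salvetti.φ l '' (K.salvetti.bdry l)ᶜ =
    K.classifyingHomeo '' K.trivialModule.stratum (univ : Set (K.trivialModule.G l)) := by
  rw [compl_salvetti_bdry]
  ext z
  constructor
  · rintro ⟨x, hx, rfl⟩
    exact ⟨_, ⟨PUnit.unit, mem_univ _, x, hx, rfl⟩, (salvetti_φ x).symm⟩
  · rintro ⟨_, ⟨⟨⟩, -, x, hx, rfl⟩, rfl⟩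
    exact ⟨x, hx, salvetti_φ x⟩

theorem IsTame.image_φ_interior_eq_str (hK : K.IsTame) (l : L) :
    K.salvetti.φ l '' (K.salvetti.bdry l)ᶜ = K.salvetti.str l := by
  rw [compl_salvetti_bdry]
  ext z
  constructor
  · rintro ⟨x, hx, rfl⟩
    obtain ⟨n, u, t, ht, rfl⟩ := Realization.exists_pos x
    obtain ⟨i, hi, -⟩ := wt_pos_iff.1 hx
    exact ⟨n, ⟨⟨u.1.1, u.1.2.1⟩, u.2.1⟩, t, ht, hK.last_of_obj_eq u hi ▸ hi, rfl⟩
  · rintro ⟨k, u, t, ht, rfl, rfl⟩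
    let v : K.trivialModule.Chain k := ⟨⟨u.1.1, u.1.2, fun _ => PUnit.unit⟩, u.2, fun _ => rfl⟩
    refine ⟨truncPt v (Fin.last k) t, wt_truncPt_pos v _ t (ht _), ?_⟩
    have h := smul_truncPt v (Fin.last k) t fun i hi => absurd hi (not_lt.2 (Fin.le_last i))
    exact (salvetti_φ (l := v.obj (Fin.last k)) _).trans (congrArg K.classifyingHomeo h)

theorem IsTame.str_eq (hK : K.IsTame) (l : L) : K.salvetti.str l =
    K.classifyingHomeo '' K.trivialModule.stratum (univ : Set (K.trivialModule.G l)) := by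
  rw [← hK.image_φ_interior_eq_str, image_φ_interior]

theorem IsTame.closure_str_eq (hK : K.IsTame) (l : L) : closure (K.salvetti.str l) =
    K.classifyingHomeo ''
      closure (K.trivialModule.stratum (univ : Set (K.trivialModule.G l))) := by
  rw [hK.str_eq, K.classifyingHomeo.image_closure]

theorem mem_gen_trivial {l a : L} (g : K.trivialModule.G a) :
    g ∈ K.trivialModule.gen (univ : Set (K.trivialModule.G l)) a ↔ Nonempty (K.Hom a l) := by
  constructor
  · intro h
    have := closure_nonempty_iff.1 ⟨g, h⟩
    obtain ⟨_, _, _, f, _, _⟩ := this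
    exact ⟨f⟩
  · rintro ⟨f⟩
    exact subset_closure ⟨PUnit.unit, mem_univ _, f, mem_univ _, rfl⟩

/-- A stratum of the Salvetti complex meets the closure of another one only if there is a morphism
between their indices. -/
theorem IsTame.nonempty_hom_of_inter (hK : K.IsTame) {m l : L}
    (h : (K.salvetti.str m ∩ closure (K.salvetti.str l)).Nonempty) : Nonempty (K.Hom m l) := by
  rw [hK.str_eq, hK.closure_str_eq] at h
  obtain ⟨_, ⟨_, ⟨g, -, x, hx, rfl⟩, rfl⟩, ⟨w, hw, hw'⟩⟩ := h
  obtain rfl := K.classifyingHomeo.injective hw'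
  rw [smul_mem_closure_stratum hK hx, mem_gen_trivial] at hw
  exact hw

theorem IsTame.str_subset_closure (hK : K.IsTame) {m l : L} (h : Nonempty (K.Hom m l)) :
    K.salvetti.str m ⊆ closure (K.salvetti.str l) := by
  rw [hK.str_eq, hK.closure_str_eq]
  refine image_mono ?_
  rintro _ ⟨g, -, x, hx, rfl⟩
  rw [smul_mem_closure_stratum hK hx, mem_gen_trivial]
  exact h

theorem IsTame.disjoint_str (hK : K.IsTame) {m l : L} (h : m ≠ l) :
    Disjoint (K.salvetti.str m) (K.salvetti.str l) := by
  rw [hK.str_eq, hK.str_eq, disjoint_image_iff K.classifyingHomeo.injective, Set.disjoint_left]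
  rintro _ ⟨g, -, x, hx, rfl⟩ ⟨g', -, x', hx', h'⟩
  exact h (eq_of_smul_eq hK hx hx' h'.symm)

/-- Closedness in the closure of a stratum can be tested on the domain of its cell. -/
theorem IsTame.isClosed_of_preimage (hK : K.IsTame) {l : L} {A : Set K.trivialModule.Real}
    (hA : A ⊆ closure (K.trivialModule.stratum (univ : Set (K.trivialModule.G l))))
    (h : IsClosed (K.trivialModule.smul (m := l) PUnit.unit ⁻¹' A)) : IsClosed A := by
  refine Realization.isClosed_iff.2 fun n => Chain.isClosed_prod fun o => ?_
  have : {q : {p // K.trivialModule.IsChain o p} × stdSimplex ℝ (Fin (n + 1)) |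
      (ofFiber o q.1, q.2) ∈ {p : K.trivialModule.Chain n × stdSimplex ℝ (Fin (n + 1)) |
        mkPt p.1 p.2 ∈ A}}
      = ⋃ j, ⋃ f : Nonempty (K.Hom (o j) l), ({q | ∀ i, j < i → q.2 i = 0} ∩
        (fun q => (K.repr l).smul f.some (truncPt (ofFiber o q.1) j q.2)) ⁻¹'
          (K.trivialModule.smul (m := l) PUnit.unit ⁻¹' A)) := by
    ext q
    have key : ∀ j (f : K.Hom (o j) l), (∀ i, j < i → q.2 i = 0) →
        K.trivialModule.smul (m := l) PUnit.unit
          ((K.repr l).smul f (truncPt (ofFiber o q.1) j q.2)) = mkPt (ofFiber o q.1) q.2 := by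
      intro j f hj
      rw [smul_comp]
      exact smul_truncPt (ofFiber o q.1) j q.2 hj
    simp only [mem_iUnion, mem_inter_iff, mem_preimage]
    change mkPt _ _ ∈ A ↔ _
    constructor
    · intro hq
      have h1 := hA hq
      rw [closure_stratum hK, mkPt_mem_sub] at h1
      obtain ⟨j, hj, hj'⟩ := h1
      rw [mem_gen_trivial] at hj
      refine ⟨j, hj, hj', ?_⟩
      rw [key j _ hj']
      exact hq
    · rintro ⟨j, f, hj, hq⟩
      rwa [key j _ hj] at hq
  -- On the closed set where the weights beyond `j` vanish, the truncation at `j`, followed by any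
  -- morphism to `l`, is a continuous lift to the domain of `l`.
  rw [this]
  refine isClosed_iUnion_of_finite fun j => isClosed_iUnion_of_finite fun f => ?_
  refine ContinuousOn.preimage_isClosed_of_isClosed ?_ ?_ h
  · refine (continuous_smul_right (M := K.repr l) f.some).comp_continuousOn
      ((continuousOn_truncPt (M := K.trivialModule) o j).mono fun q hq => ?_)
    obtain ⟨i, hi⟩ := stdSimplex.exists_pos q.2
    exact sum_initEmb_pos (t := q.2) (not_lt.1 fun hj => hi.ne' (hq i hj)) hi
  · have : {q : {p // K.trivialModule.IsChain o p} × stdSimplex ℝ (Fin (n + 1)) |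
        ∀ i, j < i → q.2 i = 0} = ⋂ i, ⋂ (_ : j < i), {q | q.2 i = 0} := by
      ext q
      simp
    rw [this]
    exact isClosed_iInter fun i => isClosed_iInter fun _ =>
      isClosed_eq ((stdSimplex.continuous_apply i).comp continuous_snd) continuous_const

theorem IsTame.φ_mem_closure (hK : K.IsTame) (l : L) (x : (K.repr l).Real) :
    K.salvetti.φ l x ∈ closure (K.salvetti.str l) := by
  rw [hK.closure_str_eq, salvetti_φ]
  refine mem_image_of_mem _ ?_
  rw [closure_stratum hK]
  exact smul_mem_sub_of_mem _ (K.trivialModule.subset_gen _ (mem_univ _)) x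

theorem IsTame.isQuotientMap_φ (hK : K.IsTame) (l : L) :
    IsQuotientMap (codRestrict (K.salvetti.φ l) (closure (K.salvetti.str l))
      (hK.φ_mem_closure l)) := by
  have hcont : Continuous (K.salvetti.φ l) := by
    have : K.salvetti.φ l = K.classifyingHomeo ∘ K.trivialModule.smul (m := l) PUnit.unit :=
      funext salvetti_φ
    rw [this]
    exact K.classifyingHomeo.continuous.comp (continuous_smul_right _)
  refine isQuotientMap_iff_isClosed.2 ⟨?_, fun s => ⟨fun h => h.preimage
    (hcont.codRestrict _), fun h => ?_⟩⟩
  · rintro ⟨z, hz⟩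
    have hz' := hz
    rw [hK.closure_str_eq] at hz'
    obtain ⟨w, hw, rfl⟩ := hz'
    obtain ⟨a, g, x, hx, rfl⟩ := exists_smul_eq w
    rw [smul_mem_closure_stratum hK hx, mem_gen_trivial] at hw
    obtain ⟨f⟩ := hw
    refine ⟨(K.repr l).smul f x, Subtype.ext ?_⟩
    exact (salvetti_φ _).trans (congrArg _ (smul_comp (M := K.trivialModule) f PUnit.unit x))
  · rw [isClosed_closure.isClosedEmbedding_subtypeVal.isClosed_iff_image_isClosed,
      ← K.classifyingHomeo.isClosed_preimage]
    refine hK.isClosed_of_preimage (l := l) ?_ ?_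
    · rintro w ⟨z, -, hz⟩
      have := z.2
      replace this : z.1 ∈ _ := this
      rw [hz] at this
      obtain ⟨w', hw', h'⟩ := hK.closure_str_eq l ▸ this
      rwa [K.classifyingHomeo.injective h'] at hw'
    · refine (congrArg IsClosed (Set.ext fun x => ?_)).mpr h
      constructor
      · rintro ⟨z, hz, hz'⟩
        have : codRestrict (K.salvetti.φ l) (closure (K.salvetti.str l))
            (hK.φ_mem_closure l) x = z := Subtype.ext ((salvetti_φ x).trans hz'.symm)
        exact mem_preimage.2 (this.symm ▸ hz)
      · exact fun hx => ⟨_, hx, salvetti_φ x⟩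

theorem IsTame.isEmbedding_φ_interior (hK : K.IsTame) (l : L) :
    IsEmbedding fun x : {x // x ∉ K.salvetti.bdry l} => K.salvetti.φ l x := by
  have h1 : IsEmbedding (inclusion (s := {x : (K.repr l).Real | x ∉ K.salvetti.bdry l})
      (t := {x : (K.repr l).Real | 0 < (K.repr l).wt l x})
      (fun x hx => notMem_salvetti_bdry.1 hx)) := IsEmbedding.inclusion _
  have h2 : IsEmbedding (fun x : {x : (K.repr l).Real // 0 < (K.repr l).wt l x} =>
      ((PUnit.unit : K.trivialModule.G l), x)) :=
    Function.LeftInverse.isEmbedding (f := Prod.snd) (fun _ => rfl) continuous_snd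
      (continuous_const.prodMk continuous_id)
  have : T2Space (K.trivialModule.G l) := inferInstanceAs (T2Space PUnit)
  have : LocallyCompactSpace (K.trivialModule.G l) := inferInstanceAs (LocallyCompactSpace PUnit)
  have h3 := K.classifyingHomeo.isEmbedding.comp
    ((isEmbedding_smul (M := K.trivialModule) hK (m := l)).comp (h2.comp h1))
  refine (congrArg IsEmbedding (funext fun x : {x // x ∉ K.salvetti.bdry l} => ?_)).mpr h3
  exact salvetti_φ x.1

/-- Stratifications of the morphism spaces that are compatible with composition, and for which the
closed stable families generated by strata are unions of strata. -/
structure IsParStratification (K : TopEnrichedCat L) (par : ∀ m l, Set (Set (K.Hom m l))) :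
    Prop where
  isStratification : ∀ m l, IsStratification (par m l)
  comp_mem : ∀ a b c, ∀ q ∈ par b c, ∀ p ∈ par a b, image2 (fun g f => K.comp g f) q p ∈ par a c
  normal : ∀ m a l, ∀ P ∈ par m l, ∀ P' ∈ par a l, (P ∩ (K.repr l).gen P' m).Nonempty →
    P ⊆ (K.repr l).gen P' m

/-- The stratifications of the Salvetti complex given by stratifications of the morphism spaces:
the strata of the boundary over `l` are the products of strata of `Hom(m, l)` and open cones. -/
def salvettiStrats (K : TopEnrichedCat L) (par : ∀ m l, Set (Set (K.Hom m l))) :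
    K.salvetti.Strats where
  par := par
  bd l := {e | ∃ m, m ≠ l ∧ ∃ P ∈ par m l, Subtype.val '' e = (K.repr l).stratum (m := m) P}

theorem IsTame.wt_smul_eq_zero (hK : K.IsTame) {m l : L} (h : m ≠ l) (p : K.Hom m l)
    (x : (K.repr m).Real) : (K.repr l).wt l ((K.repr l).smul p x) = 0 := by
  rw [wt_smul]
  obtain ⟨n, u, t, -, rfl⟩ := Realization.exists_pos x
  refine wt_eq_zero u t fun i hi => h ?_
  exact hK.antisymm p (K.castHom hi rfl (u.elt i))

theorem IsTame.stratum_subset_bdry (hK : K.IsTame) {m l : L} (h : m ≠ l) (P : Set (K.Hom m l)) :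
    (K.repr l).stratum (m := m) P ⊆ K.salvetti.bdry l := by
  rintro _ ⟨p, -, x, -, rfl⟩
  exact mem_salvetti_bdry.2 (hK.wt_smul_eq_zero h p x)

theorem IsTame.image_val_preimage_stratum (hK : K.IsTame) {m l : L} (h : m ≠ l)
    (P : Set (K.Hom m l)) :
    (Subtype.val : K.salvetti.bdry l → (K.repr l).Real) ''
      (Subtype.val ⁻¹' (K.repr l).stratum (m := m) P) = (K.repr l).stratum (m := m) P := by
  exact (Subtype.image_preimage_val _ _).trans
    (inter_eq_right.2 (hK.stratum_subset_bdry h P))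

theorem image2_interior {m l : L} (P : Set (K.Hom m l)) :
    image2 (K.salvetti.act (m := m) (l := l)) P (K.salvetti.bdry m)ᶜ =
      (K.repr l).stratum (m := m) P := by
  rw [compl_salvetti_bdry]
  rfl

/-- Normality of the strata of the boundary reduces, by the description of closures of strata, to
the normality condition on the stratifications of the morphism spaces. -/
theorem IsTame.isNormalStratification_bd (hK : K.IsTame) [∀ a b, LocallyCompactSpace (K.Hom a b)]
    {par : ∀ m l, Set (Set (K.Hom m l))} (hp : K.IsParStratification par) (l : L) :
    IsNormalStratification ((K.salvettiStrats par).bd l) := by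
  have : ∀ a b, T2Space (K.Hom a b) := hK.t2Space_hom
  refine ⟨⟨?_, ?_, ?_⟩, ?_⟩
  · rintro e ⟨m, hm, P, hP, he⟩
    have hs := (hp.isStratification m l).1 P hP
    constructor
    · have hc : IsConnected (Subtype.val '' e) := by
        rw [he]; exact isConnected_stratum (M := K.repr l) hK hs.1
      exact ⟨hc.nonempty.of_image,
        (IsInducing.subtypeVal.isPreconnected_image).1 hc.isPreconnected⟩
    · have hc : IsLocallyClosed (Subtype.val '' e) := by
        rw [he]; exact isLocallyClosed_stratum (M := K.repr l) hK hs.2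
      have := hc.preimage (continuous_subtype_val (p := fun x => x ∈ K.salvetti.bdry l))
      rwa [preimage_image_eq _ Subtype.val_injective] at this
  · rintro e ⟨m, hm, P, hP, he⟩ e' ⟨m', hm', P', hP', he'⟩ hne
    rw [Function.onFun, id, id, Set.disjoint_left]
    intro x hx hx'
    have h1 : x.1 ∈ (K.repr l).stratum (m := m) P := he ▸ mem_image_of_mem _ hx
    have h2 : x.1 ∈ (K.repr l).stratum (m := m') P' := he' ▸ mem_image_of_mem _ hx'
    obtain ⟨g, hg, y, hy, h3⟩ := h1
    obtain ⟨g', hg', y', hy', h4⟩ := h2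
    obtain rfl := eq_of_smul_eq hK hy hy' (h3.trans h4.symm)
    have h5 : (K.repr l).smul g y ∈ (K.repr l).stratum P' := ⟨g', hg', y', hy', h4.trans h3.symm⟩
    have h6 := (smul_mem_stratum (M := K.repr l) hK hy).1 h5
    have h7 : P = P' := by
      by_contra hne
      exact Set.disjoint_left.1 ((hp.isStratification m l).2.1 hP hP' hne) hg h6
    subst h7
    exact hne (Subtype.val_injective.image_injective (he.trans he'.symm))
  · refine eq_univ_of_forall fun x => ?_
    obtain ⟨m, g, y, hy, h⟩ := exists_smul_eq (M := K.repr l) x.1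
    have hm : m ≠ l := by
      rintro rfl
      have h0 := mem_salvetti_bdry.1 x.2
      rw [← h, wt_smul] at h0
      exact hy.ne' h0
    obtain ⟨P, hP, hg⟩ : g ∈ ⋃₀ par m l := (hp.isStratification m l).2.2 ▸ mem_univ g
    exact ⟨Subtype.val ⁻¹' (K.repr l).stratum (m := m) P,
      ⟨m, hm, P, hP, hK.image_val_preimage_stratum hm P⟩, ⟨g, hg, y, hy, h⟩⟩
  · rintro e ⟨m, hm, P, hP, he⟩ e' ⟨m', hm', P', hP', he'⟩ ⟨x, hx, hx'⟩ z hz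
    rw [closure_subtype, he'] at hx' ⊢
    have h1 : x.1 ∈ (K.repr l).stratum (m := m) P := he ▸ mem_image_of_mem _ hx
    have h2 : z.1 ∈ (K.repr l).stratum (m := m) P := he ▸ mem_image_of_mem _ hz
    obtain ⟨g, hg, y, hy, h3⟩ := h1
    obtain ⟨g', hg', y', hy', h4⟩ := h2
    rw [← h3] at hx'
    rw [← h4]
    exact (smul_mem_closure_stratum (M := K.repr l) hK hy').2 (hp.normal m m' l P hP P' hP'
      ⟨g, hg, (smul_mem_closure_stratum (M := K.repr l) hK hy).1 hx'⟩ hg')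

theorem image2_stratum {a m l : L} (P : Set (K.Hom m l)) (P' : Set (K.Hom a m)) :
    image2 (K.salvetti.act (m := m) (l := l)) P ((K.repr m).stratum (m := a) P') =
      (K.repr l).stratum (m := a) (image2 (fun g f => K.comp g f) P P') := by
  ext z
  constructor
  · rintro ⟨p, hp, _, ⟨q, hq, x, hx, rfl⟩, rfl⟩
    exact ⟨K.comp p q, ⟨p, hp, q, hq, rfl⟩, x, hx, (smul_comp (M := K.repr l) q p x).symm⟩
  · rintro ⟨_, ⟨p, hp, q, hq, rfl⟩, x, hx, rfl⟩
    exact ⟨p, hp, _, ⟨q, hq, x, hx, rfl⟩, smul_comp (M := K.repr l) q p x⟩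

theorem IsTame.isCylNormal_salvetti (hK : K.IsTame) [∀ a b, LocallyCompactSpace (K.Hom a b)]
    {par : ∀ m l, Set (Set (K.Hom m l))} (hp : K.IsParStratification par) :
    K.salvetti.IsCylNormal (K.salvettiStrats par) := by
  have : ∀ a b, T2Space (K.Hom a b) := hK.t2Space_hom
  have : ∀ l, LocallyCompactSpace (K.trivialModule.G l) := fun l =>
    inferInstanceAs (LocallyCompactSpace PUnit)
  exact
  { connected := fun l => by
      rw [hK.str_eq]
      have : IsConnected (univ : Set (K.trivialModule.G l)) :=
        isConnected_univ (α := PUnit)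
      exact (isConnected_stratum hK this).image _ K.classifyingHomeo.continuous.continuousOn
    locallyClosed := fun l => by
      rw [hK.str_eq, ← K.classifyingHomeo.preimage_symm]
      exact (isLocallyClosed_stratum_univ hK l).preimage K.classifyingHomeo.symm.continuous
    disjoint := fun m l h => hK.disjoint_str h
    cover := by
      refine eq_univ_of_forall fun z => ?_
      obtain ⟨w, rfl⟩ := K.classifyingHomeo.surjective z
      obtain ⟨m, g, x, hx, rfl⟩ := exists_smul_eq w
      rw [mem_iUnion]
      refine ⟨m, ?_⟩
      rw [hK.str_eq]
      exact mem_image_of_mem _ ⟨g, mem_univ _, x, hx, rfl⟩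
    normal := fun m l h => hK.str_subset_closure (hK.nonempty_hom_of_inter h)
    quotient := fun l => ⟨hK.φ_mem_closure l, hK.isQuotientMap_φ l⟩
    embedding_interior := hK.isEmbedding_φ_interior
    image_interior := hK.image_φ_interior_eq_str
    hom_self := hK.subsingleton
    le_of_hom := fun m l h => hK.str_subset_closure h
    par_strat := hp.isStratification
    bd_strat := hK.isNormalStratification_bd hp
    continuous_act := fun m l => continuous_smul (M := K.repr l)
    act_interior := fun m l h P hP => ⟨Subtype.val ⁻¹' (K.repr l).stratum (m := m) P,
      ⟨m, h, P, hP, hK.image_val_preimage_stratum h P⟩,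
      (hK.image_val_preimage_stratum h P).trans (image2_interior P).symm⟩
    act_boundary := by
      rintro m l h P hP e' ⟨a, ha, P', hP', he'⟩
      -- Acyclicity: there are morphisms from `a` to `m` and from `m` to `l`.
      have hal : a ≠ l := by
        rintro rfl
        obtain ⟨p, hp'⟩ := ((hp.isStratification m a).1 P hP).1.nonempty
        obtain ⟨q, hq⟩ := ((hp.isStratification a m).1 P' hP').1.nonempty
        exact h (hK.antisymm p q)
      refine ⟨Subtype.val ⁻¹' (K.repr l).stratum (m := a) (image2 (fun g f => K.comp g f) P P'),
        ⟨a, hal, _, hp.comp_mem a m l P hP P' hP', hK.image_val_preimage_stratum hal _⟩, ?_⟩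
      refine (hK.image_val_preimage_stratum hal _).trans ?_
      rw [he']
      exact (image2_stratum P P').symm
    comp_strict := hp.comp_mem
    embedding_act := fun m l h => by
      have h1 : IsEmbedding (inclusion (s := {x : (K.repr m).Real | x ∉ K.salvetti.bdry m})
          (t := {x : (K.repr m).Real | 0 < (K.repr m).wt m x})
          (fun x hx => notMem_salvetti_bdry.1 hx)) := IsEmbedding.inclusion _
      exact (isEmbedding_smul (M := K.repr l) hK (m := m)).comp
        ((IsEmbedding.id (X := K.Hom m l)).prodMap h1)
    φ_act := fun m l p x => by
      obtain ⟨n, u, t, -, rfl⟩ := Realization.exists_pos x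
      rfl
    act_comp := fun a b c q p x => (smul_comp (M := K.repr c) p q x).symm
    act_one := fun l x => one_smul x
    bdry_eq := fun l => by
      ext z
      simp only [mem_iUnion]
      constructor
      · intro hz
        obtain ⟨m, g, y, hy, h⟩ := exists_smul_eq (M := K.repr l) z
        have hm : m ≠ l := by
          rintro rfl
          have h0 := mem_salvetti_bdry.1 hz
          rw [← h, wt_smul] at h0
          exact hy.ne' h0
        exact ⟨m, hm, g, mem_univ _, y, notMem_salvetti_bdry.2 hy, h⟩
      · rintro ⟨m, hm, g, -, y, -, rfl⟩
        exact mem_salvetti_bdry.2 (hK.wt_smul_eq_zero hm g y) }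

end TopEnrichedCat

/-! ### Simplicial cellular stratifications -/

/-- Adding small positive constants to the coordinates and normalizing moves a point into the open
simplex. -/
theorem stdSimplex.dense_pos (k : ℕ) : Dense {t : stdSimplex ℝ (Fin (k + 1)) | ∀ i, 0 < t i} := by
  intro t
  have hc : Continuous fun s : ℝ => stdSimplex.normalize fun i => t i + max s 0 := by
    refine stdSimplex.continuousOn_normalize.comp_continuous (by fun_prop) fun s => ?_
    obtain ⟨i, hi⟩ := stdSimplex.exists_pos t
    have h : ∀ i, 0 ≤ t i + max s 0 := fun i =>
      add_nonneg (stdSimplex.zero_le t i) (le_max_right _ _)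
    exact ⟨h, Finset.sum_pos' (fun i _ => h i)
      ⟨i, Finset.mem_univ i, add_pos_of_pos_of_nonneg hi (le_max_right _ _)⟩⟩
  have h0 : (0 : ℝ) ∈ closure (Ioi (0 : ℝ)) := by rw [closure_Ioi]; exact mem_Ici.2 le_rfl
  have h := map_mem_closure hc h0 (t := {t : stdSimplex ℝ (Fin (k + 1)) | ∀ i, 0 < t i})
    fun s hs i => ?_
  · simpa using h
  · have h : ∀ i, 0 < t i + max s 0 := fun i =>
      add_pos_of_nonneg_of_pos (stdSimplex.zero_le t i) (lt_max_of_lt_left hs)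
    have h' : 0 < ∑ i, (t i + max s 0) := Finset.sum_pos (fun i _ => h i) Finset.univ_nonempty
    rw [stdSimplex.normalize_apply (fun i => (h i).le) h']
    exact div_pos (h i) h'

/-- The simplex with its barycentric coordinates is homeomorphic to the ball in such a way that the
open simplex corresponds to the open ball. -/
theorem stdSimplex.exists_homeomorph_closedBall (k : ℕ) :
    ∃ e : closedBall (0 : Eucl k) 1 ≃ₜ stdSimplex ℝ (Fin (k + 1)),
      ∀ x : closedBall (0 : Eucl k) 1, (x : Eucl k) ∈ ball (0 : Eucl k) 1 ↔ ∀ i, 0 < e x i := by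
  -- A nondegenerate affine simplex in `Eucl k` is a convex body, hence homeomorphic to the ball.
  obtain ⟨b⟩ : Nonempty (AffineBasis (Fin (k + 1)) ℝ (Eucl k)) :=
    AffineBasis.exists_affineBasis_of_finiteDimensional (by simp)
  have hcl : IsClosed (convexHull ℝ (range b)) :=
    (finite_range b).isClosed_convexHull ℝ
  obtain ⟨h, hi, hc, -⟩ := exists_homeomorph_image_interior_closure_frontier_eq_unitBall
    (convex_convexHull ℝ (range b)) (b.centroid_mem_interior_convexHull |> fun h => ⟨_, h⟩)
    ((isBounded_convexHull).2 (finite_range b).isBounded)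
  rw [hcl.closure_eq] at hc
  have hmem : ∀ x : closedBall (0 : Eucl k) 1, h.symm x ∈ convexHull ℝ (range b) := fun x => by
    obtain ⟨y, hy, hyx⟩ : (x : Eucl k) ∈ h '' convexHull ℝ (range b) := by
      rw [hc]; exact x.2
    rw [← hyx, h.symm_apply_apply]
    exact hy
  have hnn : ∀ x : closedBall (0 : Eucl k) 1, ∀ i, 0 ≤ b.coord i (h.symm x) := fun x => by
    have := hmem x
    rwa [b.convexHull_eq_nonneg_coord] at this
  let f : closedBall (0 : Eucl k) 1 → stdSimplex ℝ (Fin (k + 1)) := fun x =>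
    ⟨fun i => b.coord i (h.symm x), hnn x, b.sum_coord_apply_eq_one _⟩
  have hf : Continuous f := continuous_induced_rng.2 (continuous_pi fun i =>
    (continuous_barycentric_coord b i).comp (h.symm.continuous.comp continuous_subtype_val))
  have hinj : Function.Injective f := fun x y hxy => by
    have h1 : h.symm (x : Eucl k) = h.symm y := b.ext_elem fun i =>
      congrFun (congrArg Subtype.val hxy) i
    exact Subtype.ext (h.symm.injective h1)
  have hsurj : Function.Surjective f := fun t => by
    have hs : ∑ i, t i = 1 := t.2.2
    let y := Finset.univ.affineCombination ℝ b fun i => t i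
    have hy : ∀ i, b.coord i y = t i := fun i =>
      b.coord_apply_combination_of_mem (Finset.mem_univ i) hs
    have hy' : y ∈ convexHull ℝ (range b) := by
      rw [b.convexHull_eq_nonneg_coord]
      exact fun i => (hy i).symm ▸ t.2.1 i
    refine ⟨⟨h y, hc ▸ mem_image_of_mem _ hy'⟩, ?_⟩
    ext i
    change b.coord i (h.symm (h y)) = t i
    rw [h.symm_apply_apply, hy]
  refine ⟨(Continuous.homeoOfEquivCompactToT2 (f := Equiv.ofBijective f ⟨hinj, hsurj⟩) hf),
    fun x => ?_⟩
  rw [← hi, b.interior_convexHull]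
  constructor
  · rintro ⟨y, hy, hyx⟩ i
    change 0 < b.coord i (h.symm x)
    rw [← hyx, h.symm_apply_apply]
    exact hy i
  · exact fun hx => ⟨h.symm x, hx, h.apply_symm_apply _⟩

theorem stdSimplex.isConnected_pos (k : ℕ) :
    IsConnected {t : stdSimplex ℝ (Fin (k + 1)) | ∀ i, 0 < t i} := by
  have h1 : IsConnected {w : Fin (k + 1) → ℝ | ∀ i, 0 < w i} := by
    refine ⟨⟨fun _ => 1, fun _ => one_pos⟩, Convex.isPreconnected ?_⟩
    intro v hv w hw a b ha hb hab i
    rcases ha.eq_or_lt with rfl | ha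
    · obtain rfl : b = 1 := by linarith
      simpa using hw i
    · exact add_pos_of_pos_of_nonneg (mul_pos ha (hv i)) (mul_nonneg hb (hw i).le)
  have hs : ∀ w : Fin (k + 1) → ℝ, (∀ i, 0 < w i) → 0 < ∑ i, w i := fun w hw =>
    Finset.sum_pos (fun i _ => hw i) Finset.univ_nonempty
  have h2 := h1.image _ (stdSimplex.continuousOn_normalize.mono
    fun w hw => ⟨fun i => (hw i).le, hs w hw⟩)
  convert h2 using 1
  ext t
  constructor
  · exact fun ht => ⟨fun i => t i, ht, stdSimplex.normalize_coe t⟩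
  · rintro ⟨w, hw, rfl⟩ i
    rw [stdSimplex.normalize_apply (fun i => (hw i).le) (hs w hw)]
    exact div_pos (hw i) (hs w hw)

section Simplices

variable {Y : Type u} [TopologicalSpace Y] [T2Space Y] {k : ℕ}
  {Φ : stdSimplex ℝ (Fin (k + 1)) → Y}

theorem closure_image_pos (hΦ : Continuous Φ) : closure (Φ '' {t | ∀ i, 0 < t i}) = range Φ := by
  refine subset_antisymm ?_ ?_
  · exact closure_minimal (image_subset_range _ _) (isCompact_range hΦ).isClosed
  · rw [← image_univ, ← (stdSimplex.dense_pos k).closure_eq]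
    exact image_closure_subset_closure_image hΦ

/-- An injective simplex is a cell structure on its open simplex, with domain the closed ball. -/
theorem exists_isCellStructure_of_simplex (hΦ : Continuous Φ) (hinj : Function.Injective Φ) :
    ∃ D φ, IsCellStructure k (Φ '' {t | ∀ i, 0 < t i}) D φ ∧ IsHereditarilyQuotient φ := by
  obtain ⟨e, he⟩ := stdSimplex.exists_homeomorph_closedBall k
  have hemb : IsEmbedding Φ := (hΦ.isClosedEmbedding hinj).isEmbedding
  let φ : closedBall (0 : Eucl k) 1 ≃ₜ closure (Φ '' {t | ∀ i, 0 < t i}) :=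
    (e.trans hemb.toHomeomorph).trans (Homeomorph.setCongr (closure_image_pos hΦ).symm)
  refine ⟨closedBall 0 1, φ, ⟨ball_subset_closedBall, subset_rfl, φ.isQuotientMap,
    φ.isEmbedding.comp IsEmbedding.subtypeVal, ?_⟩, φ.continuous, φ.surjective, fun y U hU => ?_⟩
  · ext y
    constructor
    · rintro ⟨x, hx, rfl⟩
      exact ⟨e x, (he x).1 hx, rfl⟩
    · rintro ⟨t, ht, rfl⟩
      refine ⟨e.symm t, (he _).2 (by rwa [e.apply_symm_apply]), ?_⟩
      change Φ (e (e.symm t)) = Φ t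
      rw [e.apply_symm_apply]
  · obtain ⟨x, rfl⟩ := φ.surjective y
    have : φ ⁻¹' {φ x} = {x} := by
      ext z
      exact φ.injective.eq_iff
    rw [this, nhdsSet_singleton] at hU
    exact φ.isOpenMap.image_mem_nhds hU

/-- A family of injective simplices whose open simplices partition a space, such that the boundary
of each simplex is covered by open simplices of lower dimension, is a cellular stratification. -/
theorem exists_isCellular_of_simplices {ι : Type*} (k : ι → ℕ)
    (Φ : ∀ σ, stdSimplex ℝ (Fin (k σ + 1)) → Y) (hΦ : ∀ σ, Continuous (Φ σ))
    (hinj : ∀ σ, Function.Injective (Φ σ))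
    (hdisj : ∀ σ τ s t, (∀ i, 0 < s i) → (∀ i, 0 < t i) → Φ σ s = Φ τ t → σ = τ)
    (hcover : ∀ y, ∃ σ t, (∀ i, 0 < t i) ∧ Φ σ t = y)
    (hbd : ∀ σ t, (∃ i, t i = 0) → ∃ τ s, k τ < k σ ∧ (∀ i, 0 < s i) ∧ Φ τ s = Φ σ t) :
    ∃ d : Set Y → ℕ, (∀ σ, d (Φ σ '' {t | ∀ i, 0 < t i}) = k σ) ∧
      IsCellular (range fun σ => Φ σ '' {t | ∀ i, 0 < t i}) d := by
  classical
  have hne : ∀ σ, (Φ σ '' {t | ∀ i, 0 < t i}).Nonempty := fun σ =>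
    (stdSimplex.isConnected_pos _).nonempty.image _
  have hc : ∀ σ τ, (Φ σ '' {t | ∀ i, 0 < t i} ∩ Φ τ '' {t | ∀ i, 0 < t i}).Nonempty → σ = τ := by
    rintro σ τ ⟨_, ⟨s, hs, rfl⟩, ⟨t, ht, h⟩⟩
    exact hdisj σ τ s t hs ht h.symm
  -- The dimension is a function of the open simplex, since different indices give different ones.
  let d : Set Y → ℕ := fun e =>
    if h : ∃ σ, Φ σ '' {t | ∀ i, 0 < t i} = e then k h.choose else 0
  have hd : ∀ σ, d (Φ σ '' {t | ∀ i, 0 < t i}) = k σ := fun σ => by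
    have h : ∃ τ, Φ τ '' {t | ∀ i, 0 < t i} = Φ σ '' {t | ∀ i, 0 < t i} := ⟨σ, rfl⟩
    have h1 : h.choose = σ := hc _ _ (by rw [h.choose_spec, inter_self]; exact hne σ)
    simp only [d]
    rw [dif_pos h, h1]
  have hdiff : ∀ σ, closure (Φ σ '' {t | ∀ i, 0 < t i}) \ Φ σ '' {t | ∀ i, 0 < t i} ⊆
      Φ σ '' {t | ∃ i, t i = 0} := by
    rintro σ y ⟨hy, hy'⟩
    rw [closure_image_pos (hΦ σ)] at hy
    obtain ⟨t, rfl⟩ := hy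
    refine ⟨t, ?_, rfl⟩
    by_contra h
    refine hy' ⟨t, fun i => ?_, rfl⟩
    exact lt_of_le_of_ne (stdSimplex.zero_le t i) fun h0 => h ⟨i, h0.symm⟩
  refine ⟨d, hd, inferInstance, ⟨?_, ?_, ?_⟩, ?_⟩
  · rintro _ ⟨σ, rfl⟩
    refine ⟨(stdSimplex.isConnected_pos _).image _ (hΦ σ).continuousOn, ?_⟩
    have h1 : Φ σ '' {t | ∀ i, 0 < t i} = range (Φ σ) ∩ (Φ σ '' {t | ∃ i, t i = 0})ᶜ := by
      ext y
      constructor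
      · rintro ⟨t, ht, rfl⟩
        refine ⟨⟨t, rfl⟩, ?_⟩
        rintro ⟨s, ⟨i, hi⟩, hs⟩
        exact (ht i).ne' (hinj σ hs ▸ hi)
      · rintro ⟨h2, h3⟩
        by_contra h4
        rw [← closure_image_pos (hΦ σ)] at h2
        exact h3 (hdiff σ ⟨h2, h4⟩)
    have h2 : IsClosed {t : stdSimplex ℝ (Fin (k σ + 1)) | ∃ i, t i = 0} := by
      rw [ofPred_exists]
      exact isClosed_iUnion_of_finite fun i =>
        isClosed_eq (stdSimplex.continuous_apply i) continuous_const
    change IsLocallyClosed (Φ σ '' _)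
    rw [h1]
    exact (isCompact_range (hΦ σ)).isClosed.isLocallyClosed.inter
      ((h2.isCompact.image (hΦ σ)).isClosed.isOpen_compl.isLocallyClosed)
  · rintro _ ⟨σ, rfl⟩ _ ⟨τ, rfl⟩ hne'
    rw [Function.onFun, id, id, disjoint_iff_inter_eq_empty, ← not_nonempty_iff_eq_empty]
    intro h
    exact hne' (by rw [hc σ τ h])
  · refine eq_univ_of_forall fun y => ?_
    obtain ⟨σ, t, ht, rfl⟩ := hcover y
    exact ⟨_, ⟨σ, rfl⟩, t, ht, rfl⟩
  · rintro _ ⟨σ, rfl⟩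
    refine ⟨?_, fun y hy => ?_⟩
    · obtain ⟨D, φ, h, -⟩ := exists_isCellStructure_of_simplex (hΦ σ) (hinj σ)
      rw [hd]
      exact ⟨D, φ, h⟩
    · obtain ⟨t, ht, rfl⟩ := hdiff σ hy
      obtain ⟨τ, s, hk, hs, hst⟩ := hbd σ t ht
      refine ⟨_, ⟨⟨τ, rfl⟩, ?_⟩, s, hs, hst⟩
      rwa [hd, hd]

end Simplices

/-- For a normal stratification, monotonicity of the map of face posets is automatic. -/
theorem isCoarsening_of_normal {Y : Type u} [TopologicalSpace Y] {C S : Set (Set Y)}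
    (hne : ∀ c ∈ C, c.Nonempty) (h : ∀ c ∈ C, ∃ e ∈ S, c ⊆ e)
    (hS : ∀ e ∈ S, ∀ e' ∈ S, (e ∩ closure e').Nonempty → e ⊆ closure e') : IsCoarsening C S := by
  refine ⟨h, fun c hc c' hc' e he e' he' hce hce' hcc' => hS e he e' he' ?_⟩
  obtain ⟨x, hx⟩ := hne c hc
  exact ⟨x, hce hx, closure_mono hce' (hcc' hx)⟩

/-! ### The link of a vertex and stellar dimensions -/

namespace TopEnrichedCat

variable {L : Type u} {K : TopEnrichedCat L}

open RightModule

/-- The simplices of the link of `l`, that is, the chains over `l` that do not involve `l`. -/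
abbrev LinkSimplex (K : TopEnrichedCat L) (l : L) : Type u :=
  Σ n, {u : (K.repr l).Chain n // ∀ i, u.obj i ≠ l}

/-- The simplex of the boundary of the domain over `l` given by a simplex of the link. -/
noncomputable def LinkSimplex.toBdry {l : L} (σ : K.LinkSimplex l)
    (t : stdSimplex ℝ (Fin (σ.1 + 1))) : K.salvetti.bdry l :=
  ⟨mkPt σ.2.1 t, ⟨σ.1, σ.2.1, t, σ.2.2, rfl⟩⟩

theorem LinkSimplex.continuous_toBdry {l : L} (σ : K.LinkSimplex l) : Continuous σ.toBdry :=
  continuous_induced_rng.2 ((Realization.continuous_mk (r := (K.repr l).face) σ.1).comp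
    ((continuous_const (y := σ.2.1)).prodMk continuous_id))

theorem LinkSimplex.toBdry_injective {l : L} (σ : K.LinkSimplex l) :
    Function.Injective σ.toBdry := by
  intro s t h
  ext i
  have h1 := congrArg (fun x : K.salvetti.bdry l => (K.repr l).wt (σ.2.1.obj i) x.1) h
  exact (wt_obj σ.2.1 s i).symm.trans (h1.trans (wt_obj σ.2.1 t i))

theorem LinkSimplex.eq_of_toBdry_eq (hK : K.IsTame) {l : L} {σ τ : K.LinkSimplex l}
    {s : stdSimplex ℝ (Fin (σ.1 + 1))} {t : stdSimplex ℝ (Fin (τ.1 + 1))} (hs : ∀ i, 0 < s i)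
    (ht : ∀ i, 0 < t i) (h : σ.toBdry s = τ.toBdry t) : σ = τ := by
  have h0 : mkPt σ.2.1 s = mkPt τ.2.1 t := congrArg Subtype.val h
  have h1 := hK.eq_of_coord_eq hs ht (congrArg _ h0) (fun i => congrArg _ h0)
  obtain ⟨n, u, hu⟩ := σ
  obtain ⟨m, v, hv⟩ := τ
  obtain rfl : n = m := congrArg Sigma.fst h1
  obtain ⟨rfl, -⟩ := Prod.mk.inj (eq_of_heq (Sigma.mk.inj h1).2)
  rfl

theorem exists_toBdry_eq {l : L} (x : K.salvetti.bdry l) :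
    ∃ (σ : K.LinkSimplex l) (t : stdSimplex ℝ (Fin (σ.1 + 1))), (∀ i, 0 < t i) ∧
      σ.toBdry t = x := by
  obtain ⟨n, u, t, ht, hx⟩ := Realization.exists_pos x.1
  refine ⟨⟨n, u, fun i hi => ?_⟩, t, ht, Subtype.ext hx.symm⟩
  have h0 := mem_salvetti_bdry.1 x.2
  rw [hx] at h0
  exact (wt_pos_iff.2 ⟨i, hi, ht i⟩).ne' h0

theorem LinkSimplex.exists_face {l : L} (σ : K.LinkSimplex l) (t : stdSimplex ℝ (Fin (σ.1 + 1)))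
    (h : ∃ i, t i = 0) : ∃ (τ : K.LinkSimplex l) (s : stdSimplex ℝ (Fin (τ.1 + 1))),
      τ.1 < σ.1 ∧ (∀ i, 0 < s i) ∧ τ.toBdry s = σ.toBdry t := by
  obtain ⟨m, θ, s, hs, rfl⟩ : ∃ (m : ℕ) (θ : Fin (m + 1) ↪o Fin (σ.1 + 1))
      (s : stdSimplex ℝ (Fin (m + 1))), (∀ i, 0 < s i) ∧ stdSimplex.map θ s = t :=
    stdSimplex.exists_pos_map t
  obtain ⟨i, hi⟩ := h
  refine ⟨⟨m, (K.repr l).face θ σ.2.1, fun i => σ.2.2 _⟩, s, ?_, hs, Subtype.ext (pt_face _ _ _)⟩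
  have hlt : Fintype.card (Fin (m + 1)) < Fintype.card (Fin (σ.1 + 1)) := by
    refine Fintype.card_lt_of_injective_of_notMem θ θ.injective (b := i) ?_
    rintro ⟨j, rfl⟩
    rw [stdSimplex.map_apply_of_injective θ.injective] at hi
    exact (hs j).ne' hi
  simpa using hlt

/-- The rank function bounds the lengths of chains. -/
theorem IsTame.bddAbove_linkSimplex (hK : K.IsTame) (l : L) :
    BddAbove (range fun σ : K.LinkSimplex l => σ.1 + 1) := by
  obtain ⟨r, hr⟩ := hK.exists_rank
  refine ⟨r l, ?_⟩
  rintro _ ⟨⟨n, u, hu⟩, rfl⟩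
  have hm : StrictMono (r ∘ u.obj) := fun i j hij =>
    hr _ _ (fun h => hij.ne (u.2.1.1 h)) ⟨u.edge ⟨(i, j), hij⟩⟩
  have h1 : ∀ i : Fin (n + 1), i.val ≤ r (u.obj i) := fun i => by
    induction i using Fin.induction with
    | zero => exact Nat.zero_le _
    | succ i ih => exact Nat.succ_le_of_lt (ih.trans_lt (hm i.castSucc_lt_succ))
  exact Nat.succ_le_of_lt ((h1 (Fin.last n)).trans_lt (hr _ _ (hu _) ⟨u.elt _⟩))

/-- The stellar dimension of the domain over `l`: the supremum of the numbers of vertices of the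
simplices of the link.  It is `0` if the link is empty. -/
noncomputable def stellarDim (K : TopEnrichedCat L) (l : L) : ℕ :=
  sSup (range fun σ : K.LinkSimplex l => σ.1 + 1)

theorem IsTame.le_stellarDim (hK : K.IsTame) {l : L} (σ : K.LinkSimplex l) :
    σ.1 + 1 ≤ K.stellarDim l :=
  le_csSup (hK.bddAbove_linkSimplex l) ⟨σ, rfl⟩

theorem IsTame.exists_eq_stellarDim (hK : K.IsTame) (l : L) :
    K.stellarDim l = 0 ∨ ∃ σ : K.LinkSimplex l, σ.1 + 1 = K.stellarDim l := by
  rcases isEmpty_or_nonempty (K.LinkSimplex l) with h | h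
  · exact Or.inl (by rw [stellarDim, range_eq_empty, csSup_empty]; rfl)
  · exact Or.inr (Nat.sSup_mem (range_nonempty _) (hK.bddAbove_linkSimplex l))

/-- A chain over `m` not involving `m`, extended by `m` and composed with `f`, is a longer chain in
the link of `l`. -/
theorem IsTame.stellarDim_lt (hK : K.IsTame) {m l : L} (hml : m ≠ l) (f : K.Hom m l) :
    K.stellarDim m < K.stellarDim l := by
  rcases hK.exists_eq_stellarDim m with h | ⟨⟨n, u, hu⟩, h⟩
  · rw [h]
    exact hK.le_stellarDim ⟨0, (K.repr l).smulChain f (K.centerChain m), fun _ => hml⟩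
  · rw [← h]
    refine hK.le_stellarDim ⟨n + 1, (K.repr l).smulChain f (coneChain u hu), fun i hi => ?_⟩
    exact hml (hK.antisymm f (K.castHom hi rfl ((coneChain u hu).elt i)))

theorem IsTame.dimCondition (hK : K.IsTame) : K.salvetti.DimCondition K.stellarDim := by
  rintro l z ⟨hz, hz'⟩
  obtain ⟨w, rfl⟩ := K.classifyingHomeo.surjective z
  obtain ⟨m, g, x, hx, rfl⟩ := exists_smul_eq w
  have hm : K.classifyingHomeo (K.trivialModule.smul g x) ∈ K.salvetti.str m := by
    rw [hK.str_eq]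
    exact mem_image_of_mem _ ⟨g, mem_univ _, x, hx, rfl⟩
  have hml : m ≠ l := by
    rintro rfl
    exact hz' hm
  obtain ⟨f⟩ := hK.nonempty_hom_of_inter ⟨_, hm, hz⟩
  exact mem_biUnion (hK.stellarDim_lt hml f) hm

/-- The open simplices of the link of `l`. -/
def linkCells (K : TopEnrichedCat L) (l : L) : Set (Set (K.salvetti.bdry l)) :=
  range fun σ : K.LinkSimplex l => σ.toBdry '' {t | ∀ i, 0 < t i}

/-- Each open simplex of the link lies in a stratum of the boundary: the open simplex of a chain
with last object `m` lies in the product of a stratum of `Hom(m, l)` with an open cone. -/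
theorem IsTame.exists_bd_superset (hK : K.IsTame) {par : ∀ m l, Set (Set (K.Hom m l))}
    (hp : ∀ m l, ⋃₀ par m l = univ) {l : L} (σ : K.LinkSimplex l) :
    ∃ e ∈ (K.salvettiStrats par).bd l, σ.toBdry '' {t | ∀ i, 0 < t i} ⊆ e := by
  obtain ⟨n, u, hu⟩ := σ
  obtain ⟨P, hP, hg⟩ : u.elt (Fin.last n) ∈ ⋃₀ par (u.obj (Fin.last n)) l :=
    hp _ _ ▸ mem_univ _
  refine ⟨Subtype.val ⁻¹' (K.repr l).stratum (m := u.obj (Fin.last n)) P,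
    ⟨_, hu _, P, hP, hK.image_val_preimage_stratum (hu _) P⟩, ?_⟩
  rintro _ ⟨t, ht, rfl⟩
  exact ⟨_, hg, truncPt u (Fin.last n) t, wt_truncPt_pos u _ t (ht _),
    smul_truncPt u (Fin.last n) t fun i hi => absurd hi (not_lt.2 (Fin.le_last i))⟩

theorem linkCells_nonempty {l : L} {c : Set (K.salvetti.bdry l)} (hc : c ∈ K.linkCells l) :
    c.Nonempty := by
  obtain ⟨σ, rfl⟩ := hc
  exact (stdSimplex.isConnected_pos _).nonempty.image _

theorem IsTame.isCoarsening_linkCells (hK : K.IsTame) [∀ a b, LocallyCompactSpace (K.Hom a b)]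
    {par : ∀ m l, Set (Set (K.Hom m l))} (hp : K.IsParStratification par) (l : L) :
    IsCoarsening (K.linkCells l) ((K.salvettiStrats par).bd l) := by
  refine isCoarsening_of_normal (fun c hc => linkCells_nonempty hc) ?_
    (hK.isNormalStratification_bd hp l).2
  rintro _ ⟨σ, rfl⟩
  exact hK.exists_bd_superset (fun m l => (hp.isStratification m l).2.2) σ

theorem IsTame.exists_isCellular_linkCells (hK : K.IsTame) (l : L) :
    ∃ d, IsCellular (K.linkCells l) d ∧ HasDimPred (K.linkCells l) d (K.stellarDim l) := by
  have : T2Space (K.repr l).Real := hK.t2Space_real l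
  have : T2Space (K.salvetti.bdry l) :=
    inferInstanceAs (T2Space {x : (K.repr l).Real // x ∈ K.salvetti.bdry l})
  obtain ⟨d, hd, hc⟩ := exists_isCellular_of_simplices (fun σ : K.LinkSimplex l => σ.1)
    (fun σ => σ.toBdry) (fun σ => σ.continuous_toBdry) (fun σ => σ.toBdry_injective)
    (fun σ τ s t hs ht h => LinkSimplex.eq_of_toBdry_eq hK hs ht h) exists_toBdry_eq
    (fun σ t h => σ.exists_face t h)
  refine ⟨d, hc, ?_, (hK.exists_eq_stellarDim l).imp_right ?_⟩
  · rintro _ ⟨σ, rfl⟩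
    exact (hd σ).symm ▸ hK.le_stellarDim σ
  · rintro ⟨σ, h⟩
    exact ⟨_, ⟨σ, rfl⟩, by rw [hd]; exact h⟩

theorem IsTame.isAbstractAster (hK : K.IsTame) (l : L) :
    CylData.IsAbstractAster (K.salvetti.center l) (K.salvetti.bdry l) := by
  have hb : K.salvetti.bdry l = {x : (K.repr l).Real | (K.repr l).wt l x = 0} :=
    Set.ext fun x => mem_salvetti_bdry
  refine ⟨?_, hK.radial, hK.continuous_radial l, hK.radial_one, hK.radial_zero,
    hK.radial_mul, fun s x h => hK.radial_mem_boundary (mem_salvetti_bdry.1 h),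
    fun s t x hx y hy => hK.radial_injective (mem_salvetti_bdry.1 hx) (mem_salvetti_bdry.1 hy)⟩
  rw [hb]
  exact isClosed_eq (continuous_wt l) continuous_const

/-- The stratifications of the morphism spaces by points, for which compatibility with composition
and normality need no compactness. -/
theorem IsTame.isParStratification_singletons (hK : K.IsTame) :
    K.IsParStratification fun m l => range (singleton : K.Hom m l → Set (K.Hom m l)) := by
  have := hK.t2Space_hom
  refine ⟨fun m l => ⟨?_, ?_, ?_⟩, ?_, ?_⟩
  · rintro _ ⟨f, rfl⟩
    exact ⟨isConnected_singleton, isClosed_singleton.isLocallyClosed⟩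
  · rintro _ ⟨f, rfl⟩ _ ⟨g, rfl⟩ h
    exact Set.disjoint_singleton.2 fun h' => h (congrArg _ h')
  · exact eq_univ_of_forall fun f => ⟨{f}, ⟨f, rfl⟩, rfl⟩
  · rintro a b c _ ⟨g, rfl⟩ _ ⟨f, rfl⟩
    exact ⟨K.comp g f, by rw [image2_singleton]⟩
  · rintro m a l _ ⟨f, rfl⟩ P' - ⟨_, rfl, h⟩
    exact singleton_subset_iff.2 h

theorem IsTame.isCylNormalAbstractStellar (hK : K.IsTame)
    [∀ a b, LocallyCompactSpace (K.Hom a b)] : K.salvetti.IsCylNormalAbstractStellar := by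
  refine ⟨_, hK.isCylNormal_salvetti hK.isParStratification_singletons, K.stellarDim,
    hK.dimCondition, fun l => ⟨hK.isAbstractAster l, ?_⟩⟩
  obtain ⟨d, hc, hd⟩ := hK.exists_isCellular_linkCells l
  exact ⟨K.linkCells l, d, hc, hd, hK.isCoarsening_linkCells hK.isParStratification_singletons l⟩

end TopEnrichedCat

/-! ### Realization of the domains as asters -/

/-- A normal stratification of a closed subspace is extended to the ambient space by the points of
the complement. -/
theorem Topology.IsClosedEmbedding.isNormalStratification {A : Type u} {B : Type*}
    [TopologicalSpace A] [TopologicalSpace B] [T1Space B] {f : A → B} (hf : IsClosedEmbedding f)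
    {S : Set (Set A)} (hS : IsNormalStratification S) :
    IsNormalStratification ((fun e => f '' e) '' S ∪ singleton '' (range f)ᶜ) := by
  obtain ⟨⟨h1, h2, h3⟩, h4⟩ := hS
  refine ⟨⟨?_, ?_, ?_⟩, ?_⟩
  · rintro _ (⟨e, he, rfl⟩ | ⟨p, -, rfl⟩)
    · exact ⟨(h1 e he).1.image f hf.continuous.continuousOn,
        (h1 e he).2.image hf.isInducing hf.isClosed_range.isLocallyClosed⟩
    · exact ⟨isConnected_singleton, isClosed_singleton.isLocallyClosed⟩
  · rintro _ (⟨e, he, rfl⟩ | ⟨p, hp, rfl⟩) _ (⟨e', he', rfl⟩ | ⟨q, hq, rfl⟩) hne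
    · exact (disjoint_image_iff hf.injective).2 (h2 he he' fun h => hne (by rw [h]))
    · exact Set.disjoint_singleton_right.2 fun h => hq (image_subset_range _ _ h)
    · exact Set.disjoint_singleton_left.2 fun h => hp (image_subset_range _ _ h)
    · exact Set.disjoint_singleton.2 fun h => hne (congrArg _ h)
  · refine eq_univ_of_forall fun y => ?_
    by_cases hy : y ∈ range f
    · obtain ⟨x, rfl⟩ := hy
      obtain ⟨e, he, hx⟩ : x ∈ ⋃₀ S := h3 ▸ mem_univ x
      exact ⟨_, Or.inl ⟨e, he, rfl⟩, mem_image_of_mem f hx⟩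
    · exact ⟨_, Or.inr ⟨y, hy, rfl⟩, rfl⟩
  · rintro _ (⟨e, he, rfl⟩ | ⟨p, hp, rfl⟩) _ (⟨e', he', rfl⟩ | ⟨q, hq, rfl⟩)
    · rintro ⟨_, ⟨x, hx, rfl⟩, hx'⟩
      simp only [hf.closure_image_eq] at hx' ⊢
      rw [hf.injective.mem_set_image] at hx'
      exact image_mono (h4 e he e' he' ⟨x, hx, hx'⟩)
    · rintro ⟨_, ⟨x, hx, rfl⟩, hx'⟩
      rw [closure_singleton] at hx'
      exact absurd ⟨x, hx'⟩ hq
    · rintro ⟨_, rfl, hx'⟩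
      simp only [hf.closure_image_eq] at hx'
      exact absurd (image_subset_range _ _ hx') hp
    · rintro ⟨_, rfl, hx'⟩
      exact singleton_subset_iff.2 hx'

namespace TopEnrichedCat

variable {L : Type u} {K : TopEnrichedCat L}

open RightModule

theorem RightModule.isClosed_isChain {M : K.RightModule} [∀ a b, T2Space (K.Hom a b)]
    [∀ a, T2Space (M.G a)] {n : ℕ} (o : Fin (n + 1) → L) : IsClosed {p | M.IsChain o p} := by
  by_cases ho : Function.Injective o
  · have : {p | M.IsChain o p} =
        (⋂ (i) (j) (l) (h : i < j) (h' : j < l),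
          {p | p.1 ⟨(i, l), h.trans h'⟩ = K.comp (p.1 ⟨(j, l), h'⟩) (p.1 ⟨(i, j), h⟩)}) ∩
        ⋂ ij : EdgeIdx n, {p | p.2 ij.1.1 = M.act (p.2 ij.1.2) (p.1 ij)} := by
      ext p
      simp only [mem_inter_iff, mem_iInter]
      exact ⟨fun h => ⟨h.1.2, h.2⟩, fun h => ⟨⟨ho, h.1⟩, h.2⟩⟩
    have hfst : ∀ ij : EdgeIdx n, Continuous fun p : (∀ ij : EdgeIdx n,
        K.Hom (o ij.1.1) (o ij.1.2)) × (∀ i, M.G (o i)) => p.1 ij := fun ij =>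
      (continuous_apply ij).comp continuous_fst
    have hsnd : ∀ i, Continuous fun p : (∀ ij : EdgeIdx n,
        K.Hom (o ij.1.1) (o ij.1.2)) × (∀ i, M.G (o i)) => p.2 i := fun i =>
      (continuous_apply i).comp continuous_snd
    rw [this]
    refine IsClosed.inter ?_ ?_
    · refine isClosed_iInter fun i => isClosed_iInter fun j => isClosed_iInter fun l =>
        isClosed_iInter fun h => isClosed_iInter fun h' => isClosed_eq
          (hfst ⟨(i, l), h.trans h'⟩) ?_
      exact (K.continuous_comp _ _ _).comp ((hfst ⟨(j, l), h'⟩).prodMk (hfst ⟨(i, j), h⟩))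
    · refine isClosed_iInter fun ij => isClosed_eq (hsnd ij.1.1) ?_
      exact (M.continuous_act (o ij.1.1) (o ij.1.2)).comp ((hsnd ij.1.2).prodMk (hfst ij))
  · convert isClosed_empty
    exact eq_empty_of_forall_notMem fun p hp => ho hp.1.1

/-- Only finitely many simplices, all with compact spaces of chains, contribute to the lower star
of an object `l` that receives morphisms from finitely many objects only. -/
theorem IsTame.compactSpace_real (hK : K.IsTame) [∀ a b, CompactSpace (K.Hom a b)] {l : L}
    (hl : {a | Nonempty (K.Hom a l)}.Finite) : CompactSpace (K.repr l).Real := by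
  have := hK.t2Space_hom
  have hT : ∀ a, T2Space ((K.repr l).G a) := fun a => hK.t2Space_hom a l
  have : Finite {a | Nonempty (K.Hom a l)} := hl
  let N := Nat.card {a | Nonempty (K.Hom a l)}
  have huniv : (univ : Set (K.repr l).Real) = ⋃ n : Fin N,
      ⋃ o : Fin (n.1 + 1) → {a | Nonempty (K.Hom a l)},
        range fun q : {p // (K.repr l).IsChain (fun i => (o i).1) p} ×
          stdSimplex ℝ (Fin (n.1 + 1)) => mkPt (ofFiber (fun i => (o i).1) q.1) q.2 := by
    refine (eq_univ_of_forall fun x => ?_).symm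
    obtain ⟨n, u, t, -, rfl⟩ := Realization.exists_pos x
    let o : Fin (n + 1) → {a | Nonempty (K.Hom a l)} := fun i => ⟨u.obj i, ⟨u.elt i⟩⟩
    have ho : Function.Injective o := fun i j h => u.2.1.1 (congrArg Subtype.val h)
    have hn : n < N := by
      have := Nat.card_le_card_of_injective o ho
      rw [Nat.card_fin] at this
      exact this
    exact mem_iUnion.2 ⟨⟨n, hn⟩, mem_iUnion.2 ⟨o, (⟨u.1.2, u.2⟩, t), rfl⟩⟩
  refine ⟨?_⟩
  rw [huniv]
  refine isCompact_iUnion fun n => isCompact_iUnion fun o => ?_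
  have hc : CompactSpace ((∀ ij : EdgeIdx n.1, K.Hom (o ij.1.1).1 (o ij.1.2).1) ×
      ∀ i, (K.repr l).G (o i).1) := by
    have : ∀ a, CompactSpace ((K.repr l).G a) := fun a =>
      inferInstanceAs (CompactSpace (K.Hom a l))
    infer_instance
  have : CompactSpace {p // (K.repr l).IsChain (fun i => (o i).1) p} :=
    isCompact_iff_compactSpace.1 (isClosed_isChain (M := K.repr l) fun i => (o i).1).isCompact
  exact isCompact_range ((Realization.continuous_mk (r := (K.repr l).face) n.1).comp
    (((isOpenEmbedding_ofFiber (M := K.repr l) fun i => (o i).1).continuous.comp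
      continuous_fst).prodMk continuous_snd))

theorem IsTame.eq_starCenter (hK : K.IsTame) {l : L} {x : (K.repr l).Real}
    (h : ∀ a : K.Below l, (K.repr l).wt a x = 0) : x = K.starCenter l := by
  obtain ⟨n, u, t, ht, rfl⟩ := Realization.exists_pos x
  have hu : ∀ i, u.obj i = l := fun i => by
    by_contra hi
    exact (wt_pos_iff.2 ⟨i, rfl, ht i⟩).ne' (h ⟨u.obj i, hi, ⟨u.elt i⟩⟩)
  obtain rfl : n = 0 := by
    have := u.2.1.1 ((hu 0).trans (hu (Fin.last n)).symm)
    simpa using congrArg Fin.val this.symm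
  refine Eq.trans ?_ (hK.radial_zero (mkPt u t))
  rw [hK.radial_mkPt (hu _)]
  have : ∀ s s' : stdSimplex ℝ (Fin 1), s = s' := fun s s' => by
    have h1 := stdSimplex.sum_eq_one s
    have h2 := stdSimplex.sum_eq_one s'
    rw [Fin.sum_univ_one] at h1 h2
    ext i
    rw [Subsingleton.elim i 0]
    exact h1.trans h2.symm
  exact congrArg (mkPt u) (this t (stdSimplex.segment 0 t))

/-- The barycentric coordinates of a point sum to one. -/
theorem wt_add_sum_wt {l : L} [Fintype (K.Below l)] (x : (K.repr l).Real) :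
    (K.repr l).wt l x + ∑ a : K.Below l, (K.repr l).wt a x = 1 := by
  classical
  obtain ⟨n, u, t, -, rfl⟩ := Realization.exists_pos x
  -- The objects that map to `l` are indexed by `Option (K.Below l)`, where `none` stands for `l`.
  let f : Option (K.Below l) → ℝ := fun a =>
    (K.repr l).wt (a.elim l Subtype.val) (mkPt u t)
  let o : Fin (n + 1) → Option (K.Below l) := fun i =>
    if h : u.obj i = l then none else some ⟨u.obj i, h, ⟨u.elt i⟩⟩
  have ho : ∀ i, (o i).elim l Subtype.val = u.obj i := fun i => by
    simp only [o]
    split_ifs with h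
    · exact h.symm
    · rfl
  have hinj : Function.Injective o := fun i j h => u.2.1.1
    ((ho i).symm.trans ((congrArg (fun a => a.elim l Subtype.val) h).trans (ho j)))
  have hsum : ∑ i, t i = ∑ a, f a := by
    refine Fintype.sum_of_injective o hinj _ _ (fun a ha => ?_) fun i => ?_
    · refine wt_eq_zero (M := K.repr l) u t fun i hi => ha ⟨i, ?_⟩
      have h1 : (o i).elim l Subtype.val = a.elim l Subtype.val := (ho i).trans hi
      rcases h2 : o i with _ | b <;> rcases a with _ | a
      · rfl
      · rw [h2] at h1
        exact absurd h1.symm a.2.1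
      · rw [h2] at h1
        exact absurd h1 b.2.1
      · rw [h2] at h1
        exact congrArg some (Subtype.ext h1)
    · change t i = (K.repr l).wt ((o i).elim l Subtype.val) (mkPt u t)
      rw [ho, wt_obj]
  rw [stdSimplex.sum_eq_one, Fintype.sum_option] at hsum
  exact hsum.symm

section Aster

variable (hK : K.IsTame) (l : L)

theorem IsTame.finite_below (hl : {a | Nonempty (K.Hom a l)}.Finite) : Finite (K.Below l) :=
  hl.subset fun _ h => h.2

theorem IsTame.finite_coordIdx (hl : {a | Nonempty (K.Hom a l)}.Finite) :
    Finite (hK.CoordIdx l) := by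
  have := IsTame.finite_below l hl
  infer_instance

variable [Finite (hK.CoordIdx l)]

/-- The vector of all homogeneous coordinates. -/
noncomputable def IsTame.coordVec (x : (K.repr l).Real) : Eucl (Nat.card (hK.CoordIdx l)) :=
  WithLp.toLp 2 fun j => hK.coord l ((Finite.equivFin (hK.CoordIdx l)).symm j) x

theorem IsTame.continuous_coordVec : Continuous (hK.coordVec l) :=
  (PiLp.continuous_toLp 2 _).comp (continuous_pi fun _ => hK.continuous_coord l _)

variable {l}

theorem IsTame.coordVec_eq_smul_iff {x y : (K.repr l).Real} {s : ℝ} :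
    hK.coordVec l x = s • hK.coordVec l y ↔ ∀ i, hK.coord l i x = s * hK.coord l i y := by
  constructor
  · intro h i
    have := congrArg (fun v : Eucl _ => v (Finite.equivFin (hK.CoordIdx l) i)) h
    simpa [coordVec] using this
  · intro h
    ext j
    exact h _

theorem IsTame.coordVec_radial (s : unitInterval) (x : (K.repr l).Real) :
    hK.coordVec l (hK.radial s x) = (s : ℝ) • hK.coordVec l x :=
  hK.coordVec_eq_smul_iff.2 (hK.coord_radial s x)

theorem IsTame.coordVec_starCenter : hK.coordVec l (K.starCenter l) = 0 := by
  rw [← hK.radial_zero (K.starCenter l), hK.coordVec_radial]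
  exact zero_smul _ _

theorem IsTame.coordVec_eq_zero_iff {x : (K.repr l).Real} :
    hK.coordVec l x = 0 ↔ x = K.starCenter l := by
  refine ⟨fun h => hK.eq_starCenter fun a => ?_, fun h => h ▸ hK.coordVec_starCenter⟩
  have h' : hK.coordVec l x = (0 : ℝ) • hK.coordVec l x := by rw [h, smul_zero]
  have := hK.coordVec_eq_smul_iff.1 h' (.inl a)
  rwa [zero_mul] at this

/-- The points are determined by the direction of the coordinate vector and the weight of `l`. -/
theorem IsTame.eq_of_coordVec_eq_smul {x y : (K.repr l).Real} {s : ℝ}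
    (hw : (K.repr l).wt l x = (K.repr l).wt l y)
    (h : hK.coordVec l x = s • hK.coordVec l y) (hy : hK.coordVec l y ≠ 0) : x = y := by
  have : Finite (K.Below l) := Finite.of_injective (β := hK.CoordIdx l) _ Sum.inl_injective
  have : Fintype (K.Below l) := Fintype.ofFinite _
  have hc := hK.coordVec_eq_smul_iff.1 h
  have h1 := wt_add_sum_wt x
  have h2 := wt_add_sum_wt y
  have h3 : ∑ a : K.Below l, (K.repr l).wt a x = s * ∑ a : K.Below l, (K.repr l).wt a y := by
    rw [Finset.mul_sum]
    exact Finset.sum_congr rfl fun a _ => hc (.inl a)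
  have h4 : ∑ a : K.Below l, (K.repr l).wt a y ≠ 0 := fun h0 => hy <| by
    rw [Finset.sum_eq_zero_iff_of_nonneg fun a _ => wt_nonneg _ _] at h0
    exact hK.coordVec_eq_zero_iff.2 (hK.eq_starCenter fun a => h0 a (Finset.mem_univ a))
  -- The barycentric coordinates are among the homogeneous ones, and their sums agree.
  obtain rfl : s = 1 := mul_right_cancel₀ h4 (by linarith)
  exact hK.ext_of_coord hw fun i => by rw [hc, one_mul]

variable (l) in
/-- The embedding of the realization of the lower star of `l` in a disk: the distance from the
center is one minus the weight of `l`, and the direction is that of the vector of homogeneous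
coordinates.  At the center this vector vanishes, and division by zero gives the value `0`. -/
noncomputable def IsTame.asterEmb (x : (K.repr l).Real) : Eucl (Nat.card (hK.CoordIdx l)) :=
  ((1 - (K.repr l).wt l x) / ‖hK.coordVec l x‖) • hK.coordVec l x

theorem wt_le_one (x : (K.repr l).Real) : (K.repr l).wt l x ≤ 1 := by
  obtain ⟨n, u, t, -, rfl⟩ := Realization.exists_pos x
  by_cases h : ∃ i, u.obj i = l
  · obtain ⟨i, hi⟩ := h
    have := wt_obj u t i
    rw [hi] at this
    exact this.trans_le (stdSimplex.le_one t i)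
  · push Not at h
    exact (wt_eq_zero (M := K.repr l) u t h).trans_le zero_le_one

theorem IsTame.norm_asterEmb (x : (K.repr l).Real) :
    ‖hK.asterEmb l x‖ = 1 - (K.repr l).wt l x := by
  rw [asterEmb, norm_smul, norm_div, norm_norm, Real.norm_of_nonneg (sub_nonneg.2 (wt_le_one x))]
  by_cases h : hK.coordVec l x = 0
  · rw [hK.coordVec_eq_zero_iff.1 h, wt_starCenter, sub_self, zero_div, zero_mul]
  · exact div_mul_cancel₀ _ (norm_ne_zero_iff.2 h)

theorem IsTame.asterEmb_radial (s : unitInterval) (x : (K.repr l).Real) :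
    hK.asterEmb l (hK.radial s x) = (s : ℝ) • hK.asterEmb l x := by
  rw [asterEmb, asterEmb, hK.coordVec_radial, hK.wt_radial, norm_smul,
    Real.norm_of_nonneg s.2.1, smul_smul, smul_smul]
  congr 1
  rcases s.2.1.eq_or_lt with h | h
  · rw [← h]; simp
  · have : 1 - ((s : ℝ) * (K.repr l).wt l x + (1 - s)) = s * (1 - (K.repr l).wt l x) := by ring
    rw [this, mul_div_mul_left _ _ h.ne', mul_comm]

theorem IsTame.asterEmb_starCenter : hK.asterEmb l (K.starCenter l) = 0 := by
  rw [asterEmb, hK.coordVec_starCenter, smul_zero]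

theorem IsTame.asterEmb_injective : Function.Injective (hK.asterEmb l) := by
  intro x y h
  have hw : (K.repr l).wt l x = (K.repr l).wt l y := by
    have := congrArg norm h
    rw [hK.norm_asterEmb, hK.norm_asterEmb] at this
    linarith
  have key : ∀ z : (K.repr l).Real, hK.coordVec l z = 0 ↔ (K.repr l).wt l z = 1 := fun z => by
    constructor
    · intro hz
      rw [hK.coordVec_eq_zero_iff.1 hz, wt_starCenter]
    · intro hz
      have : Finite (K.Below l) := Finite.of_injective (β := hK.CoordIdx l) _ Sum.inl_injective
      have : Fintype (K.Below l) := Fintype.ofFinite _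
      have h1 := wt_add_sum_wt z
      rw [hz, add_eq_left, Finset.sum_eq_zero_iff_of_nonneg fun a _ => wt_nonneg _ _] at h1
      exact hK.coordVec_eq_zero_iff.2 (hK.eq_starCenter fun a => h1 a (Finset.mem_univ a))
  by_cases hy : hK.coordVec l y = 0
  · have hx := (key x).2 (hw.trans ((key y).1 hy))
    exact (hK.coordVec_eq_zero_iff.1 hx).trans (hK.coordVec_eq_zero_iff.1 hy).symm
  · have hx : hK.coordVec l x ≠ 0 := fun hx => hy ((key y).2 (hw.symm.trans ((key x).1 hx)))
    have h1 : 1 - (K.repr l).wt l x ≠ 0 := fun h0 => hx ((key x).2 (by linarith))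
    have h2 := norm_ne_zero_iff.2 hx
    refine hK.eq_of_coordVec_eq_smul hw (s := ‖hK.coordVec l x‖ / ‖hK.coordVec l y‖) ?_ hy
    rw [asterEmb, asterEmb, ← hw] at h
    have h3 := congrArg (fun v => (‖hK.coordVec l x‖ / (1 - (K.repr l).wt l x)) • v) h
    simp only [smul_smul] at h3
    rw [div_mul_div_cancel₀ h1, div_self h2, _root_.one_smul, div_mul_div_cancel₀ h1] at h3
    exact h3

variable (l) in
theorem IsTame.continuous_asterEmb : Continuous (hK.asterEmb l) := by
  refine continuous_iff_continuousAt.2 fun x => ?_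
  by_cases hx : hK.coordVec l x = 0
  · -- At the center, the norm tends to zero.
    have h0 : hK.asterEmb l x = 0 := by rw [asterEmb, hx, smul_zero]
    have h1 : Filter.Tendsto (fun y => ‖hK.asterEmb l y‖) (𝓝 x) (𝓝 ‖hK.asterEmb l x‖) := by
      simp only [hK.norm_asterEmb]
      exact (continuous_const.sub (continuous_wt l)).continuousAt
    rw [ContinuousAt, h0, tendsto_zero_iff_norm_tendsto_zero]
    rwa [h0, norm_zero] at h1
  · have hc := (hK.continuous_coordVec l).continuousAt (x := x)
    exact ((continuousAt_const.sub (continuous_wt l).continuousAt).div hc.norm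
      (norm_ne_zero_iff.2 hx)).smul hc

end Aster

/-- The domains of the Salvetti complex as asters in disks.  Compactness of the domains makes the
continuous injections `IsTame.asterEmb` embeddings. -/
noncomputable def IsTame.asters (hK : K.IsTame) [∀ a b, CompactSpace (K.Hom a b)]
    (hl : ∀ l, {a | Nonempty (K.Hom a l)}.Finite) : K.salvetti.Asters where
  N l := Nat.card (hK.CoordIdx l)
  ι l := have := hK.finite_coordIdx l (hl l); hK.asterEmb l
  isEmbedding l := by
    have := hK.finite_coordIdx l (hl l)
    have := hK.compactSpace_real (hl l)
    exact ((hK.continuous_asterEmb l).isClosedEmbedding hK.asterEmb_injective).isEmbedding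
  center l := by
    have := hK.finite_coordIdx l (hl l)
    exact hK.asterEmb_starCenter
  norm_le l x := by
    have := hK.finite_coordIdx l (hl l)
    have h1 := hK.norm_asterEmb x
    have h2 := wt_nonneg (M := K.repr l) l x
    exact h1.trans_le (by linarith)
  star l x s h0 h1 := by
    have := hK.finite_coordIdx l (hl l)
    exact ⟨hK.radial ⟨s, h0, h1⟩ x, hK.asterEmb_radial _ _⟩
  mem_bdry l x := by
    have := hK.finite_coordIdx l (hl l)
    refine mem_salvetti_bdry.trans ?_
    have h1 := hK.norm_asterEmb x
    constructor
    · intro h; exact h1.trans (by rw [h, sub_zero])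
    · intro h
      have := h1.symm.trans h
      linarith

theorem IsTame.isClosedEmbedding_toSphere (hK : K.IsTame) [∀ a b, CompactSpace (K.Hom a b)]
    (hl : ∀ l, {a | Nonempty (K.Hom a l)}.Finite) (l : L) :
    IsClosedEmbedding ((hK.asters hl).toSphere l) := by
  have : CompactSpace (K.salvetti.D l) := hK.compactSpace_real (hl l)
  have hb : IsClosed (K.salvetti.bdry l) := (hK.isAbstractAster l).1
  have : CompactSpace (K.salvetti.bdry l) := isCompact_iff_compactSpace.1 hb.isCompact
  refine Continuous.isClosedEmbedding (continuous_induced_rng.2 ?_) fun x y h => ?_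
  · exact ((hK.asters hl).isEmbedding l).continuous.comp continuous_subtype_val
  · exact Subtype.ext (((hK.asters hl).isEmbedding l).injective (congrArg Subtype.val h))

/-- The open simplices of the link, together with the points outside the image of the link as cells
of dimension zero, form a cellular stratification of the sphere. -/
theorem IsTame.isStellarCell (hK : K.IsTame) [∀ a b, CompactSpace (K.Hom a b)]
    (hl : ∀ l, {a | Nonempty (K.Hom a l)}.Finite) {par : ∀ m l, Set (Set (K.Hom m l))}
    (hp : K.IsParStratification par) (l : L) :
    K.salvetti.IsStellarCell (hK.asters hl) (K.salvettiStrats par) l (K.stellarDim l) := by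
  have := hK.t2Space_hom
  let f := (hK.asters hl).toSphere l
  have hf : IsClosedEmbedding f := hK.isClosedEmbedding_toSphere hl l
  have hS := hf.isNormalStratification (hK.isNormalStratification_bd hp l)
  refine ⟨⟨_, hS, fun e he => Or.inl ⟨e, he, rfl⟩⟩, ?_⟩
  let ι := K.LinkSimplex l ⊕ {p // p ∉ range f}
  let k : ι → ℕ := fun σ => match σ with
    | .inl σ => σ.1
    | .inr _ => 0
  let Φ : ∀ σ : ι, stdSimplex ℝ (Fin (k σ + 1)) → sphere (0 : Eucl ((hK.asters hl).N l)) 1 :=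
    fun σ => match σ with
    | .inl σ => fun t => f (σ.toBdry t)
    | .inr p => fun _ => p.1
  have hΦ : ∀ σ, Continuous (Φ σ) := by
    rintro (σ | p)
    · exact hf.continuous.comp σ.continuous_toBdry
    · exact continuous_const
  have hone : ∀ t : stdSimplex ℝ (Fin 1), t 0 = 1 := fun t => by
    have := stdSimplex.sum_eq_one t
    rwa [Fin.sum_univ_one] at this
  have hinj : ∀ σ, Function.Injective (Φ σ) := by
    rintro (σ | p)
    · exact hf.injective.comp σ.toBdry_injective
    · intro s t _
      ext i
      rw [Subsingleton.elim (α := Fin 1) i 0]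
      exact (hone s).trans (hone t).symm
  obtain ⟨d, hd, hc⟩ := exists_isCellular_of_simplices k Φ hΦ hinj
    (by
      rintro (σ | p) (τ | q) s t hs ht h
      · exact congrArg _ (LinkSimplex.eq_of_toBdry_eq hK hs ht (hf.injective h))
      · exact absurd ⟨_, h⟩ q.2
      · exact absurd ⟨_, h.symm⟩ p.2
      · exact congrArg _ (Subtype.ext h))
    (by
      intro y
      by_cases hy : y ∈ range f
      · obtain ⟨x, rfl⟩ := hy
        obtain ⟨σ, t, ht, rfl⟩ := exists_toBdry_eq x
        exact ⟨.inl σ, t, ht, rfl⟩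
      · refine ⟨.inr ⟨y, hy⟩, (stdSimplex.vertex 0 : stdSimplex ℝ (Fin 1)), fun i => ?_, rfl⟩
        rw [Subsingleton.elim (α := Fin 1) i 0]
        exact (hone _).symm ▸ one_pos)
    (by
      rintro (σ | p) t ht
      · obtain ⟨τ, s, h1, h2, h3⟩ := σ.exists_face t ht
        exact ⟨.inl τ, s, h1, h2, congrArg f h3⟩
      · obtain ⟨i, hi⟩ := ht
        rw [Subsingleton.elim (α := Fin 1) i 0] at hi
        exact absurd ((hone t).symm.trans hi) one_ne_zero)
  have hcells : {e ∈ range fun σ => Φ σ '' {t | ∀ i, 0 < t i} | e ⊆ range f} =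
      range fun σ : K.LinkSimplex l => Φ (.inl σ) '' {t | ∀ i, 0 < t i} := by
    ext e
    constructor
    · rintro ⟨⟨σ | p, rfl⟩, he⟩
      · exact ⟨σ, rfl⟩
      · obtain ⟨t, ht⟩ := (stdSimplex.isConnected_pos 0).nonempty
        exact absurd (he ⟨t, ht, rfl⟩) p.2
    · rintro ⟨σ, rfl⟩
      refine ⟨⟨.inl σ, rfl⟩, ?_⟩
      rintro _ ⟨t, -, rfl⟩
      exact ⟨_, rfl⟩
  refine ⟨_, d, hc, ?_, ?_, ?_, ?_⟩
  · rw [hcells]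
    refine subset_antisymm (sUnion_subset ?_) ?_
    · rintro _ ⟨σ, rfl⟩ _ ⟨t, -, rfl⟩
      exact ⟨_, rfl⟩
    · rintro _ ⟨x, rfl⟩
      obtain ⟨σ, t, ht, rfl⟩ := exists_toBdry_eq x
      exact ⟨_, ⟨σ, rfl⟩, t, ht, rfl⟩
  · rintro _ ⟨σ, rfl⟩ -
    change ∃ D φ, IsCellStructure (d (Φ σ '' {t | ∀ i, 0 < t i})) _ D φ ∧ _
    rw [hd]
    exact exists_isCellStructure_of_simplex (hΦ σ) (hinj σ)
  · rw [hcells]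
    refine ⟨?_, (hK.exists_eq_stellarDim l).imp_right ?_⟩
    · rintro _ ⟨σ, rfl⟩
      exact (hd (.inl σ)).symm ▸ hK.le_stellarDim σ
    · rintro ⟨σ, h⟩
      exact ⟨_, ⟨σ, rfl⟩, (congrArg (· + 1) (hd (.inl σ))).trans h⟩
  · rw [hcells]
    refine isCoarsening_of_normal ?_ ?_ ?_
    · rintro _ ⟨σ, rfl⟩
      exact (stdSimplex.isConnected_pos _).nonempty.image _
    · rintro _ ⟨σ, rfl⟩
      obtain ⟨e, he, hσ⟩ := hK.exists_bd_superset (fun m l => (hp.isStratification m l).2.2) σ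
      refine ⟨_, ⟨e, he, rfl⟩, ?_⟩
      rintro _ ⟨t, ht, rfl⟩
      exact ⟨_, hσ ⟨t, ht, rfl⟩, rfl⟩
    · exact fun e he e' he' => hS.2 e (Or.inl he) e' (Or.inl he')

theorem IsTame.isCylNormalStellar (hK : K.IsTame) [∀ a b, CompactSpace (K.Hom a b)]
    (hl : ∀ l, {a | Nonempty (K.Hom a l)}.Finite) {par : ∀ m l, Set (Set (K.Hom m l))}
    (hp : K.IsParStratification par) : K.salvetti.IsCylNormalStellar (hK.asters hl) := by
  have := hK.t2Space_hom
  exact ⟨_, hK.isCylNormal_salvetti hp, K.stellarDim, hK.dimCondition, hK.isStellarCell hl hp⟩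

end TopEnrichedCat

/-! ### Parameter spaces of cylindrically normal stellar stratified spaces -/

/-- For compact morphism spaces, the closed stable family generated by `P'` consists of the
composites of morphisms in `closure P'` with arbitrary morphisms, hence is a union of strata. -/
theorem TopEnrichedCat.isParStratification_of_compact {L : Type u} {K : TopEnrichedCat L}
    [∀ a b, T2Space (K.Hom a b)] [∀ a b, CompactSpace (K.Hom a b)]
    {par : ∀ m l, Set (Set (K.Hom m l))} (h1 : ∀ m l, IsNormalStratification (par m l))
    (h2 : ∀ a b c, ∀ q ∈ par b c, ∀ p ∈ par a b,
      image2 (fun g f => K.comp g f) q p ∈ par a c) : K.IsParStratification par := by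
  refine ⟨fun m l => (h1 m l).1, h2, fun m a l P hP P' hP' => ?_⟩
  rintro ⟨p, hp, hp'⟩
  have hcl : (K.repr l).gen P' m ⊆
      image2 (fun g f => K.comp g f) (closure P') (univ : Set (K.Hom m a)) := by
    refine closure_minimal (image2_subset_right subset_closure) (IsCompact.isClosed ?_)
    have h := (isClosed_closure (s := P')).isCompact.prod (isCompact_univ (X := K.Hom m a))
    have h' := h.image (K.continuous_comp m a l)
    rwa [image_prod] at h'
  obtain ⟨g, hg, f, -, rfl⟩ := hcl hp'
  obtain ⟨Q, hQ, hgQ⟩ : g ∈ ⋃₀ par a l := (h1 a l).1.2.2 ▸ mem_univ g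
  obtain ⟨R, hR, hfR⟩ : f ∈ ⋃₀ par m a := (h1 m a).1.2.2 ▸ mem_univ f
  have hQ' : Q ⊆ closure P' := (h1 a l).2 Q hQ P' hP' ⟨g, hgQ, hg⟩
  have hPQ : P = image2 (fun g f => K.comp g f) Q R := by
    by_contra hne
    exact Set.disjoint_left.1 ((h1 m l).1.2.1 hP (h2 m a l Q hQ R hR) hne) hp
      ⟨g, hgQ, f, hfR, rfl⟩
  rw [hPQ]
  rintro _ ⟨g', hg', f', -, rfl⟩
  exact map_mem_closure (f := fun g : K.Hom a l => K.comp g f')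
    ((K.continuous_comp m a l).comp (continuous_id.prodMk continuous_const)) (hQ' hg')
    fun x hx => ⟨x, hx, f', mem_univ _, rfl⟩

namespace CylData

variable {X : Type u} [TopologicalSpace X] {C : CylData X} {T : C.Strats}

theorem Asters.center_notMem_bdry (E : C.Asters) (l : C.L) : C.center l ∉ C.bdry l := by
  rw [E.mem_bdry, E.center, norm_zero]
  exact zero_ne_one

namespace IsCylNormal

/-- Every point of a domain is the image of an interior point of some domain. -/
theorem exists_eq_act (hT : C.IsCylNormal T) (l : C.L) (x : C.D l) :
    ∃ (m : C.L) (p : C.K.Hom m l), ∃ y ∉ C.bdry m, C.act p y = x := by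
  by_cases hx : x ∈ C.bdry l
  · rw [hT.bdry_eq] at hx
    simp only [mem_iUnion] at hx
    obtain ⟨m, -, p, -, y, hy, rfl⟩ := hx
    exact ⟨m, p, y, hy, rfl⟩
  · exact ⟨l, C.K.one l, x, hx, hT.act_one l x⟩

theorem φ_mem_str (hT : C.IsCylNormal T) {l : C.L} {x : C.D l} (hx : x ∉ C.bdry l) :
    C.φ l x ∈ C.str l := hT.image_interior l ▸ mem_image_of_mem _ hx

theorem eq_of_mem_str (hT : C.IsCylNormal T) {m l : C.L} {y : X} (hm : y ∈ C.str m)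
    (hl : y ∈ C.str l) : m = l := by
  by_contra h
  exact Set.disjoint_left.1 (hT.disjoint m l h) hm hl

theorem exists_mem_str (hT : C.IsCylNormal T) (y : X) : ∃ l, y ∈ C.str l :=
  mem_iUnion.1 (hT.cover ▸ mem_univ y)

theorem eq_of_φ_eq (hT : C.IsCylNormal T) {l : C.L} {x y : C.D l} (hx : x ∉ C.bdry l)
    (hy : y ∉ C.bdry l) (h : C.φ l x = C.φ l y) : x = y :=
  congrArg Subtype.val ((hT.embedding_interior l).injective (a₁ := ⟨x, hx⟩) (a₂ := ⟨y, hy⟩) h)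

theorem φ_mem_closure (hT : C.IsCylNormal T) (l : C.L) (x : C.D l) :
    C.φ l x ∈ closure (C.str l) := (hT.quotient l).choose x

theorem continuous_φ (hT : C.IsCylNormal T) (l : C.L) : Continuous (C.φ l) := by
  obtain ⟨h, hq⟩ := hT.quotient l
  exact continuous_subtype_val.comp hq.continuous

theorem exists_φ_eq (hT : C.IsCylNormal T) {l : C.L} {y : X} (hy : y ∈ closure (C.str l)) :
    ∃ x, C.φ l x = y := by
  obtain ⟨h, hq⟩ := hT.quotient l
  obtain ⟨x, hx⟩ := hq.surjective ⟨y, hy⟩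
  exact ⟨x, congrArg Subtype.val hx⟩

theorem exists_act_of_φ_eq (hT : C.IsCylNormal T) {m l : C.L} {x : C.D l} {y : C.D m}
    (hy : y ∉ C.bdry m) (h : C.φ l x = C.φ m y) : ∃ p : C.K.Hom m l, C.act p y = x := by
  obtain ⟨m', p, y', hy', rfl⟩ := hT.exists_eq_act l x
  rw [hT.φ_act] at h
  obtain rfl := hT.eq_of_mem_str (hT.φ_mem_str hy') (h ▸ hT.φ_mem_str hy)
  exact ⟨p, by rw [hT.eq_of_φ_eq hy' hy h]⟩

theorem eq_of_act_eq (hT : C.IsCylNormal T) {m l : C.L} {p p' : C.K.Hom m l} {y y' : C.D m}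
    (hy : y ∉ C.bdry m) (hy' : y' ∉ C.bdry m) (h : C.act p y = C.act p' y') :
    p = p' ∧ y = y' := by
  by_cases hm : m = l
  · subst hm
    have := hT.hom_self m
    obtain rfl : p = p' := Subsingleton.elim _ _
    obtain rfl : p = C.K.one m := Subsingleton.elim _ _
    rw [hT.act_one, hT.act_one] at h
    exact ⟨rfl, h⟩
  · have := (hT.embedding_act m l hm).injective (a₁ := (p, ⟨y, hy⟩)) (a₂ := (p', ⟨y', hy'⟩)) h
    exact ⟨congrArg Prod.fst this, congrArg (fun q => q.2.1) this⟩

theorem nonempty_hom (hT : C.IsCylNormal T) {m l : C.L} (h : C.str m ⊆ closure (C.str l)) :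
    Nonempty (C.K.Hom m l) := by
  obtain ⟨z, hz⟩ := (hT.connected m).nonempty
  obtain ⟨x, hx⟩ := hT.exists_φ_eq (h hz)
  rw [← hT.image_interior m] at hz
  obtain ⟨y, hy, rfl⟩ := hz
  obtain ⟨p, -⟩ := hT.exists_act_of_φ_eq hy hx
  exact ⟨p⟩

theorem dim_lt (hT : C.IsCylNormal T) {dim : C.L → ℕ} (hd : C.DimCondition dim) {m l : C.L}
    (hml : m ≠ l) (h : Nonempty (C.K.Hom m l)) : dim m < dim l := by
  obtain ⟨z, hz⟩ := (hT.connected m).nonempty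
  have hz' : z ∈ closure (C.str l) \ C.str l :=
    ⟨hT.le_of_hom m l h hz, fun h' => hml (hT.eq_of_mem_str hz h')⟩
  have := hd l hz'
  simp only [mem_iUnion] at this
  obtain ⟨m', hm', hz''⟩ := this
  rwa [hT.eq_of_mem_str hz hz'']

theorem isEmbedding_act_center (hT : C.IsCylNormal T) (E : C.Asters) {m l : C.L} (h : m ≠ l) :
    IsEmbedding fun p : C.K.Hom m l => C.act p (C.center m) := by
  have : IsEmbedding fun p : C.K.Hom m l =>
      ((p, ⟨C.center m, E.center_notMem_bdry m⟩) : C.K.Hom m l × {x // x ∉ C.bdry m}) :=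
    Function.LeftInverse.isEmbedding (f := Prod.fst) (fun _ => rfl) continuous_fst
      (continuous_id.prodMk continuous_const)
  exact (hT.embedding_act m l h).comp this

/-- The stellar dimension is a rank function, and the orbit of the center of `D_a` embeds `Hom(a,
b)` in the aster `D_b`. -/
theorem isTame (hT : C.IsCylNormal T) (E : C.Asters) {dim : C.L → ℕ} (hd : C.DimCondition dim) :
    C.K.IsTame where
  subsingleton := hT.hom_self
  exists_rank := ⟨dim, fun m l => hT.dim_lt hd⟩
  exists_embedding a b := by
    by_cases h : a = b
    · subst h
      have := hT.hom_self a
      exact ⟨0, fun _ => 0, .of_subsingleton _⟩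
    · exact ⟨_, _, (E.isEmbedding b).comp (hT.isEmbedding_act_center E h)⟩

/-- The parameter space `Hom(m, l)` is homeomorphic to the fiber over the image of the center
of `D_m`. -/
theorem compactSpace_hom (hT : C.IsCylNormal T) (E : C.Asters)
    (h : ∀ m l, IsCompact (C.φ l ⁻¹' {C.φ m (C.center m)})) (m l : C.L) :
    CompactSpace (C.K.Hom m l) := by
  by_cases hm : m = l
  · subst hm
    have := hT.hom_self m
    infer_instance
  · have he := hT.isEmbedding_act_center E hm
    have hr : range (fun p : C.K.Hom m l => C.act p (C.center m)) =
        C.φ l ⁻¹' {C.φ m (C.center m)} := by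
      ext x
      constructor
      · rintro ⟨p, rfl⟩
        exact hT.φ_act m l p _
      · exact fun hx => hT.exists_act_of_φ_eq (E.center_notMem_bdry m) hx
    refine ⟨?_⟩
    rw [he.isInducing.isCompact_iff, image_univ, hr]
    exact h m l

theorem compactSpace_hom_of_isRelativelyCompact (hT : C.IsCylNormal T) (E : C.Asters)
    (h : C.IsRelativelyCompact) (m l : C.L) : CompactSpace (C.K.Hom m l) :=
  hT.compactSpace_hom E (fun _ _ => h _ _) m l

/-- The preimage in `D_m` of the image of its center is the center, and `φ m` is a quotient map onto
a closed subspace.  (The space itself is not assumed to be Hausdorff.) -/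
theorem isClosed_φ_center (hT : C.IsCylNormal T) (E : C.Asters) (m : C.L) :
    IsClosed {C.φ m (C.center m)} := by
  have : T2Space (C.D m) := (E.isEmbedding m).t2Space
  obtain ⟨h, hq⟩ := hT.quotient m
  have h1 : IsClosed {(⟨C.φ m (C.center m), h _⟩ : closure (C.str m))} := by
    rw [← hq.isClosed_preimage]
    convert isClosed_singleton (x := C.center m)
    ext x
    constructor
    · intro hx
      obtain ⟨p, hp⟩ := hT.exists_act_of_φ_eq (E.center_notMem_bdry m) (congrArg Subtype.val hx)
      have := hT.hom_self m
      rw [Subsingleton.elim p (C.K.one m), hT.act_one] at hp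
      exact hp.symm
    · rintro rfl
      rfl
  have h2 := isClosed_closure.isClosedEmbedding_subtypeVal.isClosedMap _ h1
  rwa [image_singleton] at h2

end IsCylNormal

theorem AllCellsClosed.compactSpace {E : C.Asters} (h : C.AllCellsClosed E) (l : C.L) :
    CompactSpace (C.D l) := by
  refine ⟨?_⟩
  rw [(E.isEmbedding l).isInducing.isCompact_iff, image_univ]
  refine isCompact_of_isClosed_isBounded (h l).1
    ((isBounded_closedBall (x := 0) (r := 1)).subset ?_)
  rintro _ ⟨x, rfl⟩
  exact mem_closedBall_zero_iff.2 (E.norm_le l x)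

namespace IsCylNormal

theorem compactSpace_hom_of_allCellsClosed (hT : C.IsCylNormal T) {E : C.Asters}
    (h : C.AllCellsClosed E) (m l : C.L) : CompactSpace (C.K.Hom m l) :=
  hT.compactSpace_hom E (fun m l => by
    have := h.compactSpace l
    exact ((hT.isClosed_φ_center E m).preimage (hT.continuous_φ l)).isCompact) m l

theorem finite_nonempty_hom (hT : C.IsCylNormal T) (h : C.IsCW) (l : C.L) :
    {a | Nonempty (C.K.Hom a l)}.Finite := by
  obtain ⟨s, hs, hsl⟩ := h.1 l
  refine (hs.insert l).subset fun a ha => ?_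
  by_cases hal : a = l
  · exact Or.inl hal
  · obtain ⟨z, hz⟩ := (hT.connected a).nonempty
    have := hsl ⟨hT.le_of_hom a l ha hz, fun h' => hal (hT.eq_of_mem_str hz h')⟩
    simp only [mem_iUnion] at this
    obtain ⟨m, hm, hz'⟩ := this
    exact Or.inr (hT.eq_of_mem_str hz hz' ▸ hm)

/-- Since the products of strata of `Hom(m, l)` and the interior of `D_m` are strata of the boundary
of `D_l`, normality of the boundary implies normality of `Hom(m, l)`. -/
theorem isNormalStratification_par (hT : C.IsCylNormal T) (E : C.Asters) (m l : C.L) :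
    IsNormalStratification (T.par m l) := by
  refine ⟨hT.par_strat m l, ?_⟩
  rintro P hP P' hP' ⟨p, hp, hp'⟩
  by_cases hml : m = l
  · subst hml
    have := hT.hom_self m
    exact fun q _ => Subsingleton.elim p q ▸ hp'
  have hc := E.center_notMem_bdry m
  obtain ⟨e, he, heP⟩ := hT.act_interior m l hml P hP
  obtain ⟨e', he', heP'⟩ := hT.act_interior m l hml P' hP'
  -- Closures in `Hom(m, l)` are detected in `D_l` along the slice through the center of `D_m`.
  let f := fun q : C.K.Hom m l × {x // x ∉ C.bdry m} => C.act q.1 q.2.1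
  have hf : IsEmbedding f := hT.embedding_act m l hml
  have hcl : ∀ q : C.K.Hom m l, q ∈ closure P' ↔ f (q, ⟨C.center m, hc⟩) ∈
      closure (Subtype.val '' e') := by
    intro q
    have h1 : Subtype.val '' e' = f '' (P' ×ˢ univ) := by
      rw [heP']
      ext z
      constructor
      · rintro ⟨p, hp, x, hx, rfl⟩
        exact ⟨(p, ⟨x, hx⟩), ⟨hp, mem_univ _⟩, rfl⟩
      · rintro ⟨⟨p, x⟩, ⟨hp, -⟩, rfl⟩
        exact ⟨p, hp, x.1, x.2, rfl⟩
    rw [h1, ← mem_preimage, ← hf.isInducing.closure_eq_preimage_closure_image, closure_prod_eq]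
    exact ⟨fun h => ⟨h, subset_closure (mem_univ _)⟩, fun h => h.1⟩
  have hmem : ∀ q ∈ P, ∃ z ∈ e, z.1 = f (q, ⟨C.center m, hc⟩) := fun q hq => by
    have : f (q, ⟨C.center m, hc⟩) ∈ Subtype.val '' e := heP ▸ ⟨q, hq, _, hc, rfl⟩
    exact this
  obtain ⟨z, hz, hzp⟩ := hmem p hp
  have hsub := (hT.bd_strat l).2 e he e' he' ⟨z, hz, by
    rw [closure_subtype, hzp]; exact (hcl p).1 hp'⟩
  intro q hq
  obtain ⟨w, hw, hwq⟩ := hmem q hq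
  rw [hcl, ← hwq, ← closure_subtype]
  exact hsub hw

theorem isParStratification (hT : C.IsCylNormal T) (E : C.Asters)
    [∀ a b, T2Space (C.K.Hom a b)] [∀ a b, CompactSpace (C.K.Hom a b)] :
    C.K.IsParStratification T.par :=
  C.K.isParStratification_of_compact (hT.isNormalStratification_par E) hT.comp_strict

/-- The opposite category of the cylindrical face category, with the same stratifications. -/
theorem isParStratification_op (hT : C.IsCylNormal T) (E : C.Asters)
    [∀ a b, T2Space (C.K.Hom a b)] [∀ a b, CompactSpace (C.K.Hom a b)] :
    C.K.op.IsParStratification fun m l => T.par l m := by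
  have : ∀ a b, T2Space (C.K.op.Hom a b) := fun a b => inferInstanceAs (T2Space (C.K.Hom b a))
  have : ∀ a b, CompactSpace (C.K.op.Hom a b) := fun a b =>
    inferInstanceAs (CompactSpace (C.K.Hom b a))
  refine C.K.op.isParStratification_of_compact
    (fun m l => hT.isNormalStratification_par E l m) fun a b c q hq p hp => ?_
  have := hT.comp_strict c b a p hp q hq
  exact (image2_swap (fun g f => C.K.comp g f) p q) ▸ this

end IsCylNormal

end CylData

/-- With finitely many objects, subtracting a rank from its maximum gives a rank for the opposite
category. -/
theorem TopEnrichedCat.IsTame.op {L : Type u} [Finite L] {K : TopEnrichedCat L} (hK : K.IsTame) :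
    K.op.IsTame where
  subsingleton := hK.subsingleton
  exists_rank := by
    obtain ⟨r, hr⟩ := hK.exists_rank
    obtain ⟨M, hM⟩ := (finite_range r).bddAbove
    have hM' : ∀ l, r l ≤ M := fun l => hM ⟨l, rfl⟩
    refine ⟨fun l => M - r l, fun m l hml h => ?_⟩
    have h1 := hr l m (Ne.symm hml) h
    have h2 := hM' m
    change M - r m < M - r l
    omega
  exists_embedding a b := hK.exists_embedding b a

/-! ### The canonical morphism on domains -/

namespace TopEnrichedCat

variable {L : Type u} {K : TopEnrichedCat L}

open RightModule

theorem IsTame.wellFounded (hK : K.IsTame) :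
    WellFounded fun m l : L => m ≠ l ∧ Nonempty (K.Hom m l) := by
  obtain ⟨r, hr⟩ := hK.exists_rank
  exact Subrelation.wf (fun h => hr _ _ h.1 h.2) (InvImage.wf r wellFounded_lt)

/-- The coordinates `(s, g, w)` of a point `s · (g w)` on a radius of the lower star of `l`, where
`g : m → l` with `m ≠ l` and `w` lies in the open cone over `m`. -/
abbrev RadialCoord (K : TopEnrichedCat L) (l : L) : Type u :=
  Σ m : {m : L // m ≠ l}, unitInterval × K.Hom m l × {w : (K.repr m).Real // 0 < (K.repr m).wt m w}

/-- The point with given radial coordinates. -/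
noncomputable def RadialCoord.toReal (hK : K.IsTame) {l : L} (d : K.RadialCoord l) :
    (K.repr l).Real :=
  hK.radial d.2.1 ((K.repr l).smul d.2.2.1 d.2.2.2.1)

theorem RadialCoord.wt_toReal (hK : K.IsTame) {l : L} (d : K.RadialCoord l) :
    (K.repr l).wt l (d.toReal hK) = 1 - d.2.1 := by
  rw [toReal, hK.wt_radial, hK.wt_smul_eq_zero d.1.2, mul_zero, zero_add]

/-- Away from the center, radial coordinates are unique. -/
theorem RadialCoord.eq_of_toReal_eq (hK : K.IsTame) [∀ a b, LocallyCompactSpace (K.Hom a b)] {l : L}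
    {d d' : K.RadialCoord l} (h : d.toReal hK = d'.toReal hK) :
    d.2.1 = 0 ∧ d'.2.1 = 0 ∨ d = d' := by
  have := hK.t2Space_hom
  obtain ⟨⟨m, hm⟩, s, g, w, hw⟩ := d
  obtain ⟨⟨m', hm'⟩, s', g', w', hw'⟩ := d'
  by_cases hs : s = 0
  · left
    subst hs
    have h1 := congrArg ((K.repr l).wt l) h
    rw [wt_toReal, wt_toReal] at h1
    have h2 : (s' : ℝ) = ((0 : unitInterval) : ℝ) := by linarith
    exact ⟨rfl, Subtype.ext h2⟩
  · right
    obtain ⟨rfl, h1⟩ := hK.radial_injective (hK.wt_smul_eq_zero hm g w)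
      (hK.wt_smul_eq_zero hm' g' w') hs h
    obtain rfl := eq_of_smul_eq (M := K.repr l) hK hw hw' h1
    have h2 := (isEmbedding_smul (M := K.repr l) hK (m := m)).injective
      (a₁ := (g, ⟨w, hw⟩)) (a₂ := (g', ⟨w', hw'⟩)) h1
    obtain ⟨rfl, h3⟩ := Prod.mk.inj h2
    obtain rfl := congrArg Subtype.val h3
    rfl

/-- A point of a simplex with last vertex `l` lies on the radius through the point of the opposite
face with proportional coordinates. -/
theorem IsTame.radial_smul_truncPt (hK : K.IsTame) {l : L} {n : ℕ} (v : (K.repr l).Chain (n + 1))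
    (hv : v.obj (Fin.last (n + 1)) = l) (t : stdSimplex ℝ (Fin (n + 2)))
    (ht : t (Fin.last (n + 1)) ≠ 1) :
    hK.radial (unitInterval.symm ⟨t (Fin.last (n + 1)), stdSimplex.zero_le t _,
        stdSimplex.le_one t _⟩)
      ((K.repr l).smul (v.elt (Fin.last n).castSucc) (truncPt v (Fin.last n).castSucc t)) =
    mkPt v t := by
  set j : Fin (n + 2) := (Fin.last n).castSucc
  set a := t (Fin.last (n + 1))
  have ha : 0 < 1 - a := sub_pos.2 (lt_of_le_of_ne (stdSimplex.le_one t _) ht)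
  -- `t'` is the projection of `t` from the last vertex to the opposite face.
  let w : Fin (n + 2) → ℝ := fun i => if i = Fin.last (n + 1) then 0 else t i
  have hw0 : ∀ i, 0 ≤ w i := fun i => by
    simp only [w]
    split_ifs
    exacts [le_rfl, stdSimplex.zero_le t i]
  have hsum : ∑ i, w i = 1 - a := by
    have h1 := stdSimplex.sum_eq_one t
    rw [Fin.sum_univ_castSucc] at h1 ⊢
    have h2 : ∀ i : Fin (n + 1), w i.castSucc = t i.castSucc := fun i =>
      if_neg (Fin.castSucc_lt_last i).ne
    simp only [h2, w, if_true]
    linarith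
  have hsum' : 0 < ∑ i, w i := hsum ▸ ha
  let t' := stdSimplex.normalize w
  have ht' : ∀ i, t' i = w i / (1 - a) := fun i =>
    (stdSimplex.normalize_apply hw0 hsum' i).trans (by rw [hsum])
  have hlast : t' (Fin.last (n + 1)) = 0 := by rw [ht']; simp [w]
  have hne : ∀ i : Fin (n + 2), i ≤ j → i ≠ Fin.last (n + 1) := fun i hi h =>
    absurd (h ▸ hi) (not_le.2 (Fin.castSucc_lt_last _))
  have hj : ∀ i, j < i → t' i = 0 := fun i hi => by
    have : i = Fin.last (n + 1) := by
      apply Fin.ext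
      have h1 : n < i.val := hi
      have h2 := i.2
      change i.val = n + 1
      omega
    rw [this, hlast]
  have htr : truncPt v j t = truncPt v j t' := by
    rw [truncPt, truncPt]
    congr 1
    have h1 : ∀ i, t' (initEmb j i) = t (initEmb j i) / (1 - a) := fun i => by
      rw [ht']
      simp only [w]
      rw [if_neg (hne _ (initEmb_le j i))]
    obtain ⟨i, hi⟩ := stdSimplex.exists_pos t'
    have hij : i ≤ j := not_lt.1 fun h => hi.ne' (hj i h)
    have hs' := sum_initEmb_pos hij hi
    have hti : 0 < t i := by
      have := h1 (⟨i, Nat.lt_succ_of_le hij⟩)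
      by_contra hneg
      have h0 : t i = 0 := le_antisymm (not_lt.1 hneg) (stdSimplex.zero_le t i)
      rw [ht'] at hi
      simp only [w] at hi
      rw [if_neg (hne i hij), h0, zero_div] at hi
      exact lt_irrefl _ hi
    have hs := sum_initEmb_pos hij hti
    ext i
    rw [stdSimplex.normalize_apply (fun i => stdSimplex.zero_le t _) hs,
      stdSimplex.normalize_apply (fun i => stdSimplex.zero_le t' _) hs']
    simp only [h1]
    rw [← Finset.sum_div, div_div_div_cancel_right₀ ha.ne']
  rw [htr, smul_truncPt v j t' hj, hK.radial_mkPt hv]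
  congr 1
  ext i
  rw [stdSimplex.segment_apply]
  simp only [unitInterval.coe_symm_eq]
  rw [ht']
  simp only [w]
  split_ifs with h
  · rw [h]; ring
  · field_simp
    ring

/-- Every point except the center has radial coordinates. -/
theorem IsTame.exists_toReal_eq (hK : K.IsTame) {l : L} (x : (K.repr l).Real) :
    x = K.starCenter l ∨ ∃ d : K.RadialCoord l, d.toReal hK = x := by
  obtain ⟨n, v, t, hv, rfl⟩ := hK.exists_last x
  by_cases ht : t (Fin.last n) = 1
  · left
    have h : stdSimplex.segment 0 t = t := by
      have h1 : ∀ i, i ≠ Fin.last n → t i = 0 := fun i hi => by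
        have h2 := stdSimplex.sum_eq_one t
        rw [← Finset.add_sum_erase _ _ (Finset.mem_univ (Fin.last n)), ht, add_eq_left,
          Finset.sum_eq_zero_iff_of_nonneg fun i _ => stdSimplex.zero_le t i] at h2
        exact h2 i (Finset.mem_erase.2 ⟨hi, Finset.mem_univ i⟩)
      ext i
      rw [stdSimplex.segment_apply]
      by_cases hi : i = Fin.last n
      · simp [hi, ht]
      · simp [hi, h1 i hi]
    rw [← hK.radial_zero (mkPt v t), hK.radial_mkPt hv, h]
  · right
    obtain _ | n := n
    · refine absurd ?_ ht
      have := stdSimplex.sum_eq_one t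
      rwa [Fin.sum_univ_one] at this
    · have h := hK.radial_smul_truncPt v hv t ht
      obtain ⟨m, g, w, hw, hgw⟩ := exists_smul_eq
        (truncPt v (Fin.last n).castSucc t)
      have hm : m ≠ l := by
        rintro rfl
        exact hK.obj_ne v (Fin.castSucc_lt_last (Fin.last n))
          (hK.antisymm (v.elt (Fin.last n).castSucc) g)
      refine ⟨⟨⟨m, hm⟩, unitInterval.symm ⟨t (Fin.last (n + 1)), stdSimplex.zero_le t _,
        stdSimplex.le_one t _⟩, K.comp (v.elt (Fin.last n).castSucc) g, ⟨w, hw⟩⟩, Eq.trans ?_ h⟩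
      rw [← hgw]
      exact congrArg (hK.radial _)
        (smul_comp (M := K.repr l) g (v.elt (Fin.last n).castSucc) w).symm

end TopEnrichedCat

namespace CylData

variable {X : Type u} [TopologicalSpace X] {C : CylData X} {T : C.Strats}

open TopEnrichedCat RightModule

/-- Radial multiplication in the asters. -/
noncomputable def Asters.radial (E : C.Asters) {l : C.L} (s : unitInterval) (x : C.D l) : C.D l :=
  (E.star l x s s.2.1 s.2.2).choose

theorem Asters.ι_radial (E : C.Asters) {l : C.L} (s : unitInterval) (x : C.D l) :
    E.ι l (E.radial s x) = (s : ℝ) • E.ι l x :=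
  (E.star l x s s.2.1 s.2.2).choose_spec

theorem Asters.continuous_radial (E : C.Asters) (l : C.L) :
    Continuous fun q : unitInterval × C.D l => E.radial q.1 q.2 := by
  refine (E.isEmbedding l).continuous_iff.2 ?_
  have : E.ι l ∘ (fun q : unitInterval × C.D l => E.radial q.1 q.2) =
      fun q => (q.1 : ℝ) • E.ι l q.2 := funext fun q => E.ι_radial q.1 q.2
  rw [this]
  exact (continuous_subtype_val.comp continuous_fst).smul
    ((E.isEmbedding l).continuous.comp continuous_snd)

theorem Asters.radial_zero (E : C.Asters) {l : C.L} (x : C.D l) :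
    E.radial 0 x = C.center l :=
  (E.isEmbedding l).injective (by rw [E.ι_radial, E.center]; exact zero_smul _ _)

theorem Asters.radial_one (E : C.Asters) {l : C.L} (x : C.D l) : E.radial 1 x = x :=
  (E.isEmbedding l).injective (by rw [E.ι_radial]; exact _root_.one_smul _ _)

theorem Asters.radial_center (E : C.Asters) {l : C.L} (s : unitInterval) :
    E.radial s (C.center l) = C.center l :=
  (E.isEmbedding l).injective (by rw [E.ι_radial, E.center, smul_zero])

theorem Asters.radial_mul (E : C.Asters) {l : C.L} (s t : unitInterval) (x : C.D l) :
    E.radial (s * t) x = E.radial s (E.radial t x) :=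
  (E.isEmbedding l).injective (by
    rw [E.ι_radial, E.ι_radial, E.ι_radial, smul_smul, Set.Icc.coe_mul])

/-- The maps `z_l` from the domains of the Salvetti complex to the domains of `X`, defined by
recursion on `l`: the boundary point `g w`, where `g : m → l` and `w` lies in the interior of the
domain over `m`, is sent to `g z_m(w)`, and this is extended radially.  A point without radial
coordinates is the center. -/
noncomputable def Asters.canonicalMap (E : C.Asters) (hK : C.K.IsTame) :
    ∀ l, (C.K.repr l).Real → C.D l :=
  open Classical in
  hK.wellFounded.fix fun l ih x =>
    if h : ∃ d : C.K.RadialCoord l, d.toReal hK = x then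
      E.radial h.choose.2.1 (C.act h.choose.2.2.1
        (ih h.choose.1 ⟨h.choose.1.2, ⟨h.choose.2.2.1⟩⟩ h.choose.2.2.2.1))
    else C.center l

section CanonicalMap

variable (E : C.Asters) (hK : C.K.IsTame)

theorem Asters.canonicalMap_def (l : C.L) (x : (C.K.repr l).Real) :
    open Classical in E.canonicalMap hK l x =
      if h : ∃ d : C.K.RadialCoord l, d.toReal hK = x then
        E.radial h.choose.2.1 (C.act h.choose.2.2.1
          (E.canonicalMap hK h.choose.1 h.choose.2.2.2.1))
      else C.center l := by
  rw [canonicalMap, WellFounded.fix_eq]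

variable [∀ a b, LocallyCompactSpace (C.K.Hom a b)]

theorem Asters.canonicalMap_toReal {l : C.L} (d : C.K.RadialCoord l) :
    E.canonicalMap hK l (d.toReal hK) =
      E.radial d.2.1 (C.act d.2.2.1 (E.canonicalMap hK d.1 d.2.2.2.1)) := by
  have h : ∃ d' : C.K.RadialCoord l, d'.toReal hK = d.toReal hK := ⟨d, rfl⟩
  rw [canonicalMap_def, dif_pos h]
  rcases RadialCoord.eq_of_toReal_eq hK h.choose_spec with ⟨h1, h2⟩ | h1
  · rw [h1, h2, E.radial_zero, E.radial_zero]
  · rw [h1]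

theorem Asters.canonicalMap_radial_smul {m l : C.L} (hm : m ≠ l) (s : unitInterval)
    (g : C.K.Hom m l) {w : (C.K.repr m).Real} (hw : 0 < (C.K.repr m).wt m w) :
    E.canonicalMap hK l (hK.radial s ((C.K.repr l).smul g w)) =
      E.radial s (C.act g (E.canonicalMap hK m w)) :=
  E.canonicalMap_toReal hK ⟨⟨m, hm⟩, s, g, ⟨w, hw⟩⟩

theorem Asters.canonicalMap_starCenter (l : C.L) :
    E.canonicalMap hK l (C.K.starCenter l) = C.center l := by
  by_cases h : ∃ d : C.K.RadialCoord l, d.toReal hK = C.K.starCenter l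
  · obtain ⟨d, hd⟩ := h
    have h1 := d.wt_toReal hK
    rw [hd, wt_starCenter] at h1
    have h2 : d.2.1 = 0 := Subtype.ext (by change (d.2.1 : ℝ) = 0; linarith)
    rw [← hd, E.canonicalMap_toReal, h2, E.radial_zero]
  · rw [canonicalMap_def, dif_neg h]

theorem Asters.canonicalMap_radial {l : C.L} (s : unitInterval) (x : (C.K.repr l).Real) :
    E.canonicalMap hK l (hK.radial s x) = E.radial s (E.canonicalMap hK l x) := by
  rcases hK.exists_toReal_eq x with rfl | ⟨⟨⟨m, hm⟩, t, g, w, hw⟩, rfl⟩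
  · rw [E.canonicalMap_starCenter, E.radial_center, ← hK.radial_zero (C.K.starCenter l),
      ← hK.radial_mul, mul_zero, hK.radial_zero, E.canonicalMap_starCenter]
  · rw [RadialCoord.toReal, ← hK.radial_mul, E.canonicalMap_radial_smul hK hm _ g hw,
      E.canonicalMap_radial_smul hK hm _ g hw, E.radial_mul]

theorem Asters.norm_canonicalMap_le {l : C.L} (x : (C.K.repr l).Real) :
    ‖E.ι l (E.canonicalMap hK l x)‖ ≤ 1 - (C.K.repr l).wt l x := by
  rcases hK.exists_toReal_eq x with rfl | ⟨d, rfl⟩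
  · rw [E.canonicalMap_starCenter, E.center, norm_zero, wt_starCenter, sub_self]
  · rw [E.canonicalMap_toReal, d.wt_toReal, E.ι_radial, norm_smul, Real.norm_of_nonneg d.2.1.2.1,
      sub_sub_cancel]
    exact mul_le_of_le_one_right d.2.1.2.1 (E.norm_le _ _)

theorem Asters.canonicalMap_notMem_bdry {l : C.L} {x : (C.K.repr l).Real}
    (hx : 0 < (C.K.repr l).wt l x) : E.canonicalMap hK l x ∉ C.bdry l := by
  rw [E.mem_bdry]
  have := E.norm_canonicalMap_le hK x
  exact ne_of_lt (by linarith)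

variable {E}

namespace IsCylNormal

theorem canonicalMap_smul (hT : C.IsCylNormal T) {m l : C.L} (g : C.K.Hom m l)
    (x : (C.K.repr m).Real) :
    E.canonicalMap hK l ((C.K.repr l).smul g x) = C.act g (E.canonicalMap hK m x) := by
  have key : ∀ {a b : C.L} (p : C.K.Hom a b) {w : (C.K.repr a).Real}, 0 < (C.K.repr a).wt a w →
      E.canonicalMap hK b ((C.K.repr b).smul p w) = C.act p (E.canonicalMap hK a w) := by
    intro a b p w hw
    by_cases hab : a = b
    · subst hab
      rw [hK.eq_one p, hT.act_one, RightModule.one_smul]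
    · have := E.canonicalMap_radial_smul hK hab 1 p hw
      rwa [hK.radial_one, E.radial_one] at this
  obtain ⟨a, f, w, hw, rfl⟩ := exists_smul_eq x
  rw [key f hw, ← hT.act_comp, ← key _ hw]
  exact congrArg _ (smul_comp (M := C.K.repr l) f g w)

theorem canonicalMap_mem_bdry (hT : C.IsCylNormal T) {m l : C.L} (hm : m ≠ l) (g : C.K.Hom m l)
    {w : (C.K.repr m).Real} (hw : 0 < (C.K.repr m).wt m w) :
    C.act g (E.canonicalMap hK m w) ∈ C.bdry l := by
  rw [hT.bdry_eq]
  exact mem_biUnion (show m ∈ {m | m ≠ l} from hm)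
    ⟨g, mem_univ _, _, E.canonicalMap_notMem_bdry hK hw, rfl⟩

/-- The norm of the image is the radial parameter `s`; if it is not zero, the boundary point `g w`
at the end of the radius can be recovered, since distinct strata of `X` are disjoint and `act` is
injective on interiors. -/
theorem canonicalMap_injective (hT : C.IsCylNormal T) (l : C.L) :
    Function.Injective (E.canonicalMap hK l) := by
  induction l using hK.wellFounded.induction with
  | _ l ih =>
  have hnorm : ∀ d : C.K.RadialCoord l, ‖E.ι l (E.canonicalMap hK l (d.toReal hK))‖ = d.2.1 := by
    rintro ⟨⟨m, hm⟩, s, g, w, hw⟩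
    rw [E.canonicalMap_toReal, E.ι_radial, norm_smul, Real.norm_of_nonneg s.2.1,
      (E.mem_bdry l _).1 (hT.canonicalMap_mem_bdry hK hm g hw), mul_one]
  have hcenter : ∀ d : C.K.RadialCoord l,
      C.center l = E.canonicalMap hK l (d.toReal hK) → C.K.starCenter l = d.toReal hK := by
    intro d h
    have h1 := hnorm d
    rw [← h, E.center, norm_zero] at h1
    have h2 : d.2.1 = 0 := Subtype.ext h1.symm
    rw [RadialCoord.toReal, h2, hK.radial_zero]
  intro x y h
  rcases hK.exists_toReal_eq x with rfl | ⟨d, rfl⟩ <;>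
    rcases hK.exists_toReal_eq y with rfl | ⟨d', rfl⟩
  · rfl
  · rw [E.canonicalMap_starCenter] at h
    exact hcenter d' h
  · rw [E.canonicalMap_starCenter] at h
    exact (hcenter d h.symm).symm
  · have hs : d.2.1 = d'.2.1 := Subtype.ext (by rw [← hnorm, ← hnorm, h])
    obtain ⟨⟨m, hm⟩, s, g, w, hw⟩ := d
    obtain ⟨⟨m', hm'⟩, s', g', w', hw'⟩ := d'
    obtain rfl : s = s' := hs
    by_cases h0 : s = 0
    · rw [RadialCoord.toReal, RadialCoord.toReal, h0, hK.radial_zero, hK.radial_zero]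
    · have h0' : (s : ℝ) ≠ 0 := fun h => h0 (Subtype.ext h)
      have h1 := congrArg (E.ι l) h
      rw [E.canonicalMap_toReal, E.canonicalMap_toReal, E.ι_radial, E.ι_radial] at h1
      have h2 : C.act g (E.canonicalMap hK m w) = C.act g' (E.canonicalMap hK m' w') :=
        (E.isEmbedding l).injective (smul_right_injective _ h0' h1)
      have hb := E.canonicalMap_notMem_bdry hK hw
      have hb' := E.canonicalMap_notMem_bdry hK hw'
      have h3 := congrArg (C.φ l) h2
      rw [hT.φ_act, hT.φ_act] at h3
      obtain rfl := hT.eq_of_mem_str (hT.φ_mem_str hb) (h3 ▸ hT.φ_mem_str hb')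
      obtain ⟨rfl, h4⟩ := hT.eq_of_act_eq hb hb' h2
      obtain rfl := ih m ⟨hm, ⟨g⟩⟩ h4
      rfl

/-- On a simplex with last vertex the identity of `l`, the map is radial over the opposite face,
where it is continuous by induction; on the other simplices it is given by the map for their last
object. -/
theorem continuous_canonicalMap (hT : C.IsCylNormal T) (l : C.L) :
    Continuous (E.canonicalMap hK l) := by
  induction l using hK.wellFounded.induction with
  | _ l ih =>
  refine Realization.continuous_iff.2 fun n => Chain.continuous_prod (M := C.K.repr l) fun o => ?_
  -- For a chain whose object `o j` is different from `l`, the induction hypothesis applies.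
  have hstep : ∀ j : Fin (n + 1), o j ≠ l →
      ContinuousOn (fun q : {p // (C.K.repr l).IsChain o p} × stdSimplex ℝ (Fin (n + 1)) =>
        C.act (m := o j) (l := l) ((ofFiber o q.1).elt j)
          (E.canonicalMap hK (o j) (truncPt (ofFiber o q.1) j q.2)))
        {q | 0 < ∑ i, q.2 (initEmb j i)} := by
    intro j hj q hq
    have hz := ih (o j) ⟨hj, ⟨q.1.1.2 j⟩⟩
    refine (hT.continuous_act (o j) l).comp_continuousOn (ContinuousOn.prodMk ?_
      (hz.comp_continuousOn (continuousOn_truncPt (M := C.K.repr l) o j))) q hq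
    exact (((continuous_apply j).comp (continuous_snd.comp
      (continuous_subtype_val.comp continuous_fst)))).continuousOn
  by_cases hl : o (Fin.last n) = l
  · obtain _ | n := n
    · have : ∀ q : {p // (C.K.repr l).IsChain o p} × stdSimplex ℝ (Fin 1),
          E.canonicalMap hK l (mkPt (ofFiber o q.1) q.2) = C.center l := fun q => by
        rw [← E.canonicalMap_starCenter hK l]
        congr 1
        refine hK.eq_starCenter fun a => wt_eq_zero (M := C.K.repr l) _ _ fun i hi => a.2.1 ?_
        rw [← hi, Subsingleton.elim (α := Fin 1) i (Fin.last 0)]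
        exact hl
      exact continuous_const.congr fun q => (this q).symm
    · have hsum : ∀ t : stdSimplex ℝ (Fin (n + 2)), t (Fin.last (n + 1)) ≠ 1 →
          0 < ∑ i, t (initEmb (Fin.last n).castSucc i) := by
        intro t ht
        by_contra hneg
        have h0 : ∀ i : Fin (n + 1), t i.castSucc = 0 := fun i => by
          by_contra hi
          exact hneg (sum_initEmb_pos (i := i.castSucc)
            (Fin.castSucc_le_castSucc_iff.2 (Fin.le_last i))
            (lt_of_le_of_ne (stdSimplex.zero_le t _) (Ne.symm hi)))
        have h1 := stdSimplex.sum_eq_one t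
        rw [Fin.sum_univ_castSucc] at h1
        simp only [h0, Finset.sum_const_zero, zero_add] at h1
        exact ht h1
      have hformula : ∀ q : {p // (C.K.repr l).IsChain o p} × stdSimplex ℝ (Fin (n + 2)),
          q.2 (Fin.last (n + 1)) ≠ 1 → E.canonicalMap hK l (mkPt (ofFiber o q.1) q.2) =
          E.radial (unitInterval.symm ⟨q.2 (Fin.last (n + 1)), stdSimplex.zero_le q.2 _,
            stdSimplex.le_one q.2 _⟩)
            (C.act (m := o (Fin.last n).castSucc) (l := l)
              ((ofFiber o q.1).elt (Fin.last n).castSucc)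
              (E.canonicalMap hK _ (truncPt (ofFiber o q.1) (Fin.last n).castSucc q.2))) := by
        intro q hq
        rw [← hK.radial_smul_truncPt (ofFiber o q.1) hl q.2 hq, E.canonicalMap_radial]
        exact congrArg _ (hT.canonicalMap_smul hK _ _)
      have hc : Continuous fun q : {p // (C.K.repr l).IsChain o p} × stdSimplex ℝ (Fin (n + 2)) =>
          q.2 (Fin.last (n + 1)) := (stdSimplex.continuous_apply _).comp continuous_snd
      refine continuous_iff_continuousAt.2 fun q => ?_
      by_cases hq : q.2 (Fin.last (n + 1)) = 1
      · -- Near the center, the norm is bounded by one minus the last coordinate.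
        rw [(E.isEmbedding l).continuousAt_iff]
        have hb : ∀ q : {p // (C.K.repr l).IsChain o p} × stdSimplex ℝ (Fin (n + 2)),
            ‖E.ι l (E.canonicalMap hK l (mkPt (ofFiber o q.1) q.2))‖ ≤
              1 - q.2 (Fin.last (n + 1)) := fun q => by
          have h1 := wt_obj (M := C.K.repr l) (ofFiber o q.1) q.2 (Fin.last (n + 1))
          have h2 : (ofFiber o q.1).obj (Fin.last (n + 1)) = l := hl
          rw [h2] at h1
          rw [← h1]
          exact E.norm_canonicalMap_le hK _
        have h0 : E.ι l (E.canonicalMap hK l (mkPt (ofFiber o q.1) q.2)) = 0 := by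
          have := hb q
          rw [hq, sub_self] at this
          exact norm_le_zero_iff.1 this
        change Filter.Tendsto _ _ (𝓝 (E.ι l (E.canonicalMap hK l (mkPt (ofFiber o q.1) q.2))))
        rw [h0]
        refine squeeze_zero_norm hb ?_
        have := hc.tendsto q |>.const_sub 1
        rwa [hq, sub_self] at this
      · have ho : IsOpen {q : {p // (C.K.repr l).IsChain o p} × stdSimplex ℝ (Fin (n + 2)) |
            q.2 (Fin.last (n + 1)) ≠ 1} := isOpen_ne_fun hc continuous_const
        have hj : o (Fin.last n).castSucc ≠ l := fun h =>
          (Fin.castSucc_lt_last (Fin.last n)).ne (q.1.2.1.1 (h.trans hl.symm))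
        refine ContinuousAt.congr ?_ (Filter.eventuallyEq_of_mem (ho.mem_nhds hq)
          fun q' hq' => (hformula q' hq').symm)
        have h1 := ((hstep _ hj).mono fun q' hq' => hsum q'.2 hq').continuousAt (ho.mem_nhds hq)
        have h2 : Continuous fun q : {p // (C.K.repr l).IsChain o p} ×
            stdSimplex ℝ (Fin (n + 2)) => unitInterval.symm ⟨q.2 (Fin.last (n + 1)),
              stdSimplex.zero_le q.2 _, stdSimplex.le_one q.2 _⟩ :=
          unitInterval.continuous_symm.comp (continuous_induced_rng.2 hc)
        exact (E.continuous_radial l).continuousAt.comp (h2.continuousAt.prodMk h1)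
  · have : ∀ q : {p // (C.K.repr l).IsChain o p} × stdSimplex ℝ (Fin (n + 1)),
        E.canonicalMap hK l (mkPt (ofFiber o q.1) q.2) =
          C.act (m := o (Fin.last n)) (l := l) ((ofFiber o q.1).elt (Fin.last n))
            (E.canonicalMap hK _ (truncPt (ofFiber o q.1) (Fin.last n) q.2)) := fun q => by
      rw [← smul_truncPt (ofFiber o q.1) (Fin.last n) q.2
        fun i hi => absurd hi (not_lt.2 (Fin.le_last i))]
      exact hT.canonicalMap_smul hK _ _
    refine Continuous.congr (continuousOn_univ.1 ((hstep _ hl).mono fun q _ => ?_))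
      fun q => (this q).symm
    obtain ⟨i, hi⟩ := stdSimplex.exists_pos q.2
    exact sum_initEmb_pos (Fin.le_last i) hi

/-- When all cells are closed, every point except the center lies on a radius that ends in the
boundary, and the boundary is covered by images of interiors of smaller domains. -/
theorem canonicalMap_surjective (hT : C.IsCylNormal T) (hcl : C.AllCellsClosed E) (l : C.L) :
    Function.Surjective (E.canonicalMap hK l) := by
  induction l using hK.wellFounded.induction with
  | _ l ih =>
  intro y
  rcases (hcl l).2 y with rfl | ⟨b, hb, s, h0, h1, hs⟩
  · exact ⟨_, E.canonicalMap_starCenter hK l⟩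
  · rw [hT.bdry_eq] at hb
    simp only [mem_iUnion] at hb
    obtain ⟨m, hm, g, -, y', -, rfl⟩ := hb
    obtain ⟨w, rfl⟩ := ih m ⟨hm, ⟨g⟩⟩ y'
    refine ⟨hK.radial ⟨s, h0, h1⟩ ((C.K.repr l).smul g w), (E.isEmbedding l).injective ?_⟩
    rw [E.canonicalMap_radial, E.ι_radial, hT.canonicalMap_smul, hs]

end IsCylNormal

end CanonicalMap

end CylData

/-! ### The canonical morphism on underlying spaces -/

namespace CylData

variable {X : Type u} [TopologicalSpace X] {C : CylData X} {T : C.Strats}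

open TopEnrichedCat RightModule

/-- Every point of the subdivision lies in the image of the interior of a domain. -/
theorem exists_sal_φ_eq (C : CylData X) (z : C.Sd) :
    ∃ (m : C.L) (w : (C.K.repr m).Real), 0 < (C.K.repr m).wt m w ∧ C.K.salvetti.φ m w = z := by
  obtain ⟨y, rfl⟩ := C.K.classifyingHomeo.surjective z
  obtain ⟨m, g, w, hw, rfl⟩ := exists_smul_eq y
  exact ⟨m, w, hw, salvetti_φ w⟩

/-- The map from the barycentric subdivision to the space, given on the stratum with index `m` by
the map `z_m` between the interiors of the domains. -/
noncomputable def Asters.canonicalSpaceMap (E : C.Asters) (hK : C.K.IsTame) (z : C.Sd) : X :=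
  C.φ _ (E.canonicalMap hK (C.exists_sal_φ_eq z).choose (C.exists_sal_φ_eq z).choose_spec.choose)

variable {E : C.Asters} (hK : C.K.IsTame) [∀ a b, LocallyCompactSpace (C.K.Hom a b)]

namespace IsCylNormal

/-- The axioms for the Salvetti complex, with the parameter spaces stratified by points, which serve
here only for their consequences that do not involve stratifications. -/
theorem sal (hK : C.K.IsTame) : C.K.salvetti.IsCylNormal
    (C.K.salvettiStrats fun m l => range (singleton : C.K.Hom m l → Set (C.K.Hom m l))) :=
  hK.isCylNormal_salvetti hK.isParStratification_singletons

theorem canonicalSpaceMap_φ (hT : C.IsCylNormal T) {l : C.L} (x : (C.K.repr l).Real) :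
    E.canonicalSpaceMap hK (C.K.salvetti.φ l x) = C.φ l (E.canonicalMap hK l x) := by
  have hS := sal hK
  have key : ∀ {m m' : C.L} {w : (C.K.repr m).Real} {w' : (C.K.repr m').Real},
      0 < (C.K.repr m).wt m w → 0 < (C.K.repr m').wt m' w' →
      C.K.salvetti.φ m w = C.K.salvetti.φ m' w' →
      C.φ m (E.canonicalMap hK m w) = C.φ m' (E.canonicalMap hK m' w') := by
    intro m m' w w' hw hw' h
    have hb := notMem_salvetti_bdry.2 hw
    have hb' := notMem_salvetti_bdry.2 hw'
    obtain rfl : m = m' := hS.eq_of_mem_str (hS.φ_mem_str hb) (h ▸ hS.φ_mem_str hb')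
    rw [hS.eq_of_φ_eq hb hb' h]
  obtain ⟨m, g, w, hw, rfl⟩ := exists_smul_eq x
  rw [hT.canonicalMap_smul, hT.φ_act]
  have h := (C.exists_sal_φ_eq (C.K.salvetti.φ l ((C.K.repr l).smul g w))).choose_spec.choose_spec
  exact key h.1 hw (h.2.trans (hS.φ_act m l g w))

/-- Locally, the map is the composite of the truncation at the last object, `z`, and the structure
map of the cell of that object. -/
theorem continuous_canonicalSpaceMap (hT : C.IsCylNormal T) :
    Continuous (E.canonicalSpaceMap hK) := by
  suffices h : Continuous (E.canonicalSpaceMap hK ∘ C.K.classifyingHomeo) by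
    have h' := h.comp C.K.classifyingHomeo.symm.continuous
    convert h' using 1
    funext z
    exact congrArg _ (C.K.classifyingHomeo.apply_symm_apply z).symm
  refine Realization.continuous_iff.2 fun n =>
    Chain.continuous_prod (M := C.K.trivialModule) fun o => ?_
  have h1 : Continuous (Y := (C.K.repr (o (Fin.last n))).Real)
      fun q : {p // C.K.trivialModule.IsChain o p} × stdSimplex ℝ (Fin (n + 1)) =>
      truncPt (ofFiber o q.1) (Fin.last n) q.2 :=
    continuousOn_univ.1 ((continuousOn_truncPt (M := C.K.trivialModule) o (Fin.last n)).mono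
      fun q _ => by
        obtain ⟨i, hi⟩ := stdSimplex.exists_pos q.2
        exact sum_initEmb_pos (Fin.le_last i) hi)
  refine ((hT.continuous_φ _).comp ((hT.continuous_canonicalMap (E := E) hK _).comp h1)).congr
    fun q => ?_
  refine (hT.canonicalSpaceMap_φ hK _).symm.trans (congrArg (E.canonicalSpaceMap hK) ?_)
  exact (salvetti_φ _).trans (congrArg C.K.classifyingHomeo (smul_truncPt (ofFiber o q.1)
    (Fin.last n) q.2 fun i hi => absurd hi (not_lt.2 (Fin.le_last i))))

theorem canonicalSpaceMap_injective (hT : C.IsCylNormal T) :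
    Function.Injective (E.canonicalSpaceMap hK) := by
  intro z z' h
  obtain ⟨m, w, hw, rfl⟩ := C.exists_sal_φ_eq z
  obtain ⟨m', w', hw', rfl⟩ := C.exists_sal_φ_eq z'
  rw [hT.canonicalSpaceMap_φ, hT.canonicalSpaceMap_φ] at h
  have hb := E.canonicalMap_notMem_bdry hK hw
  have hb' := E.canonicalMap_notMem_bdry hK hw'
  obtain rfl := hT.eq_of_mem_str (hT.φ_mem_str hb) (h ▸ hT.φ_mem_str hb')
  rw [hT.canonicalMap_injective hK m (hT.eq_of_φ_eq hb hb' h)]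

/-- Closedness of the image of a closed set is tested on the closures of the strata, and there on
the domains, where the preimage of the image is the image of a compact set. -/
theorem isClosedMap_canonicalSpaceMap (hT : C.IsCylNormal T) (hCW : C.IsCW)
    (hD : ∀ l, CompactSpace (C.K.repr l).Real) : IsClosedMap (E.canonicalSpaceMap hK) := by
  have hS := sal hK
  intro A hA
  refine hCW.2 _ fun l => ?_
  have : T2Space (C.D l) := (E.isEmbedding l).t2Space
  obtain ⟨h, hq⟩ := hT.quotient l
  have hB : IsClosed (C.φ l ⁻¹' (E.canonicalSpaceMap hK '' A)) := by
    have he : C.φ l ⁻¹' (E.canonicalSpaceMap hK '' A) =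
        E.canonicalMap hK l '' (C.K.salvetti.φ l ⁻¹' A) := by
      ext x
      constructor
      · rintro ⟨z, hz, hzx⟩
        obtain ⟨m, w, hw, rfl⟩ := C.exists_sal_φ_eq z
        rw [hT.canonicalSpaceMap_φ] at hzx
        obtain ⟨p, rfl⟩ := hT.exists_act_of_φ_eq (E.canonicalMap_notMem_bdry hK hw) hzx.symm
        refine ⟨(C.K.repr l).smul p w, ?_, hT.canonicalMap_smul hK p w⟩
        exact (congrArg (· ∈ A) (hS.φ_act m l p w)).mpr hz
      · rintro ⟨x, hx, rfl⟩
        exact ⟨_, hx, hT.canonicalSpaceMap_φ hK x⟩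
    rw [he]
    have : CompactSpace (C.K.salvetti.D l) := hD l
    exact ((hA.preimage (hS.continuous_φ l)).isCompact.image
      (hT.continuous_canonicalMap hK l)).isClosed
  have hB' : IsClosed
      (Subtype.val ⁻¹' (E.canonicalSpaceMap hK '' A) : Set (closure (C.str l))) := by
    rw [← hq.isClosed_preimage]
    exact hB
  have := isClosed_closure.isClosedEmbedding_subtypeVal.isClosedMap _ hB'
  rwa [Subtype.image_preimage_coe, inter_comm] at this

theorem canonicalSpaceMap_surjective (hT : C.IsCylNormal T) (hcl : C.AllCellsClosed E) :
    Function.Surjective (E.canonicalSpaceMap hK) := by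
  intro y
  obtain ⟨l, hl⟩ := hT.exists_mem_str y
  obtain ⟨x, rfl⟩ := hT.exists_φ_eq (subset_closure hl)
  obtain ⟨w, rfl⟩ := hT.canonicalMap_surjective hK hcl l x
  exact ⟨C.K.salvetti.φ l w, hT.canonicalSpaceMap_φ hK w⟩

variable (E) in
/-- The canonical morphism `i_X` from the Salvetti complex. -/
noncomputable def canonicalMorphism (hT : C.IsCylNormal T) : C.Sal.Morphism C (fun l => l) where
  map := E.canonicalSpaceMap hK
  dom := E.canonicalMap hK
  par p := p
  continuous_map := hT.continuous_canonicalSpaceMap hK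
  continuous_dom := hT.continuous_canonicalMap hK
  continuous_par _ _ := continuous_id
  monotone m l h := hT.le_of_hom m l ((sal hK).nonempty_hom h)
  map_str l z hz := by
    obtain ⟨x, hx, rfl⟩ := (congrArg (z ∈ ·) ((sal hK).image_interior l)).mpr hz
    exact (congrArg (· ∈ C.str l) (hT.canonicalSpaceMap_φ hK x)).mpr
      (hT.φ_mem_str (E.canonicalMap_notMem_bdry hK (notMem_salvetti_bdry.1 hx)))
  φ_dom l x := (hT.canonicalSpaceMap_φ hK x).symm
  dom_act m l p x := hT.canonicalMap_smul hK p x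

theorem isCanonical_canonicalMorphism (hT : C.IsCylNormal T) :
    C.IsCanonical E (hT.canonicalMorphism E hK) where
  par _ _ _ := rfl
  center l := E.canonicalMap_starCenter hK l
  radial l k u hu s t t' h0 h1 ht := by
    have h2 : t' = stdSimplex.segment ⟨s, h0, h1⟩ t := by
      ext i
      exact ht i
    have h3 := hK.radial_mkPt (v := u) hu ⟨s, h0, h1⟩ t
    rw [h2]
    refine (congrArg (fun x => E.ι l (E.canonicalMap hK l x)) h3).symm.trans ?_
    rw [E.canonicalMap_radial, E.ι_radial]
    rfl

theorem isEmbedding_canonicalMap (hT : C.IsCylNormal T) (l : C.L)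
    [CompactSpace (C.K.repr l).Real] : IsEmbedding (E.canonicalMap hK l) := by
  have : T2Space (C.D l) := (E.isEmbedding l).t2Space
  exact ((hT.continuous_canonicalMap hK l).isClosedEmbedding
    (hT.canonicalMap_injective hK l)).isEmbedding

theorem isHomeomorph_canonicalMap (hT : C.IsCylNormal T) (hcl : C.AllCellsClosed E) (l : C.L)
    [CompactSpace (C.K.repr l).Real] : IsHomeomorph (E.canonicalMap hK l) :=
  isHomeomorph_iff_isEmbedding_surjective.2
    ⟨hT.isEmbedding_canonicalMap hK l, hT.canonicalMap_surjective hK hcl l⟩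

theorem isEmbedding_canonicalMorphism (hT : C.IsCylNormal T) (hCW : C.IsCW)
    (hD : ∀ l, CompactSpace (C.K.repr l).Real) : (hT.canonicalMorphism E hK).IsEmbedding where
  map := (IsClosedEmbedding.of_continuous_injective_isClosedMap
    (hT.continuous_canonicalSpaceMap hK) (hT.canonicalSpaceMap_injective hK)
    (hT.isClosedMap_canonicalSpaceMap hK hCW hD)).isEmbedding
  injective := Function.injective_id
  le_of_le m l h := (sal hK).le_of_hom m l (hT.nonempty_hom h)
  dom l := have := hD l; hT.isEmbedding_canonicalMap hK l
  par _ _ := .id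

theorem isIso_canonicalMorphism (hT : C.IsCylNormal T) (hCW : C.IsCW)
    (hD : ∀ l, CompactSpace (C.K.repr l).Real) (hcl : C.AllCellsClosed E) :
    (hT.canonicalMorphism E hK).IsIso where
  map := isHomeomorph_iff_isEmbedding_surjective.2
    ⟨(hT.isEmbedding_canonicalMorphism hK hCW hD).map, hT.canonicalSpaceMap_surjective hK hcl⟩
  bijective := Function.bijective_id
  le_of_le := (hT.isEmbedding_canonicalMorphism hK hCW hD (E := E)).le_of_le
  dom l := have := hD l; hT.isHomeomorph_canonicalMap hK hcl l
  par _ _ := IsHomeomorph.id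

end IsCylNormal

end CylData

/-! ### Transport along homeomorphisms -/

theorem Homeomorph.isNormalStratification {Y Z : Type*} [TopologicalSpace Y] [TopologicalSpace Z]
    (f : Y ≃ₜ Z) {S : Set (Set Y)} (hS : IsNormalStratification S) :
    IsNormalStratification ((fun e => f '' e) '' S) := by
  obtain ⟨⟨h1, h2, h3⟩, h4⟩ := hS
  refine ⟨⟨?_, ?_, ?_⟩, ?_⟩
  · rintro _ ⟨e, he, rfl⟩
    exact ⟨(h1 e he).1.image f f.continuous.continuousOn,
      (h1 e he).2.image f.isInducing f.isClosedEmbedding.isClosed_range.isLocallyClosed⟩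
  · rintro _ ⟨e, he, rfl⟩ _ ⟨e', he', rfl⟩ hne
    exact (disjoint_image_iff f.injective).2 (h2 he he' fun h => hne (by rw [h]))
  · refine eq_univ_of_forall fun y => ?_
    obtain ⟨e, he, hx⟩ : f.symm y ∈ ⋃₀ S := h3 ▸ mem_univ _
    exact ⟨_, ⟨e, he, rfl⟩, _, hx, f.apply_symm_apply y⟩
  · rintro _ ⟨e, he, rfl⟩ _ ⟨e', he', rfl⟩ h
    simp only [← f.image_closure] at h ⊢
    rw [← image_inter f.injective] at h
    exact image_mono (h4 e he e' he' h.of_image)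

namespace CylData

variable {X Y : Type u} [TopologicalSpace X] [TopologicalSpace Y] {C : CylData X}
  {D' : C.L → Type u} [∀ l, TopologicalSpace (D' l)]

variable (C) in
/-- Transport of the data along homeomorphisms of the space and of the domains. -/
abbrev transport (Ψ : X ≃ₜ Y) (δ : ∀ l, C.D l ≃ₜ D' l) : CylData Y where
  L := C.L
  str l := Ψ '' C.str l
  K := C.K
  D := D'
  center l := δ l (C.center l)
  bdry l := δ l '' C.bdry l
  φ l x := Ψ (C.φ l ((δ l).symm x))
  act p x := δ _ (C.act p ((δ _).symm x))

variable (Ψ : X ≃ₜ Y) (δ : ∀ l, C.D l ≃ₜ D' l)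

/-- The stratifications of transported data. -/
abbrev Strats.transport (T : C.Strats) : (C.transport Ψ δ).Strats where
  par := T.par
  bd l := (fun e => (δ l).image (C.bdry l) '' e) '' T.bd l

/-- The asters of transported data. -/
def Asters.transport (E : C.Asters) : (C.transport Ψ δ).Asters where
  N := E.N
  ι l x := E.ι l ((δ l).symm x)
  isEmbedding l := (E.isEmbedding l).comp (δ l).symm.isEmbedding
  center l := (congrArg _ ((δ l).symm_apply_apply _)).trans (E.center l)
  norm_le l x := E.norm_le l _
  star l x s h0 h1 := by
    obtain ⟨y, hy⟩ := E.star l ((δ l).symm x) s h0 h1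
    exact ⟨δ l y, (congrArg _ ((δ l).symm_apply_apply _)).trans hy⟩
  mem_bdry l x := by
    refine Iff.trans ?_ (E.mem_bdry l _)
    exact ⟨fun ⟨y, hy, h⟩ => h ▸ ((δ l).symm_apply_apply y).symm ▸ hy,
      fun h => ⟨_, h, (δ l).apply_symm_apply x⟩⟩

variable {Ψ δ}

theorem compl_transport_bdry (l : C.L) :
    ((C.transport Ψ δ).bdry l)ᶜ = δ l '' (C.bdry l)ᶜ :=
  (image_compl_eq (δ l).bijective).symm

theorem symm_notMem_bdry {l : C.L} {x : D' l} (hx : x ∉ (C.transport Ψ δ).bdry l) :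
    (δ l).symm x ∉ C.bdry l := fun h => hx ⟨_, h, (δ l).apply_symm_apply x⟩

theorem image_val_image (l : C.L) (e : Set (C.bdry l)) :
    Subtype.val '' ((δ l).image (C.bdry l) '' e) = δ l '' (Subtype.val '' e) := by
  rw [image_image, image_image]
  rfl

theorem image2_act_image {m l : C.L} (P : Set (C.K.Hom m l)) (s : Set (C.D m)) :
    image2 ((C.transport Ψ δ).act (m := m) (l := l)) P (δ m '' s) =
      δ l '' image2 C.act P s := by
  ext z
  constructor
  · rintro ⟨p, hp, _, ⟨x, hx, rfl⟩, rfl⟩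
    refine ⟨_, ⟨p, hp, x, hx, rfl⟩, ?_⟩
    change _ = δ l (C.act p ((δ m).symm (δ m x)))
    rw [(δ m).symm_apply_apply]
  · rintro ⟨_, ⟨p, hp, x, hx, rfl⟩, rfl⟩
    refine ⟨p, hp, _, ⟨x, hx, rfl⟩, ?_⟩
    change δ l (C.act p ((δ m).symm (δ m x))) = _
    rw [(δ m).symm_apply_apply]

theorem IsCylNormal.transport {T : C.Strats} (hT : C.IsCylNormal T) :
    (C.transport Ψ δ).IsCylNormal (T.transport Ψ δ) := by
  have hcl : ∀ l, closure ((C.transport Ψ δ).str l) = Ψ '' closure (C.str l) := fun l =>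
    (Ψ.image_closure _).symm
  have hmem : ∀ l x, (C.transport Ψ δ).φ l x ∈ closure ((C.transport Ψ δ).str l) := fun l x => by
    rw [hcl]
    exact mem_image_of_mem _ (hT.φ_mem_closure l _)
  exact
  { connected := fun l => (hT.connected l).image _ Ψ.continuous.continuousOn
    locallyClosed := fun l => (hT.locallyClosed l).image Ψ.isInducing
      Ψ.isClosedEmbedding.isClosed_range.isLocallyClosed
    disjoint := fun m l h => (disjoint_image_iff Ψ.injective).2 (hT.disjoint m l h)
    cover := by
      refine eq_univ_of_forall fun y => ?_
      obtain ⟨l, hl⟩ := hT.exists_mem_str (Ψ.symm y)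
      exact mem_iUnion.2 ⟨l, _, hl, Ψ.apply_symm_apply y⟩
    normal := fun m l h => by
      rw [hcl] at h ⊢
      change (Ψ '' C.str m ∩ _).Nonempty at h
      rw [← image_inter Ψ.injective] at h
      exact image_mono (hT.normal m l h.of_image)
    quotient := fun l => by
      refine ⟨hmem l, ?_⟩
      obtain ⟨h, hq⟩ := hT.quotient l
      exact (((Ψ.image (closure (C.str l))).trans
        (Homeomorph.setCongr (hcl l).symm)).isQuotientMap.comp hq).comp (δ l).symm.isQuotientMap
    embedding_interior := fun l => by
      have h : IsEmbedding fun x : {x // x ∉ (C.transport Ψ δ).bdry l} =>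
          (⟨(δ l).symm x.1, symm_notMem_bdry x.2⟩ : {x // x ∉ C.bdry l}) :=
        ((δ l).symm.isEmbedding.comp (IsEmbedding.subtypeVal
          (p := fun x => x ∉ (C.transport Ψ δ).bdry l))).codRestrict {x | x ∉ C.bdry l}
          fun x => symm_notMem_bdry x.2
      exact Ψ.isEmbedding.comp ((hT.embedding_interior l).comp h)
    image_interior := fun l => by
      rw [compl_transport_bdry]
      change _ = Ψ '' C.str l
      rw [← hT.image_interior, image_image, image_image]
      refine image_congr fun x _ => ?_
      change Ψ (C.φ l ((δ l).symm (δ l x))) = _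
      rw [(δ l).symm_apply_apply]
    hom_self := hT.hom_self
    le_of_hom := fun m l h => by
      rw [hcl]
      exact image_mono (hT.le_of_hom m l h)
    par_strat := hT.par_strat
    bd_strat := fun l => ((δ l).image (C.bdry l)).isNormalStratification (hT.bd_strat l)
    continuous_act := fun m l => (δ l).continuous.comp ((hT.continuous_act m l).comp
      (continuous_fst.prodMk ((δ m).symm.continuous.comp continuous_snd)))
    act_interior := fun m l h P hP => by
      obtain ⟨e, he, h'⟩ := hT.act_interior m l h P hP
      refine ⟨_, ⟨e, he, rfl⟩, (image_val_image (C := C) (δ := δ) l e).trans ?_⟩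
      rw [h', compl_transport_bdry]
      exact (image2_act_image (Ψ := Ψ) (δ := δ) P _).symm
    act_boundary := by
      rintro m l h P hP _ ⟨e', he', rfl⟩
      obtain ⟨e, he, h'⟩ := hT.act_boundary m l h P hP e' he'
      refine ⟨_, ⟨e, he, rfl⟩, (image_val_image (C := C) (δ := δ) l e).trans ?_⟩
      rw [h']
      exact (image2_act_image (Ψ := Ψ) (δ := δ) P _).symm.trans (congrArg
        (image2 ((C.transport Ψ δ).act (m := m) (l := l)) P)
        (image_val_image (C := C) (δ := δ) m e').symm)
    comp_strict := hT.comp_strict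
    embedding_act := fun m l hml => by
      have h : IsEmbedding fun x : {x // x ∉ (C.transport Ψ δ).bdry m} =>
          (⟨(δ m).symm x.1, symm_notMem_bdry x.2⟩ : {x // x ∉ C.bdry m}) :=
        ((δ m).symm.isEmbedding.comp (IsEmbedding.subtypeVal
          (p := fun x => x ∉ (C.transport Ψ δ).bdry m))).codRestrict {x | x ∉ C.bdry m}
          fun x => symm_notMem_bdry x.2
      exact (δ l).isEmbedding.comp ((hT.embedding_act m l hml).comp
        ((IsEmbedding.id (X := C.K.Hom m l)).prodMap h))
    φ_act := fun m l p x => by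
      change Ψ (C.φ l ((δ l).symm (δ l (C.act p ((δ m).symm x))))) = _
      rw [(δ l).symm_apply_apply, hT.φ_act]
    act_comp := fun a b c q p x => by
      change δ c _ = δ c (C.act q ((δ b).symm (δ b (C.act p ((δ a).symm x)))))
      rw [(δ b).symm_apply_apply, ← hT.act_comp]
    act_one := fun l x => by
      change δ l (C.act (C.K.one l) _) = x
      rw [hT.act_one, (δ l).apply_symm_apply]
    bdry_eq := fun l => by
      change δ l '' C.bdry l = _
      rw [hT.bdry_eq, image_iUnion₂]
      refine iUnion₂_congr fun m _ => ?_
      rw [compl_transport_bdry]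
      exact (image2_act_image (Ψ := Ψ) (δ := δ) _ _).symm }

/-- Transport does not change the inclusion of the boundary into the sphere, so the conditions on
stellar cells carry over without change. -/
theorem Asters.toSphere_transport (E : C.Asters) (l : C.L) (x : C.bdry l) :
    (E.transport Ψ δ).toSphere l ((δ l).image (C.bdry l) x) = E.toSphere l x :=
  Subtype.ext (congrArg (E.ι l) ((δ l).symm_apply_apply x.1))

theorem Asters.toSphere_transport_image (E : C.Asters) (l : C.L) (e : Set (C.bdry l)) :
    (E.transport Ψ δ).toSphere l '' ((δ l).image (C.bdry l) '' e) = E.toSphere l '' e := by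
  rw [image_image]
  exact image_congr fun x _ => E.toSphere_transport l x

theorem Asters.range_toSphere_transport (E : C.Asters) (l : C.L) :
    range ((E.transport Ψ δ).toSphere l) = range (E.toSphere l) := by
  have := E.toSphere_transport_image (Ψ := Ψ) (δ := δ) l univ
  rw [image_univ, image_univ, ((δ l).image (C.bdry l)).range_coe] at this
  rw [← this]
  exact image_univ.symm

theorem IsCylNormalStellar.transport {E : C.Asters} (h : C.IsCylNormalStellar E) :
    (C.transport Ψ δ).IsCylNormalStellar (E.transport Ψ δ) := by
  obtain ⟨T, hT, dim, hd, hs⟩ := h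
  refine ⟨T.transport Ψ δ, hT.transport, dim, fun l => ?_, fun l => ?_⟩
  · change closure (Ψ '' C.str l) \ Ψ '' C.str l ⊆ ⋃ m ∈ {m | dim m < dim l}, Ψ '' C.str m
    rw [← Ψ.image_closure, ← image_sdiff Ψ.injective, ← image_iUnion₂]
    exact image_mono (hd l)
  · obtain ⟨⟨S, hS, hS'⟩, S₁, d, h1, h2, h3, h4, h5⟩ := hs l
    refine ⟨⟨S, hS, ?_⟩, S₁, d, h1, ?_⟩
    · rintro _ ⟨e, he, rfl⟩
      exact (E.toSphere_transport_image (Ψ := Ψ) (δ := δ) l e).symm ▸ hS' e he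
    · have hr := E.range_toSphere_transport (Ψ := Ψ) (δ := δ) l
      have hb : (fun e => (E.transport Ψ δ).toSphere l '' e) '' (T.transport Ψ δ).bd l =
          (fun e => E.toSphere l '' e) '' T.bd l := by
        refine (image_image _ _ _).trans (image_congr fun e _ => ?_)
        exact E.toSphere_transport_image (Ψ := Ψ) (δ := δ) l e
      rw [hr, hb]
      exact ⟨h2, h3, h4, h5⟩

end CylData

/-! ### Reversal of chains and the stellar dual -/

/-- The order embedding obtained by conjugation with the reversals. -/
def Fin.revEmb {m n : ℕ} (θ : Fin (m + 1) ↪o Fin (n + 1)) : Fin (m + 1) ↪o Fin (n + 1) :=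
  OrderEmbedding.ofStrictMono (fun i => (θ i.rev).rev) fun _ _ h =>
    Fin.rev_lt_rev.2 (θ.strictMono (Fin.rev_lt_rev.2 h))

theorem Fin.revEmb_apply {m n : ℕ} (θ : Fin (m + 1) ↪o Fin (n + 1)) (i : Fin (m + 1)) :
    Fin.revEmb θ i = (θ i.rev).rev := rfl

theorem Fin.revEmb_revEmb {m n : ℕ} (θ : Fin (m + 1) ↪o Fin (n + 1)) :
    Fin.revEmb (Fin.revEmb θ) = θ := by
  ext i
  simp only [Fin.revEmb_apply, Fin.rev_rev]

theorem stdSimplex.map_rev_map_rev {n : ℕ} (t : stdSimplex ℝ (Fin (n + 1))) :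
    stdSimplex.map Fin.rev (stdSimplex.map Fin.rev t) = t := by
  ext i
  have h := stdSimplex.map_apply_of_injective Fin.rev_injective
    (stdSimplex.map Fin.rev t) i.rev
  rw [Fin.rev_rev] at h
  exact h.trans (stdSimplex.map_apply_of_injective Fin.rev_injective t i)

theorem stdSimplex.map_rev_map {m n : ℕ} (θ : Fin (m + 1) ↪o Fin (n + 1))
    (t : stdSimplex ℝ (Fin (m + 1))) :
    stdSimplex.map Fin.rev (stdSimplex.map θ t) =
      stdSimplex.map (Fin.revEmb θ) (stdSimplex.map Fin.rev t) := by
  have h : Fin.rev ∘ (θ : Fin (m + 1) → Fin (n + 1)) = Fin.revEmb θ ∘ Fin.rev := by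
    funext i
    simp [Fin.revEmb_apply]
  refine (stdSimplex.map_comp_apply (θ : Fin (m + 1) → Fin (n + 1)) Fin.rev t).trans ?_
  rw [h]
  exact (stdSimplex.map_comp_apply Fin.rev (Fin.revEmb θ : Fin (m + 1) → Fin (n + 1)) t).symm

section Realization

variable {F G : ℕ → Type u} {r : ∀ {m n : ℕ}, (Fin (m + 1) ↪o Fin (n + 1)) → F n → F m}
  {s : ∀ {m n : ℕ}, (Fin (m + 1) ↪o Fin (n + 1)) → G n → G m}

/-- The map of realizations induced by a family of maps that reverse the order of vertices. -/
noncomputable def Realization.revMap (e : ∀ n, F n → G n)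
    (he : ∀ {m n : ℕ} (θ : Fin (m + 1) ↪o Fin (n + 1)) (x : F n),
      e m (r θ x) = s (Fin.revEmb θ) (e n x)) : Realization F r → Realization G s :=
  Quot.map (fun y => ⟨y.1, (e y.1 y.2.1, stdSimplex.map Fin.rev y.2.2)⟩) (by
    rintro _ _ ⟨θ, x, t⟩
    simp only [he, stdSimplex.map_rev_map]
    exact RealizationRel.face _ (e _ x) _)

variable [∀ n, TopologicalSpace (F n)] [∀ n, TopologicalSpace (G n)]

theorem Realization.continuous_revMap {e : ∀ n, F n → G n}
    {he : ∀ {m n : ℕ} (θ : Fin (m + 1) ↪o Fin (n + 1)) (x : F n),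
      e m (r θ x) = s (Fin.revEmb θ) (e n x)} (hc : ∀ n, Continuous (e n)) :
    Continuous (Realization.revMap (r := r) (s := s) e @he) := by
  refine continuous_quot_lift _ (continuous_sigma fun n => ?_)
  have h : Continuous fun p : F n × stdSimplex ℝ (Fin (n + 1)) =>
      (⟨n, (e n p.1, stdSimplex.map Fin.rev p.2)⟩ :
        Σ n, G n × stdSimplex ℝ (Fin (n + 1))) :=
    continuous_sigmaMk.comp (((hc n).comp continuous_fst).prodMk
      ((stdSimplex.continuous_map Fin.rev).comp continuous_snd))
  exact continuous_quot_mk.comp h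

/-- Order-reversing homeomorphisms of the spaces of simplices induce a homeomorphism of the
realizations. -/
noncomputable def Realization.revHomeo (e : ∀ n, F n ≃ₜ G n)
    (he : ∀ {m n : ℕ} (θ : Fin (m + 1) ↪o Fin (n + 1)) (x : F n),
      e m (r θ x) = s (Fin.revEmb θ) (e n x)) : Realization F r ≃ₜ Realization G s where
  toFun := Realization.revMap (fun n => e n) he
  invFun := Realization.revMap (fun n => (e n).symm) fun {m n} θ y => by
    rw [Homeomorph.symm_apply_eq, he, Fin.revEmb_revEmb, (e n).apply_symm_apply]
  left_inv x := by
    obtain ⟨n, u, t, -, rfl⟩ := Realization.exists_pos x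
    change Realization.mk r ((e n).symm (e n u)) (stdSimplex.map Fin.rev (stdSimplex.map Fin.rev t))
      = _
    rw [(e n).symm_apply_apply, stdSimplex.map_rev_map_rev]
  right_inv x := by
    obtain ⟨n, u, t, -, rfl⟩ := Realization.exists_pos x
    change Realization.mk s (e n ((e n).symm u)) (stdSimplex.map Fin.rev (stdSimplex.map Fin.rev t))
      = _
    rw [(e n).apply_symm_apply, stdSimplex.map_rev_map_rev]
  continuous_toFun := Realization.continuous_revMap fun n => (e n).continuous
  continuous_invFun := Realization.continuous_revMap fun n => (e n).symm.continuous

end Realization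

namespace TopEnrichedCat

variable {L : Type u} (K : TopEnrichedCat L)

variable {K} in
/-- The chain of the opposite category obtained by pulling back along an order-reversing map. -/
def nerveAnti {m n : ℕ} (ρ : Fin (m + 1) → Fin (n + 1)) (hρ : StrictAnti ρ) (x : K.Nerve n) :
    K.op.Nerve m :=
  ⟨⟨x.1.1 ∘ ρ, fun ij => x.1.2 ⟨(ρ ij.1.2, ρ ij.1.1), hρ ij.2⟩⟩,
    x.2.1.comp hρ.injective, fun _ _ _ h h' => x.2.2 _ _ _ (hρ h') (hρ h)⟩

theorem nerveRev_nerveFace {m n : ℕ} (θ : Fin (m + 1) ↪o Fin (n + 1)) (x : K.Nerve n) :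
    K.nerveRev (K.nerveFace θ x) = K.op.nerveFace (Fin.revEmb θ) (K.nerveRev x) := by
  -- Both sides are pullbacks along the same order-reversing map, up to propositional equality.
  have h : ∀ (ρ ρ' : Fin (m + 1) → Fin (n + 1)) (hρ : StrictAnti ρ) (hρ' : StrictAnti ρ'),
      ρ = ρ' → nerveAnti ρ hρ x = nerveAnti ρ' hρ' x := by
    rintro ρ _ hρ hρ' rfl
    rfl
  exact h (fun i => θ i.rev) (fun i => (Fin.revEmb θ i).rev)
    (fun _ _ h => θ.strictMono (Fin.rev_lt_rev.2 h))
    (fun _ _ h => Fin.rev_lt_rev.2 ((Fin.revEmb θ).strictMono h))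
    (funext fun i => by rw [Fin.revEmb_apply, Fin.rev_rev])

theorem nerveRev_nerveRev {n : ℕ} (x : K.Nerve n) : K.op.nerveRev (K.nerveRev x) = x := by
  have h : ∀ θ θ' : Fin (n + 1) ↪o Fin (n + 1), θ = θ' → K.nerveFace θ x = K.nerveFace θ' x := by
    rintro θ _ rfl
    rfl
  exact h (Fin.revEmb (RelEmbedding.refl _)) (RelEmbedding.refl _)
    (by ext i; simp [Fin.revEmb_apply])

theorem continuous_nerveRev (n : ℕ) : Continuous (K.nerveRev (k := n)) := by
  refine continuous_induced_rng.2 ?_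
  have h : Continuous fun x : Σ o : Fin (n + 1) → L, ∀ ij : EdgeIdx n,
      K.Hom (o ij.1.1) (o ij.1.2) =>
      (⟨x.1 ∘ Fin.rev,
        fun ij : EdgeIdx n => x.2 ⟨(ij.1.2.rev, ij.1.1.rev), Fin.rev_lt_rev.2 ij.2⟩⟩ :
        Σ o : Fin (n + 1) → L, ∀ ij : EdgeIdx n, K.op.Hom (o ij.1.1) (o ij.1.2)) := by
    refine continuous_sigma fun o => ?_
    have h1 : Continuous fun x : (∀ ij : EdgeIdx n, K.Hom (o ij.1.1) (o ij.1.2)) =>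
        (fun ij : EdgeIdx n => x ⟨(ij.1.2.rev, ij.1.1.rev), Fin.rev_lt_rev.2 ij.2⟩ :
          ∀ ij : EdgeIdx n, K.op.Hom (o ij.1.1.rev) (o ij.1.2.rev)) :=
      continuous_pi fun ij => continuous_apply (A := fun ij : EdgeIdx n =>
        K.Hom (o ij.1.1) (o ij.1.2)) ⟨(ij.1.2.rev, ij.1.1.rev), Fin.rev_lt_rev.2 ij.2⟩
    exact (continuous_sigmaMk (σ := fun o : Fin (n + 1) → L =>
      ∀ ij : EdgeIdx n, K.op.Hom (o ij.1.1) (o ij.1.2)) (i := o ∘ Fin.rev)).comp h1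
  exact h.comp continuous_subtype_val

/-- Reversal of chains, as a homeomorphism of spaces of chains. -/
def nerveRevHomeo (n : ℕ) : K.Nerve n ≃ₜ K.op.Nerve n where
  toFun := K.nerveRev
  invFun := K.op.nerveRev
  left_inv := K.nerveRev_nerveRev
  right_inv := K.op.nerveRev_nerveRev
  continuous_toFun := K.continuous_nerveRev n
  continuous_invFun := K.op.continuous_nerveRev n

/-- The classifying spaces of a category and of its opposite are homeomorphic by reversal of
chains. -/
noncomputable def classifyingRev : K.Classifying ≃ₜ K.op.Classifying :=
  Realization.revHomeo K.nerveRevHomeo K.nerveRev_nerveFace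

variable {K} in
/-- The reversal of a chain over `l`, a chain of the upper star of the opposite category. -/
def lowerRev {l : L} {n : ℕ} (x : K.LowerStar l n) : K.op.UpperStar l n :=
  ⟨⟨x.1.1 ∘ Fin.rev, fun ij => x.1.2.1 ⟨(ij.1.2.rev, ij.1.1.rev), Fin.rev_lt_rev.2 ij.2⟩,
      fun i => x.1.2.2 i.rev⟩,
    ⟨x.2.1.1.comp Fin.rev_injective,
      fun _ _ _ h h' => x.2.1.2 _ _ _ (Fin.rev_lt_rev.2 h') (Fin.rev_lt_rev.2 h)⟩,
    fun ij => x.2.2 ⟨(ij.1.2.rev, ij.1.1.rev), Fin.rev_lt_rev.2 ij.2⟩⟩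

variable {K} in
/-- The reversed chain of the lower star, for a chain of the upper star of the opposite
category. -/
def upperRev {l : L} {n : ℕ} (x : K.op.UpperStar l n) : K.LowerStar l n :=
  ⟨⟨x.1.1 ∘ Fin.rev, fun ij => x.1.2.1 ⟨(ij.1.2.rev, ij.1.1.rev), Fin.rev_lt_rev.2 ij.2⟩,
      fun i => x.1.2.2 i.rev⟩,
    ⟨x.2.1.1.comp Fin.rev_injective,
      fun _ _ _ h h' => x.2.1.2 _ _ _ (Fin.rev_lt_rev.2 h') (Fin.rev_lt_rev.2 h)⟩,
    fun ij => x.2.2 ⟨(ij.1.2.rev, ij.1.1.rev), Fin.rev_lt_rev.2 ij.2⟩⟩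

variable {K} in
/-- The chain of the upper star of the opposite category obtained by pulling back along an
order-reversing map. -/
def lowerAnti {l : L} {m n : ℕ} (ρ : Fin (m + 1) → Fin (n + 1)) (hρ : StrictAnti ρ)
    (x : K.LowerStar l n) : K.op.UpperStar l m :=
  ⟨⟨x.1.1 ∘ ρ, fun ij => x.1.2.1 ⟨(ρ ij.1.2, ρ ij.1.1), hρ ij.2⟩, fun i => x.1.2.2 (ρ i)⟩,
    ⟨x.2.1.1.comp hρ.injective, fun _ _ _ h h' => x.2.1.2 _ _ _ (hρ h') (hρ h)⟩,
    fun ij => x.2.2 ⟨(ρ ij.1.2, ρ ij.1.1), hρ ij.2⟩⟩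

theorem lowerRev_lowerFace {l : L} {m n : ℕ} (θ : Fin (m + 1) ↪o Fin (n + 1))
    (x : K.LowerStar l n) :
    lowerRev (K.lowerFace l θ x) = K.op.upperFace l (Fin.revEmb θ) (lowerRev x) := by
  have h : ∀ (ρ ρ' : Fin (m + 1) → Fin (n + 1)) (hρ : StrictAnti ρ) (hρ' : StrictAnti ρ'),
      ρ = ρ' → lowerAnti ρ hρ x = lowerAnti ρ' hρ' x := by
    rintro ρ _ hρ hρ' rfl
    rfl
  exact h (fun i => θ i.rev) (fun i => (Fin.revEmb θ i).rev)
    (fun _ _ h => θ.strictMono (Fin.rev_lt_rev.2 h))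
    (fun _ _ h => Fin.rev_lt_rev.2 ((Fin.revEmb θ).strictMono h))
    (funext fun i => by rw [Fin.revEmb_apply, Fin.rev_rev])

/-- Reversal of chains over `l`, as a homeomorphism of spaces of chains. -/
def lowerRevHomeo (l : L) (n : ℕ) : K.LowerStar l n ≃ₜ K.op.UpperStar l n where
  toFun := lowerRev
  invFun := upperRev
  left_inv x := by
    have h : ∀ θ θ' : Fin (n + 1) ↪o Fin (n + 1), θ = θ' →
        K.lowerFace l θ x = K.lowerFace l θ' x := by
      rintro θ _ rfl
      rfl
    exact h (Fin.revEmb (RelEmbedding.refl _)) (RelEmbedding.refl _)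
      (by ext i; simp [Fin.revEmb_apply])
  right_inv x := by
    have h : ∀ θ θ' : Fin (n + 1) ↪o Fin (n + 1), θ = θ' →
        K.op.upperFace l θ x = K.op.upperFace l θ' x := by
      rintro θ _ rfl
      rfl
    exact h (Fin.revEmb (RelEmbedding.refl _)) (RelEmbedding.refl _)
      (by ext i; simp [Fin.revEmb_apply])
  continuous_toFun := by
    refine continuous_induced_rng.2 ?_
    have h : Continuous fun x : Σ o : Fin (n + 1) → L,
        (∀ ij : EdgeIdx n, K.Hom (o ij.1.1) (o ij.1.2)) × (∀ i, K.Hom (o i) l) =>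
        (⟨x.1 ∘ Fin.rev,
          fun ij : EdgeIdx n => x.2.1 ⟨(ij.1.2.rev, ij.1.1.rev), Fin.rev_lt_rev.2 ij.2⟩,
          fun i => x.2.2 i.rev⟩ : Σ o : Fin (n + 1) → L,
          (∀ ij : EdgeIdx n, K.op.Hom (o ij.1.1) (o ij.1.2)) × (∀ i, K.op.Hom l (o i))) := by
      refine continuous_sigma fun o => ?_
      have h1 : Continuous fun x : (∀ ij : EdgeIdx n, K.Hom (o ij.1.1) (o ij.1.2)) ×
          (∀ i, K.Hom (o i) l) =>
          ((fun ij : EdgeIdx n => x.1 ⟨(ij.1.2.rev, ij.1.1.rev), Fin.rev_lt_rev.2 ij.2⟩,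
            fun i => x.2 i.rev) : (∀ ij : EdgeIdx n, K.op.Hom (o ij.1.1.rev) (o ij.1.2.rev)) ×
              (∀ i : Fin (n + 1), K.op.Hom l (o i.rev))) :=
        (continuous_pi fun ij => (continuous_apply (A := fun ij : EdgeIdx n =>
          K.Hom (o ij.1.1) (o ij.1.2)) ⟨(ij.1.2.rev, ij.1.1.rev), Fin.rev_lt_rev.2 ij.2⟩).comp
          continuous_fst).prodMk
        (continuous_pi fun i => (continuous_apply (A := fun i => K.Hom (o i) l)
          i.rev).comp continuous_snd)
      exact (continuous_sigmaMk (σ := fun o : Fin (n + 1) → L =>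
        (∀ ij : EdgeIdx n, K.op.Hom (o ij.1.1) (o ij.1.2)) × (∀ i, K.op.Hom l (o i)))
        (i := o ∘ Fin.rev)).comp h1
    exact h.comp continuous_subtype_val
  continuous_invFun := by
    refine continuous_induced_rng.2 ?_
    have h : Continuous fun x : Σ o : Fin (n + 1) → L,
        (∀ ij : EdgeIdx n, K.op.Hom (o ij.1.1) (o ij.1.2)) × (∀ i, K.op.Hom l (o i)) =>
        (⟨x.1 ∘ Fin.rev,
          fun ij : EdgeIdx n => x.2.1 ⟨(ij.1.2.rev, ij.1.1.rev), Fin.rev_lt_rev.2 ij.2⟩,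
          fun i => x.2.2 i.rev⟩ : Σ o : Fin (n + 1) → L,
          (∀ ij : EdgeIdx n, K.Hom (o ij.1.1) (o ij.1.2)) × (∀ i, K.Hom (o i) l)) := by
      refine continuous_sigma fun o => ?_
      have h1 : Continuous fun x : (∀ ij : EdgeIdx n, K.op.Hom (o ij.1.1) (o ij.1.2)) ×
          (∀ i, K.op.Hom l (o i)) =>
          ((fun ij : EdgeIdx n => x.1 ⟨(ij.1.2.rev, ij.1.1.rev), Fin.rev_lt_rev.2 ij.2⟩,
            fun i => x.2 i.rev) : (∀ ij : EdgeIdx n, K.Hom (o ij.1.1.rev) (o ij.1.2.rev)) ×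
              (∀ i : Fin (n + 1), K.Hom (o i.rev) l)) :=
        (continuous_pi fun ij => (continuous_apply (A := fun ij : EdgeIdx n =>
          K.op.Hom (o ij.1.1) (o ij.1.2)) ⟨(ij.1.2.rev, ij.1.1.rev), Fin.rev_lt_rev.2 ij.2⟩).comp
          continuous_fst).prodMk
        (continuous_pi fun i => (continuous_apply (A := fun i => K.op.Hom l (o i))
          i.rev).comp continuous_snd)
      exact (continuous_sigmaMk (σ := fun o : Fin (n + 1) → L =>
        (∀ ij : EdgeIdx n, K.Hom (o ij.1.1) (o ij.1.2)) × (∀ i, K.Hom (o i) l))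
        (i := o ∘ Fin.rev)).comp h1
    exact h.comp continuous_subtype_val

/-- The lower star of `l` is homeomorphic to its upper star in the opposite category. -/
noncomputable def realRev (l : L) : K.RealLower l ≃ₜ K.op.RealUpper l :=
  Realization.revHomeo (K.lowerRevHomeo l) K.lowerRev_lowerFace

end TopEnrichedCat

namespace CylData

variable {X : Type u} [TopologicalSpace X] (C : CylData X)

/-- The strata of the stellar dual are those of the Salvetti complex of the opposite category. -/
theorem dual_str (l : C.L) :
    C.dual.str l = C.K.op.classifyingRev '' C.K.op.salvetti.str l := by
  ext z
  constructor
  · rintro ⟨k, u, t, ht, hl, rfl⟩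
    refine ⟨C.K.op.pt (C.K.nerveRev u) (stdSimplex.map Fin.rev t),
      ⟨k, _, _, fun i => ?_, ?_, rfl⟩, ?_⟩
    · rw [← Fin.rev_rev i]
      exact (stdSimplex.map_apply_of_injective Fin.rev_injective t i.rev).symm ▸ ht _
    · exact (congrArg u.1.1 (Fin.rev_last k)).trans hl
    · change C.K.pt (C.K.op.nerveRev (C.K.nerveRev u))
        (stdSimplex.map Fin.rev (stdSimplex.map Fin.rev t)) = _
      rw [C.K.nerveRev_nerveRev, stdSimplex.map_rev_map_rev]
  · rintro ⟨_, ⟨k, u, t, ht, hl, rfl⟩, rfl⟩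
    refine ⟨k, C.K.op.nerveRev u, stdSimplex.map Fin.rev t, fun i => ?_, ?_, rfl⟩
    · rw [← Fin.rev_rev i]
      exact (stdSimplex.map_apply_of_injective Fin.rev_injective t i.rev).symm ▸ ht _
    · exact (congrArg u.1.1 (Fin.rev_zero k)).trans hl

theorem dual_center (l : C.L) :
    C.dual.center l = C.K.op.realRev l (C.K.op.salvetti.center l) := by
  have h : (stdSimplex.vertex 0 : stdSimplex ℝ (Fin 1)) =
      stdSimplex.map Fin.rev (stdSimplex.vertex 0) := by
    have hs : ∀ t : stdSimplex ℝ (Fin 1), t 0 = 1 := fun t => by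
      have := stdSimplex.sum_eq_one t
      rwa [Fin.sum_univ_one] at this
    ext i
    rw [Subsingleton.elim i 0]
    exact (hs _).trans (hs _).symm
  exact congrArg (Realization.mk (C.K.upperFace l) (n := 0) _) h

theorem dual_bdry (l : C.L) :
    C.dual.bdry l = C.K.op.realRev l '' C.K.op.salvetti.bdry l := by
  ext z
  constructor
  · rintro ⟨k, u, t, hu, rfl⟩
    refine ⟨(C.K.op.realRev l).symm (Realization.mk (C.K.upperFace l) u t),
      ⟨k, TopEnrichedCat.upperRev (K := C.K.op) u, stdSimplex.map Fin.rev t,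
        fun i => hu _, rfl⟩, (C.K.op.realRev l).apply_symm_apply _⟩
  · rintro ⟨_, ⟨k, u, t, hu, rfl⟩, rfl⟩
    exact ⟨k, TopEnrichedCat.lowerRev u, stdSimplex.map Fin.rev t, fun i => hu _, rfl⟩

theorem dual_φ (l : C.L) (x : C.K.op.RealLower l) :
    C.dual.φ l (C.K.op.realRev l x) = C.K.op.classifyingRev (C.K.op.salvetti.φ l x) := by
  obtain ⟨n, u, t, -, rfl⟩ := Realization.exists_pos x
  rfl

theorem dual_act {m l : C.L} (p : C.K.op.Hom m l) (x : C.K.op.RealLower m) :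
    C.dual.act (m := m) (l := l) p (C.K.op.realRev m x) =
      C.K.op.realRev l (C.K.op.salvetti.act (m := m) (l := l) p x) := by
  obtain ⟨n, u, t, -, rfl⟩ := Realization.exists_pos x
  rfl

/-- The stellar dual is the Salvetti complex of the opposite category, up to reversal of chains. -/
theorem dual_eq_transport : C.dual =
    C.K.op.salvetti.transport (D' := fun l => C.K.RealUpper l) C.K.op.classifyingRev
      (fun l => C.K.op.realRev l) := by
  -- The two structures share their index sets, categories and domains, so the fields that remain can
  -- be compared pointwise.
  have ext : ∀ {L : Type u} {K : TopEnrichedCat L} {D : L → Type u}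
      [∀ l, TopologicalSpace (D l)] {str str' : L → Set C.Sd} {center center' : ∀ l, D l}
      {bdry bdry' : ∀ l, Set (D l)} {φ φ' : ∀ l, D l → C.Sd}
      {act act' : ∀ {m l}, K.Hom m l → D m → D l},
      (∀ l, str l = str' l) → (∀ l, center l = center' l) → (∀ l, bdry l = bdry' l) →
      (∀ l x, φ l x = φ' l x) → (∀ m l (p : K.Hom m l) x, act p x = act' p x) →
      (⟨L, str, K, D, center, bdry, φ, act⟩ : CylData C.Sd) =
        ⟨L, str', K, D, center', bdry', φ', act'⟩ := by
    intro L K D _ str str' center center' bdry bdry' φ φ' act act' h1 h2 h3 h4 h5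
    obtain rfl := funext h1
    obtain rfl := funext h2
    obtain rfl := funext h3
    obtain rfl : φ = φ' := funext fun l => funext (h4 l)
    obtain rfl : @act = @act' := by
      funext m l p x
      exact h5 m l p x
    rfl
  refine ext C.dual_str C.dual_center C.dual_bdry (fun l x => ?_) fun m l p x => ?_
  · rw [← C.dual_φ]
    exact congrArg _ ((C.K.op.realRev l).apply_symm_apply x).symm
  · exact (congrArg _ ((C.K.op.realRev m).apply_symm_apply x).symm).trans (C.dual_act p _)

theorem dual_dual_eq_transport : C.dual.dual =
    C.K.salvetti.transport (D' := fun l : C.L => C.K.op.RealUpper l) C.K.classifyingRev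
      (fun l => C.K.realRev l) :=
  C.dual.dual_eq_transport

theorem dual_dual_str (l : C.L) :
    C.dual.dual.str l = C.K.classifyingRev '' C.K.salvetti.str l :=
  C.dual.dual_str l

theorem dual_dual_str_subset_closure_iff (m l : C.L) :
    C.dual.dual.str m ⊆ closure (C.dual.dual.str l) ↔
      C.K.salvetti.str m ⊆ closure (C.K.salvetti.str l) := by
  have h : ∀ A B : Set C.K.Classifying,
      C.K.classifyingRev '' A ⊆ closure (C.K.classifyingRev '' B) ↔ A ⊆ closure B := by
    intro A B
    rw [← C.K.classifyingRev.image_closure, image_subset_image_iff C.K.classifyingRev.injective]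
  exact (C.dual_dual_str m).symm ▸ (C.dual_dual_str l).symm ▸ h _ _

theorem isHomeomorph_realRev (l : C.L) : IsHomeomorph (C.K.realRev l) :=
  (C.K.realRev l).isHomeomorph

theorem mapsTo_classifyingRev (l : C.L) :
    MapsTo C.K.classifyingRev (C.K.salvetti.str l) (C.dual.dual.str l) := fun _ hz =>
  (C.dual_dual_str l).symm ▸ mem_image_of_mem _ hz

/-- Reversal of chains as a morphism from the Salvetti complex to the double dual. -/
noncomputable def dualDualMorphism : C.Sal.Morphism C.dual.dual (fun l => l) where
  map := C.K.classifyingRev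
  dom (l : C.L) := (C.K.realRev l : C.K.RealLower l → C.K.op.RealUpper l)
  par p := p
  continuous_map := C.K.classifyingRev.continuous
  continuous_dom (l : C.L) := (C.isHomeomorph_realRev l).continuous
  continuous_par _ _ := continuous_id
  monotone (m l : C.L) h := (C.dual_dual_str_subset_closure_iff m l).2 h
  map_str (l : C.L) := C.mapsTo_classifyingRev l
  φ_dom (l : C.L) x := C.dual.dual_φ l x
  dom_act _ _ p x := (C.dual.dual_act p x).symm

theorem isIso_dualDualMorphism : C.dualDualMorphism.IsIso where
  map := C.K.classifyingRev.isHomeomorph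
  bijective := Function.bijective_id
  le_of_le (m l : C.L) h := (C.dual_dual_str_subset_closure_iff m l).1 h
  dom (l : C.L) := C.isHomeomorph_realRev l
  par _ _ := IsHomeomorph.id

end CylData

/-! ### The four assertions -/

namespace CylData.IsCylNormal

variable {X : Type u} [TopologicalSpace X] {C : CylData X} {T : C.Strats} {E : C.Asters}

theorem exists_isCylNormalStellar_sal (hT : C.IsCylNormal T) (hK : C.K.IsTame) (E : C.Asters)
    [∀ m l, CompactSpace (C.K.Hom m l)] (hl : ∀ l, {a | Nonempty (C.K.Hom a l)}.Finite) :
    ∃ E' : C.Sal.Asters, C.Sal.IsCylNormalStellar E' :=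
  have := hK.t2Space_hom
  ⟨hK.asters hl, hK.isCylNormalStellar hl (hT.isParStratification E)⟩

theorem exists_isCylNormalStellar_dual [Finite C.L] (hT : C.IsCylNormal T) (hK : C.K.IsTame)
    (E : C.Asters) [∀ m l, CompactSpace (C.K.Hom m l)] :
    ∃ E' : C.dual.Asters, C.dual.IsCylNormalStellar E' := by
  have := hK.t2Space_hom
  have : ∀ m l, CompactSpace (C.K.op.Hom m l) := fun m l =>
    inferInstanceAs (CompactSpace (C.K.Hom l m))
  rw [C.dual_eq_transport]
  exact ⟨_, (hK.op.isCylNormalStellar (fun _ => toFinite _)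
    (hT.isParStratification_op E)).transport⟩

theorem exists_isCylNormalStellar_dual_dual [Finite C.L] (hT : C.IsCylNormal T)
    (hK : C.K.IsTame) (E : C.Asters) [∀ m l, CompactSpace (C.K.Hom m l)] :
    ∃ E' : C.dual.dual.Asters, C.dual.dual.IsCylNormalStellar E' := by
  have := hK.t2Space_hom
  rw [C.dual_dual_eq_transport]
  exact ⟨_, (hK.isCylNormalStellar (fun _ => toFinite _) (hT.isParStratification E)).transport⟩

end CylData.IsCylNormal

theorem mainTheorem4 {X : Type u} [TopologicalSpace X] (C : CylData X) (E : C.Asters)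
    (hC : C.IsCylNormalStellar E) :
    ((∀ m l, LocallyCompactSpace (C.K.Hom m l)) → C.Sal.IsCylNormalAbstractStellar) ∧
    (C.IsCW → C.IsRelativelyCompact →
      (∃ E' : C.Sal.Asters, C.Sal.IsCylNormalStellar E') ∧
      ∃ F : C.Sal.Morphism C (fun l => l), C.IsCanonical E F ∧ F.IsEmbedding) ∧
    (C.IsCW → C.AllCellsClosed E →
      (∃ E' : C.Sal.Asters, C.Sal.IsCylNormalStellar E') ∧
      ∃ F : C.Sal.Morphism C (fun l => l), C.IsCanonical E F ∧ F.IsIso) ∧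
    (Finite C.L → C.IsRelativelyCompact →
      (∃ E₁ : C.dual.Asters, C.dual.IsCylNormalStellar E₁) ∧
      (∃ E₂ : C.dual.dual.Asters, C.dual.dual.IsCylNormalStellar E₂) ∧
      ∃ F : C.Sal.Morphism C.dual.dual (fun l => l),
        F.IsIso ∧
        (∀ m l (p : C.K.Hom m l), F.par (m := m) (l := l) p = p) ∧
        (∀ l, F.dom l (C.Sal.center l) = C.dual.dual.center l) ∧
        ∀ (k : ℕ) (x : C.K.Nerve k) (t : stdSimplex ℝ (Fin (k + 1))),
          F.map (C.K.pt x t) = C.K.op.pt (C.K.nerveRev x) (stdSimplex.map Fin.rev t)) := by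
  obtain ⟨T, hT, dim, hd, -⟩ := hC
  have hK := hT.isTame E hd
  have := hK.t2Space_hom
  refine ⟨fun h => hK.isCylNormalAbstractStellar, fun hCW hR => ?_, fun hCW hcl => ?_,
    fun hfin hR => ?_⟩
  · have := hT.compactSpace_hom_of_isRelativelyCompact E hR
    have hl := hT.finite_nonempty_hom hCW
    exact ⟨hT.exists_isCylNormalStellar_sal hK E hl, hT.canonicalMorphism E hK,
      hT.isCanonical_canonicalMorphism hK,
      hT.isEmbedding_canonicalMorphism hK hCW fun l => hK.compactSpace_real (hl l)⟩
  · have := hT.compactSpace_hom_of_allCellsClosed hcl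
    have hl := hT.finite_nonempty_hom hCW
    exact ⟨hT.exists_isCylNormalStellar_sal hK E hl, hT.canonicalMorphism E hK,
      hT.isCanonical_canonicalMorphism hK,
      hT.isIso_canonicalMorphism hK hCW (fun l => hK.compactSpace_real (hl l)) hcl⟩
  · have := hT.compactSpace_hom_of_isRelativelyCompact E hR
    exact ⟨hT.exists_isCylNormalStellar_dual hK E, hT.exists_isCylNormalStellar_dual_dual hK E,
      C.dualDualMorphism, C.isIso_dualDualMorphism, fun _ _ _ => rfl,
      fun l => (C.dual.dual_center l).symm, fun _ _ _ => rfl⟩
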